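/- A circuit $\mathcal C$ is a directed acyclic graph in which the vertices of in-degree zero are the input gates $x_1,\dots,x_n$ and all other vertices are arithmetic gates; one or more (distinct) arithmetic gates are designated as the output gates $y_1,\dots,y_m$. Its size $|\mathcal C|$ is the number of its wires (edges). Each arithmetic gate adds up its predecessors, over the boolean semiring $(\{0,1\},\lor,\land)$ in an OR-circuit, over the semiring of non-negative integers in a SUM-circuit, and over $\mathrm{GF}(2)$ in a XOR-circuit; the circuit computes the matrix $A\in\{0,1\}^{m\times n}$ if it outputs $y=Ax$ over the respective semiring for every input vector $x$. The problem $(\mathrm X,\mathrm Y)$-Rewrite is: given an X-circuit $\mathcal C$ (with at least as many wires as inputs), output a Y-circuit that computes the same matrix; here it is required that such a Y-circuit is output for every such $\mathcal C$. Circuits are represented as lists of gates and wires in topological order, and time is measured on a random access machine (with logarithmic cost). The strong exponential time hypothesis (SETH) states that for every $\varepsilon>0$ there is a $k$ such that no algorithm decides the satisfiability of $k$-CNF formulas $\varphi$ with $n$ variables in time $2^{(1-\varepsilon)n}\,\mathrm{poly}(|\varphi|)$. The randomized SETH states the same for Monte Carlo algorithms (which never accept an unsatisfiable formula and accept each satisfiable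 one with probability at least $1/2$). **Theorem.** (a) If SETH holds for deterministic algorithms, then for no constant $\varepsilon>0$ can $(\mathrm{OR},\mathrm{SUM})$-Rewrite be solved by a deterministic algorithm in time $O(|\mathcal C|^{2-\varepsilon})$. (b) If the randomized SETH holds, then for no constant $\varepsilon>0$ can $(\mathrm{OR},\mathrm{XOR})$-Rewrite be solved by a deterministic algorithm in time $O(|\mathcal C|^{2-\varepsilon})$. -/

import Mathlib

open MeasureTheory

/-! ### Random access machines with logarithmic cost -/

namespace RAM

/-- Programs of a random access machine. The machine has registers (each program names only
finitely many of them) and an unbounded memory whose cells are addressed through registers; all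
of them hold natural numbers. Control flow is structured (`branch` and `loop` test a register for
being nonzero), which simulates jumps with constant overhead. -/
inductive Prog : Type
  /-- do nothing -/
  | skip : Prog
  /-- `const r c`: `r := c` -/
  | const : ℕ → ℕ → Prog
  /-- `add r a b`: `r := a + b` -/
  | add : ℕ → ℕ → ℕ → Prog
  /-- `sub r a b`: `r := max (a - b) 0` -/
  | sub : ℕ → ℕ → ℕ → Prog
  /-- `load r a`: `r := memory[a]` -/
  | load : ℕ → ℕ → Prog
  /-- `store a r`: `memory[a] := r` -/
  | store : ℕ → ℕ → Prog
  /-- `coin r`: `r := ` a fresh random bit -/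
  | coin : ℕ → Prog
  /-- `seq p q`: first `p`, then `q` -/
  | seq : Prog → Prog → Prog
  /-- `branch r p q`: if `r ≠ 0` then `p`, otherwise `q` -/
  | branch : ℕ → Prog → Prog → Prog
  /-- `loop r p`: while `r ≠ 0` do `p` -/
  | loop : ℕ → Prog → Prog

/-- A machine state: the registers, the memory, and the random bits not yet consumed. -/
structure State where
  reg : ℕ → ℕ
  mem : ℕ → ℕ
  coins : ℕ → Bool

/-- The state after writing the value `v` to the register `r`. -/
def State.setReg (s : State) (r v : ℕ) : State :=
  { s with reg := Function.update s.reg r v }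

/-- The state after writing the value `v` to the memory cell `a`. -/
def State.setMem (s : State) (a v : ℕ) : State :=
  { s with mem := Function.update s.mem a v }

/-- The state after moving the next random bit to the register `r`. -/
def State.flip (s : State) (r : ℕ) : State :=
  { s with
    reg := Function.update s.reg r (s.coins 0).toNat
    coins := fun i => s.coins (i + 1) }

/-- `p.Runs s t s'`: started in the state `s`, the program `p` halts in the state `s'`, and the
logarithmic cost of the computation is `t`: an instruction costs one plus the total number of
binary digits (`Nat.size`) of the numbers and the addresses that it handles. -/
inductive Prog.Runs : Prog → State → ℕ → State → Prop
  | skip (s : State) : Runs .skip s 1 s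
  | const (s : State) (r c : ℕ) : Runs (.const r c) s (1 + c.size) (s.setReg r c)
  | add (s : State) (r a b : ℕ) :
      Runs (.add r a b) s (1 + (s.reg a).size + (s.reg b).size)
        (s.setReg r (s.reg a + s.reg b))
  | sub (s : State) (r a b : ℕ) :
      Runs (.sub r a b) s (1 + (s.reg a).size + (s.reg b).size)
        (s.setReg r (s.reg a - s.reg b))
  | load (s : State) (r a : ℕ) :
      Runs (.load r a) s (1 + (s.reg a).size + (s.mem (s.reg a)).size)
        (s.setReg r (s.mem (s.reg a)))
  | store (s : State) (a r : ℕ) :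
      Runs (.store a r) s (1 + (s.reg a).size + (s.reg r).size)
        (s.setMem (s.reg a) (s.reg r))
  | coin (s : State) (r : ℕ) : Runs (.coin r) s 1 (s.flip r)
  | seq {p q : Prog} {s s₁ s₂ : State} {t₁ t₂ : ℕ} :
      Runs p s t₁ s₁ → Runs q s₁ t₂ s₂ → Runs (.seq p q) s (t₁ + t₂) s₂
  | branch_true {r : ℕ} {p q : Prog} {s s₁ : State} {t : ℕ} :
      s.reg r ≠ 0 → Runs p s t s₁ → Runs (.branch r p q) s (1 + (s.reg r).size + t) s₁
  | branch_false {r : ℕ} {p q : Prog} {s s₁ : State} {t : ℕ} :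
      s.reg r = 0 → Runs q s t s₁ → Runs (.branch r p q) s (1 + (s.reg r).size + t) s₁
  | loop_true {r : ℕ} {p : Prog} {s s₁ s₂ : State} {t₁ t₂ : ℕ} :
      s.reg r ≠ 0 → Runs p s t₁ s₁ → Runs (.loop r p) s₁ t₂ s₂ →
        Runs (.loop r p) s (1 + (s.reg r).size + t₁ + t₂) s₂
  | loop_false {r : ℕ} {p : Prog} {s : State} :
      s.reg r = 0 → Runs (.loop r p) s (1 + (s.reg r).size) s

/-- A program is deterministic if it does not use random bits. -/
def Prog.Deterministic : Prog → Prop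
  | .coin _ => False
  | .seq p q => p.Deterministic ∧ q.Deterministic
  | .branch _ p q => p.Deterministic ∧ q.Deterministic
  | .loop _ p => p.Deterministic
  | _ => True

/-- The initial state: the input word is stored in the memory cells `0, 1, 2, …`, all other cells
and all registers hold zero, and `ω` is the sequence of random bits. -/
def init (w : List ℕ) (ω : ℕ → Bool) : State where
  reg := fun _ => 0
  mem := fun i => w.getD i 0
  coins := ω

/-- The memory cells `0, 1, 2, …` of the state `s` hold the word `w` (followed by anything). -/
def State.Holds (s : State) (w : List ℕ) : Prop :=
  ∀ (i : ℕ) (h : i < w.length), s.mem i = w[i]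

/-- Independent fair random bits. -/
noncomputable def coinMeasure : Measure (ℕ → Bool) :=
  Measure.infinitePi (fun _ : ℕ => (PMF.uniformOfFintype Bool).toMeasure)

end RAM

/-! ### Circuits -/

/-- A directed acyclic graph with designated outputs, in topological order. The vertices are
`0, 1, 2, …`; the vertices below `inputs` are the input gates, and the `i`-th entry of `gates` is
the list of the vertices that have a wire to the arithmetic gate `inputs + i`. The list `outputs`
names the gates that compute the first, the second, … output. -/
structure Circuit where
  inputs : ℕ
  gates : List (List ℕ)
  outputs : List ℕ

namespace Circuit

/-- The wires of each arithmetic gate come from earlier gates, there is at least one of them, and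
there are no parallel wires; one or more arithmetic gates are designated as outputs. -/
def WellFormed (C : Circuit) : Prop :=
  (∀ (i : ℕ) (h : i < C.gates.length),
    C.gates[i] ≠ [] ∧ C.gates[i].Nodup ∧ ∀ p ∈ C.gates[i], p < C.inputs + i) ∧
  C.outputs ≠ [] ∧ C.outputs.Nodup ∧
  ∀ o ∈ C.outputs, C.inputs ≤ o ∧ o < C.inputs + C.gates.length

/-- The size of a circuit is the number of its wires. -/
def size (C : Circuit) : ℕ := (C.gates.map List.length).sum

/-- The representation of a circuit as a word: the number of input gates, the number of arithmetic
gates, for each arithmetic gate its fan-in and its predecessors, the number of outputs, and the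
output gates. -/
def encode (C : Circuit) : List ℕ :=
  C.inputs :: C.gates.length ::
    (C.gates.flatMap (fun ps => ps.length :: ps) ++ C.outputs.length :: C.outputs)

/-- The values of all gates on the input vector `x`, where each arithmetic gate adds up the values
of its predecessors with the operation `op`, whose neutral element is `z`. -/
def values {R : Type} (op : R → R → R) (z : R) (C : Circuit) (x : List R) : List R :=
  C.gates.foldl (fun vs ps => vs ++ [(ps.map (fun p => vs.getD p z)).foldr op z]) x

/-- The output vector of the circuit on the input vector `x`. -/
def eval {R : Type} (op : R → R → R) (z : R) (C : Circuit) (x : List R) : List R :=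
  C.outputs.map (fun o => (C.values op z x).getD o z)

/-- The circuit computes `y = A x` for the boolean matrix `A`: on every input vector `x`, the `i`-th
output is the sum (with respect to `op`) of the `x j` with `A i j = 1`. -/
def Computes {R : Type} (op : R → R → R) (z : R) (C : Circuit) {m n : ℕ}
    (A : Matrix (Fin m) (Fin n) Bool) : Prop :=
  C.inputs = n ∧ ∀ x : Fin n → R, C.eval op z (List.ofFn x) =
    List.ofFn (fun i => (List.ofFn (fun j => if A i j then x j else z)).foldr op z)

/-- `C`, read as an OR-circuit (over the boolean semiring), computes `A`. -/
def OrComputes (C : Circuit) {m n : ℕ} (A : Matrix (Fin m) (Fin n) Bool) : Prop :=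
  C.Computes (R := Bool) (fun a b => a || b) false A

/-- `C`, read as a SUM-circuit (over the semiring of non-negative integers), computes `A`. -/
def SumComputes (C : Circuit) {m n : ℕ} (A : Matrix (Fin m) (Fin n) Bool) : Prop :=
  C.Computes (R := ℕ) (fun a b => a + b) 0 A

/-- `C`, read as a XOR-circuit (over the field with two elements), computes `A`. -/
def XorComputes (C : Circuit) {m n : ℕ} (A : Matrix (Fin m) (Fin n) Bool) : Prop :=
  C.Computes (R := ZMod 2) (fun a b => a + b) 0 A

end Circuit

/-- The type of the relation "the circuit `C`, read in a certain circuit model, computes `A`". -/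
abbrev CircuitModel : Type :=
  Circuit → ∀ {m n : ℕ}, Matrix (Fin m) (Fin n) Bool → Prop

/-- The `(X, Y)`-Rewrite problem can be solved in time `O(|C| ^ e)`: a deterministic program turns
(the representation of) each `X`-circuit `C` into a `Y`-circuit that computes the same
matrix. Only circuits that have at least as many wires as inputs are considered as inputs. -/
def RewriteSolvable (X Y : CircuitModel) (e : ℝ) : Prop :=
  ∃ (P : RAM.Prog) (c : ℝ), P.Deterministic ∧
    ∀ C : Circuit, C.WellFormed → C.inputs ≤ C.size →
      ∀ (m n : ℕ) (A : Matrix (Fin m) (Fin n) Bool), X C A →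
        ∃ (t : ℕ) (s : RAM.State) (D : Circuit),
          P.Runs (RAM.init C.encode (fun _ => false)) t s ∧
          (t : ℝ) ≤ c * (C.size : ℝ) ^ e ∧
          D.WellFormed ∧ s.Holds D.encode ∧ Y D A

/-! ### Satisfiability and the strong exponential time hypothesis -/

/-- A formula in conjunctive normal form over the variables `0, …, vars - 1`: a list of clauses, each
of them a list of literals; the literal `(v, b)` is true if the variable `v` has the value `b`. -/
structure CNF where
  vars : ℕ
  clauses : List (List (Fin vars × Bool))

namespace CNF

/-- Some truth assignment satisfies a literal in each clause. -/
def Satisfiable (φ : CNF) : Prop :=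
  ∃ a : Fin φ.vars → Bool, ∀ cl ∈ φ.clauses, ∃ l ∈ cl, a l.1 = l.2

/-- Each clause has at most `k` literals. -/
def IsKCNF (k : ℕ) (φ : CNF) : Prop :=
  ∀ cl ∈ φ.clauses, cl.length ≤ k

/-- The representation of a formula as a word: the number of variables, the number of clauses, and
for each clause its length and its literals, where `(v, b)` is represented by `2 v + b`. -/
def encode (φ : CNF) : List ℕ :=
  φ.vars :: φ.clauses.length ::
    φ.clauses.flatMap (fun cl => cl.length :: cl.map (fun l => 2 * (l.1 : ℕ) + l.2.toNat))

/-- The number of variables plus the length of the representation. -/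
def size (φ : CNF) : ℕ := φ.vars + φ.encode.length

end CNF

/-- `k`-SAT can be decided deterministically in time `2 ^ (δ n) * poly(|φ|)`, where `n` is the number
of variables. The answer is given in the memory cell `0` (`1` for yes, `0` for no). -/
def KSatSolvable (k : ℕ) (δ : ℝ) : Prop :=
  ∃ (P : RAM.Prog) (c : ℕ), P.Deterministic ∧
    ∀ φ : CNF, φ.IsKCNF k →
      ∃ (t : ℕ) (s : RAM.State),
        P.Runs (RAM.init φ.encode (fun _ => false)) t s ∧
        (t : ℝ) ≤ c * (φ.size : ℝ) ^ c * (2 : ℝ) ^ (δ * φ.vars) ∧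
        (φ.Satisfiable → s.mem 0 = 1) ∧ (¬ φ.Satisfiable → s.mem 0 = 0)

/-- `k`-SAT can be decided by a Monte Carlo algorithm in time `2 ^ (δ n) * poly(|φ|)`: the time bound
holds for all outcomes of the random bits, unsatisfiable formulas are never accepted, and
satisfiable ones are accepted with probability at least one half. -/
def KSatSolvableRandomized (k : ℕ) (δ : ℝ) : Prop :=
  ∃ (P : RAM.Prog) (c : ℕ),
    ∀ φ : CNF, φ.IsKCNF k →
      (∀ ω : ℕ → Bool, ∃ (t : ℕ) (s : RAM.State),
        P.Runs (RAM.init φ.encode ω) t s ∧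
        (t : ℝ) ≤ c * (φ.size : ℝ) ^ c * (2 : ℝ) ^ (δ * φ.vars) ∧
        (s.mem 0 = 1 ∨ s.mem 0 = 0) ∧ (¬ φ.Satisfiable → s.mem 0 = 0)) ∧
      (φ.Satisfiable →
        1 / 2 ≤ RAM.coinMeasure
          {ω | ∃ (t : ℕ) (s : RAM.State), P.Runs (RAM.init φ.encode ω) t s ∧ s.mem 0 = 1})

/-- The strong exponential time hypothesis for deterministic algorithms: for each `ε > 0` there is a
`k` such that `k`-SAT cannot be decided in time `2 ^ ((1 - ε) n) * poly(|φ|)`. -/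
def SETH : Prop :=
  ∀ ε : ℝ, 0 < ε → ∃ k : ℕ, ¬ KSatSolvable k (1 - ε)

/-- The strong exponential time hypothesis for randomized algorithms. -/
def RandomizedSETH : Prop :=
  ∀ ε : ℝ, 0 < ε → ∃ k : ℕ, ¬ KSatSolvableRandomized k (1 - ε)

/-! Let `φ` have `n` variables and `m` clauses, put `h = ⌈n / 2⌉` and `N = 2 ^ h`, and split the
variables into the first `h` and the rest. Partial assignments `x` and `y` of the two halves
together falsify a clause iff each of them makes all literals of its own half false. Hence the
matrix with a one at `(y, x)` iff `x` and `y` jointly falsify some clause is the boolean product of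
an `N × m` and an `m × N` matrix. An OR-circuit with one gate per clause and one output per `y`
computes it with `O(m N)` wires, and `φ` is satisfiable iff the matrix has a zero
(`CNF.satisfiable_iff`, `satCircuit_orComputes`). An extra input, wired to every clause gate and
every output gate, adds a column of ones and keeps all fan-ins positive.

A circuit over a ring-like structure reveals a zero by a single evaluation. A SUM-circuit on the
all-ones vector outputs the row sums, and a row without zeros is one whose sum is the number of
inputs (`SumComputes.differs_iff`). A XOR-circuit on a random vector outputs sums over the supports
of the rows. A row without zeros always yields the sum of all inputs. If the row has a zero in
column `j`, flipping the `j`-th random bit changes the total but not the output, so the two differ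
with probability at least one half (`XorComputes.half_le_differs`).

If rewriting takes time `O(|C| ^ (2 - ε))`, then on this circuit it takes `poly(|φ|) * 2 ^ ((n / 2)
(2 - ε)) = poly(|φ|) * 2 ^ ((1 - ε / 2) n)` (`rpow_size_le`), and building the circuit costs only
`poly(|φ|) * 2 ^ (n / 2)`. The rewritten circuit is no longer than the time spent on it, up to a
constant (`length_encode_le_of_runs`), and it is evaluated with linearly many instructions modulo a
small number, so the whole procedure contradicts the hypothesis on `k`-SAT.

Most of the work is to carry this out on the machine. `Prog.Within` counts instructions under a
common bound `M` for all numbers that occur. Since `M` is chosen as `2 ^ O(|φ|)`, each instruction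
costs `O(|φ|)`, which the polynomial factor absorbs. `build` replaces the formula by the circuit,
`check` evaluates the rewritten circuit, and `exists_decider` joins them, with the modulus and the
generator of the inputs as parameters so that it serves both claims. -/

namespace RAM

@[simp] theorem State.setReg_reg (s : State) (r v a : ℕ) :
    (s.setReg r v).reg a = if a = r then v else s.reg a := by
  simp [State.setReg, Function.update_apply]

@[simp] theorem State.setReg_mem (s : State) (r v : ℕ) : (s.setReg r v).mem = s.mem := rfl

@[simp] theorem State.setReg_coins (s : State) (r v : ℕ) : (s.setReg r v).coins = s.coins := rfl

@[simp] theorem State.setMem_reg (s : State) (r v : ℕ) : (s.setMem r v).reg = s.reg := rfl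

@[simp] theorem State.setMem_coins (s : State) (r v : ℕ) : (s.setMem r v).coins = s.coins := rfl

@[simp] theorem State.setMem_mem (s : State) (a v b : ℕ) :
    (s.setMem a v).mem b = if b = a then v else s.mem b := by
  simp [State.setMem, Function.update_apply]

@[simp] theorem State.flip_reg (s : State) (r a : ℕ) :
    (s.flip r).reg a = if a = r then (s.coins 0).toNat else s.reg a := by
  simp [State.flip, Function.update_apply]

@[simp] theorem State.flip_mem (s : State) (r : ℕ) : (s.flip r).mem = s.mem := rfl

@[simp] theorem State.flip_coins (s : State) (r : ℕ) :
    (s.flip r).coins = fun i => s.coins (i + 1) := rfl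

theorem State.ext_iff' {s s' : State} :
    s = s' ↔ s.reg = s'.reg ∧ s.mem = s'.mem ∧ s.coins = s'.coins := by
  cases s; cases s'; simp

/-! ### A calculus for the cost of programs -/

namespace Prog

/-- Started in `s`, the program `p` halts in a state that satisfies `Q`, after `k` instructions that
handle numbers up to `M` only. -/
def Within (M : ℕ) (p : Prog) (s : State) (k : ℕ) (Q : State → Prop) : Prop :=
  ∃ t s', p.Runs s t s' ∧ t ≤ k * (1 + 2 * M.size) ∧ Q s'

/-- The number of instructions of a program without loops. -/
def steps : Prog → ℕ
  | .seq p q => p.steps + q.steps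
  | .branch _ p q => 1 + max p.steps q.steps
  | _ => 1

/-- The weakest precondition of a program without loops, with the requirement that the program
handles numbers up to `M` only. -/
def wp (M : ℕ) : Prog → (State → Prop) → State → Prop
  | .skip, Q, s => Q s
  | .const r c, Q, s => c ≤ M ∧ Q (s.setReg r c)
  | .add r a b, Q, s => s.reg a ≤ M ∧ s.reg b ≤ M ∧ Q (s.setReg r (s.reg a + s.reg b))
  | .sub r a b, Q, s => s.reg a ≤ M ∧ s.reg b ≤ M ∧ Q (s.setReg r (s.reg a - s.reg b))
  | .load r a, Q, s =>
      s.reg a ≤ M ∧ s.mem (s.reg a) ≤ M ∧ Q (s.setReg r (s.mem (s.reg a)))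
  | .store a r, Q, s => s.reg a ≤ M ∧ s.reg r ≤ M ∧ Q (s.setMem (s.reg a) (s.reg r))
  | .coin r, Q, s => Q (s.flip r)
  | .seq p q, Q, s => wp M p (wp M q Q) s
  | .branch r p q, Q, s =>
      s.reg r ≤ M ∧ (s.reg r ≠ 0 → wp M p Q s) ∧ (s.reg r = 0 → wp M q Q s)
  | .loop _ _, _, _ => False

variable {M : ℕ} {p q : Prog} {s : State} {k l : ℕ} {Q Q' : State → Prop}

theorem Within.mono (h : Within M p s k Q') (hk : k ≤ l) (hQ : ∀ s', Q' s' → Q s') :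
    Within M p s l Q := by
  obtain ⟨t, s', h, ht, hs⟩ := h
  exact ⟨t, s', h, ht.trans (Nat.mul_le_mul_right _ hk), hQ _ hs⟩

theorem Within.seq (h : Within M p s k Q') (h' : ∀ s', Q' s' → Within M q s' l Q) :
    Within M (.seq p q) s (k + l) Q := by
  obtain ⟨t, s', h, ht, hs⟩ := h
  obtain ⟨t', s'', h', ht', hs'⟩ := h' _ hs
  exact ⟨t + t', s'', h.seq h', by rw [add_mul]; omega, hs'⟩

/-- An instruction handles at most two numbers, both at most `M` by the precondition, so it costs at
most `1 + 2 * M.size`. Correctness and cost of loop-free code thus reduce to one computation of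
`wp`. -/
theorem Within.of_wp (h : wp M p Q s) : Within M p s p.steps Q := by
  induction p generalizing s Q with
  | skip => exact ⟨_, _, .skip s, by simp [steps], h⟩
  | const r c =>
    refine ⟨_, _, .const s r c, ?_, h.2⟩
    have := Nat.size_le_size h.1
    simp only [steps]; omega
  | add r a b =>
    refine ⟨_, _, .add s r a b, ?_, h.2.2⟩
    have := Nat.size_le_size h.1
    have := Nat.size_le_size h.2.1
    simp only [steps]; omega
  | sub r a b =>
    refine ⟨_, _, .sub s r a b, ?_, h.2.2⟩
    have := Nat.size_le_size h.1
    have := Nat.size_le_size h.2.1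
    simp only [steps]; omega
  | load r a =>
    refine ⟨_, _, .load s r a, ?_, h.2.2⟩
    have := Nat.size_le_size h.1
    have := Nat.size_le_size h.2.1
    simp only [steps]; omega
  | store a r =>
    refine ⟨_, _, .store s a r, ?_, h.2.2⟩
    have := Nat.size_le_size h.1
    have := Nat.size_le_size h.2.1
    simp only [steps]; omega
  | coin r => exact ⟨_, _, .coin s r, by simp [steps], h⟩
  | seq p q ihp ihq => exact (ihp h).seq fun s' hs' => ihq hs'
  | branch r p q ihp ihq =>
    have h1 := Nat.size_le_size h.1
    by_cases hr : s.reg r = 0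
    · obtain ⟨t, s', h', ht, hs⟩ := ihq (h.2.2 hr)
      refine ⟨_, s', .branch_false hr h', ?_, hs⟩
      have : q.steps * (1 + 2 * M.size) ≤ max p.steps q.steps * (1 + 2 * M.size) :=
        Nat.mul_le_mul_right _ (le_max_right _ _)
      simp only [steps, add_mul, one_mul]; omega
    · obtain ⟨t, s', h', ht, hs⟩ := ihp (h.2.1 hr)
      refine ⟨_, s', .branch_true hr h', ?_, hs⟩
      have : p.steps * (1 + 2 * M.size) ≤ max p.steps q.steps * (1 + 2 * M.size) :=
        Nat.mul_le_mul_right _ (le_max_left _ _)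
      simp only [steps, add_mul, one_mul]; omega
  | loop r p => exact h.elim

theorem Within.block (hk : p.steps ≤ k) (h : wp M p Q s) : Within M p s k Q :=
  (Within.of_wp h).mono hk fun _ h => h

/-- A block of instructions, followed by an arbitrary program. -/
theorem Within.block_seq (k : ℕ) (hk : p.steps + k ≤ l)
    (h : wp M p (fun s' => Within M q s' k Q) s) : Within M (.seq p q) s l Q :=
  ((Within.of_wp h).seq fun _ h => h).mono hk fun _ h => h

theorem Within.then (h : Within M p s k Q') {m : ℕ} (hk : k + l ≤ m)
    (h' : ∀ s', Q' s' → Within M q s' l Q) : Within M (.seq p q) s m Q :=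
  (h.seq h').mono hk fun _ h => h

theorem Within.branch {r : ℕ} (hr : s.reg r ≤ M) (h1 : s.reg r ≠ 0 → Within M p s k Q)
    (h0 : s.reg r = 0 → Within M q s k Q) : Within M (.branch r p q) s (k + 1) Q := by
  rw [add_comm]
  have hr := Nat.size_le_size hr
  by_cases h : s.reg r = 0
  · obtain ⟨t, s', h', ht, hs⟩ := h0 h
    exact ⟨_, s', .branch_false h h', by rw [add_mul]; omega, hs⟩
  · obtain ⟨t, s', h', ht, hs⟩ := h1 h
    exact ⟨_, s', .branch_true h h', by rw [add_mul]; omega, hs⟩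

/-- A loop that is executed `n` times, with the invariant `I`. -/
theorem Within.loop {r : ℕ} (I : ℕ → State → Prop) (n : ℕ) (k : ℕ → ℕ)
    (step : ∀ i < n, ∀ s, I i s → s.reg r ≠ 0 ∧ s.reg r ≤ M ∧ Within M p s (k i) (I (i + 1)))
    (exit : ∀ s, I n s → s.reg r = 0) (h : I 0 s) :
    Within M (.loop r p) s (∑ i ∈ Finset.range n, (k i + 1) + 1) (I n) := by
  induction n generalizing I k s with
  | zero =>
    refine ⟨_, s, .loop_false (exit s h), ?_, h⟩
    simp [exit s h]
  | succ n ih =>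
    obtain ⟨hr, hM, t, s', h', ht, hs⟩ := step 0 (by omega) s h
    obtain ⟨t', s'', h'', ht', hs'⟩ := ih (fun i => I (i + 1)) (fun i => k (i + 1))
      (fun i hi s h => step (i + 1) (by omega) s h) exit hs
    refine ⟨_, s'', .loop_true hr h' h'', ?_, hs'⟩
    have := Nat.size_le_size hM
    rw [Finset.sum_range_succ']
    simp only [add_mul, one_mul] at ht' ⊢
    omega

theorem Within.loop_const {r : ℕ} (I : ℕ → State → Prop) (n k : ℕ)
    (step : ∀ i < n, ∀ s, I i s → s.reg r ≠ 0 ∧ s.reg r ≤ M ∧ Within M p s k (I (i + 1)))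
    (exit : ∀ s, I n s → s.reg r = 0) (h : I 0 s) :
    Within M (.loop r p) s (n * (k + 1) + 1) (I n) := by
  simpa using Within.loop I n (fun _ => k) step exit h

/-- A deterministic program runs in the same way for all random bits. -/
theorem Runs.with_coins {t : ℕ} {s s' : State} (h : Runs p s t s') (hp : p.Deterministic)
    (ω : ℕ → Bool) : Runs p { s with coins := ω } t { s' with coins := ω } := by
  induction h with
  | skip s => exact .skip _
  | const s r c => exact .const { s with coins := ω } r c
  | add s r a b => exact .add { s with coins := ω } r a b
  | sub s r a b => exact .sub { s with coins := ω } r a b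
  | load s r a => exact .load { s with coins := ω } r a
  | store s a r => exact .store { s with coins := ω } a r
  | coin s r => exact hp.elim
  | seq _ _ ih1 ih2 => exact .seq (ih1 hp.1) (ih2 hp.2)
  | @branch_true r p q s s₁ t hr _ ih =>
    exact .branch_true (s := { s with coins := ω }) hr (ih hp.1)
  | @branch_false r p q s s₁ t hr _ ih =>
    exact .branch_false (s := { s with coins := ω }) hr (ih hp.2)
  | @loop_true r p s s₁ s₂ t₁ t₂ hr _ _ ih1 ih2 =>
    exact .loop_true (s := { s with coins := ω }) hr (ih1 hp) (ih2 hp)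
  | @loop_false r p s hr => exact .loop_false (s := { s with coins := ω }) hr

/-- A program that runs in time `t` fills at most `t` new memory cells. -/
theorem Runs.support {t : ℕ} {s s' : State} (h : Runs p s t s') (F : Finset ℕ)
    (hF : ∀ a, s.mem a ≠ 0 → a ∈ F) :
    ∃ F' : Finset ℕ, F'.card ≤ F.card + t ∧ ∀ a, s'.mem a ≠ 0 → a ∈ F' := by
  induction h generalizing F with
  | skip s => exact ⟨F, by omega, hF⟩
  | const s r c => exact ⟨F, by omega, hF⟩
  | add s r a b => exact ⟨F, by omega, hF⟩
  | sub s r a b => exact ⟨F, by omega, hF⟩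
  | load s r a => exact ⟨F, by omega, hF⟩
  | store s a r =>
    refine ⟨insert (s.reg a) F, (Finset.card_insert_le _ _).trans (by omega), fun b hb => ?_⟩
    by_cases h : b = s.reg a
    · simp [h]
    · simp only [State.setMem_mem, h, if_false] at hb
      exact Finset.mem_insert_of_mem (hF b hb)
  | coin s r => exact ⟨F, by omega, hF⟩
  | seq _ _ ih1 ih2 =>
    obtain ⟨F1, h1, h1'⟩ := ih1 F hF
    obtain ⟨F2, h2, h2'⟩ := ih2 F1 h1'
    exact ⟨F2, by omega, h2'⟩
  | branch_true hr _ ih =>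
    obtain ⟨F1, h1, h1'⟩ := ih F hF
    exact ⟨F1, by omega, h1'⟩
  | branch_false hr _ ih =>
    obtain ⟨F1, h1, h1'⟩ := ih F hF
    exact ⟨F1, by omega, h1'⟩
  | loop_true hr _ _ ih1 ih2 =>
    obtain ⟨F1, h1, h1'⟩ := ih1 F hF
    obtain ⟨F2, h2, h2'⟩ := ih2 F1 h1'
    exact ⟨F2, by omega, h2'⟩
  | loop_false hr => exact ⟨F, by omega, hF⟩

end Prog

/-- The states `s` and `s'` differ in registers below `k` only. -/
structure State.Frame (k : ℕ) (s s' : State) : Prop where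
  mem : s'.mem = s.mem
  coins : s'.coins = s.coins
  reg : ∀ r, k ≤ r → s'.reg r = s.reg r

/-- The memory cells from `b` on hold the word `l` (followed by anything). -/
def HoldsAt (mem : ℕ → ℕ) (b : ℕ) (l : List ℕ) : Prop :=
  ∀ (i : ℕ) (h : i < l.length), mem (b + i) = l[i]

theorem holdsAt_nil (mem : ℕ → ℕ) (b : ℕ) : HoldsAt mem b [] := by
  intro i h; simp at h

theorem holdsAt_cons {mem : ℕ → ℕ} {b a : ℕ} {l : List ℕ} :
    HoldsAt mem b (a :: l) ↔ mem b = a ∧ HoldsAt mem (b + 1) l := by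
  constructor
  · intro h
    refine ⟨h 0 (by simp), fun i hi => ?_⟩
    have := h (i + 1) (by simpa using hi)
    rw [add_right_comm, add_assoc]
    simpa using this
  · rintro ⟨h0, h1⟩ i hi
    cases i with
    | zero => simpa using h0
    | succ i =>
      have := h1 i (by simpa using hi)
      rw [add_right_comm, add_assoc] at this
      simpa using this

theorem holdsAt_append {mem : ℕ → ℕ} {b : ℕ} {l l' : List ℕ} :
    HoldsAt mem b (l ++ l') ↔ HoldsAt mem b l ∧ HoldsAt mem (b + l.length) l' := by
  induction l generalizing b with
  | nil => simp [holdsAt_nil]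
  | cons a l ih =>
    simp only [List.cons_append, holdsAt_cons, ih, List.length_cons, and_assoc]
    rw [show b + 1 + l.length = b + (l.length + 1) by omega]

theorem HoldsAt.congr {mem mem' : ℕ → ℕ} {b : ℕ} {l : List ℕ} (h : HoldsAt mem b l)
    (h' : ∀ a, b ≤ a → a < b + l.length → mem' a = mem a) : HoldsAt mem' b l := by
  intro i hi
  rw [h' _ (by omega) (by omega), h i hi]

end RAM

/-! ### Testing a clause under a partial assignment -/

namespace RAM

infixr:60 " ;; " => Prog.seq

/-- The literal `l = 2 v + b` of a formula is true under the partial assignment `x`. The partial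
assignment is a number below `N = 2 ^ h`; its binary digits, from the most significant one on, are
the values of the variables `v` with `off ≤ 2 v < off + H`, where `H = 2 h`. -/
def litTrue (N H off x l : ℕ) : Bool :=
  decide (off ≤ l ∧ l - off < H ∧
    (N ≤ 2 * ((2 ^ ((l - off) / 2) * x) % N) ↔ (l - off) % 2 = 1))

/-- No literal of the clause is true under the partial assignment `x`. -/
def falsifies (N H off x : ℕ) (cl : List ℕ) : Bool := cl.all fun l => !litTrue N H off x l

/-- The machine has neither division nor shifts. This is why digits are read from the most
significant one on: doubling modulo `N` needs only an addition and a conditional subtraction. -/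
theorem double_mod {N y : ℕ} (hy : y < N) :
    (2 * y) % N = if N ≤ 2 * y then 2 * y - N else 2 * y := by
  split_ifs with h
  · rw [Nat.mod_eq_sub_mod h, Nat.mod_eq_of_lt (by omega)]
  · rw [Nat.mod_eq_of_lt (by omega)]

/-- One step of `shift`. -/
def shiftBody : Prog :=
  .add 3 3 3 ;; .sub 0 15 3 ;; .branch 0 .skip (.sub 3 3 15) ;; .sub 2 2 18 ;; .sub 0 2 17

/-- Shift the number in register `3` by `v` digits to the left, modulo the power of two in register
`15`, if register `2` holds `2 v` or `2 v + 1`. -/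
def shift : Prog := .sub 0 2 17 ;; .loop 0 shiftBody

/-- For `d = 2 v + b`, counting down by two doubles `v` times and leaves the sign bit `b` of the
literal in register `2`. The number of instructions is linear in the literal, hence polynomial in
the size of the formula. -/
theorem shift_within {M N x d : ℕ} {s : State} (h2 : s.reg 2 = d) (h3 : s.reg 3 = x)
    (h15 : s.reg 15 = N) (h17 : s.reg 17 = 1) (h18 : s.reg 18 = 2) (hx : x < N)
    (hM : d + 2 * N + 2 ≤ M) :
    shift.Within M s (8 * d + 2) fun s' => State.Frame 4 s s' ∧ s'.reg 2 = d % 2 ∧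
      s'.reg 3 = (2 ^ (d / 2) * x) % N := by
  have hl : ∀ s1 : State, (State.Frame 4 s s1 ∧ s1.reg 2 = d ∧ s1.reg 3 = x ∧ s1.reg 0 = d - 1) →
      (Prog.loop 0 shiftBody).Within M s1 ((d / 2) * (7 + 1) + 1) fun s' =>
        State.Frame 4 s s' ∧ s'.reg 2 = d - 2 * (d / 2) ∧
        s'.reg 3 = (2 ^ (d / 2) * x) % N ∧ s'.reg 0 = d - 2 * (d / 2) - 1 := by
    intro s1 h1
    refine Prog.Within.loop_const (fun i s' => State.Frame 4 s s' ∧ s'.reg 2 = d - 2 * i ∧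
        s'.reg 3 = (2 ^ i * x) % N ∧ s'.reg 0 = d - 2 * i - 1) (d / 2) 7 ?_ ?_ ?_
    · rintro i hi s' ⟨hf, e2, e3, e0⟩
      have e15 := (hf.reg 15 (by omega)).trans h15
      have e17 := (hf.reg 17 (by omega)).trans h17
      have e18 := (hf.reg 18 (by omega)).trans h18
      have hlt : (2 ^ i * x) % N < N := Nat.mod_lt _ (by omega)
      have hmod : (2 ^ (i + 1) * x) % N = (2 * ((2 ^ i * x) % N)) % N := by
        rw [pow_succ', mul_assoc, Nat.mul_mod_mod]
      refine ⟨by omega, by omega, Prog.Within.block (by decide) ?_⟩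
      rw [hmod, double_mod hlt]
      set y := (2 ^ i * x) % N
      -- The postcondition is made opaque so that `simp` only executes the instructions. It is
      -- restored once the bounds on the numbers are discharged; the same device is used throughout.
      generalize hQ : (fun s' : State => (_ : Prop)) = Q
      simp [shiftBody, Prog.wp, e2, e3, e15, e17, e18]
      and_intros
      any_goals intro h
      any_goals and_intros
      any_goals omega
      all_goals rw [← hQ]
      · refine ⟨⟨hf.mem, hf.coins, fun r hr => ?_⟩, by simp; omega, ?_, by simp; omega⟩
        · have := hf.reg r hr
          simp [show r ≠ 0 by omega, show r ≠ 2 by omega, show r ≠ 3 by omega, this]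
        · simp; rw [if_neg (by omega)]; omega
      · refine ⟨⟨hf.mem, hf.coins, fun r hr => ?_⟩, by simp; omega, ?_, by simp; omega⟩
        · have := hf.reg r hr
          simp [show r ≠ 0 by omega, show r ≠ 2 by omega, show r ≠ 3 by omega, this]
        · simp; rw [if_pos (by omega)]; omega
    · rintro s' ⟨hf, e2, e3, e0⟩
      omega
    · refine ⟨h1.1, by simpa using h1.2.1, ?_, by simpa using h1.2.2.2⟩
      simpa [Nat.mod_eq_of_lt hx] using h1.2.2.1
  refine Prog.Within.block_seq ((d / 2) * (7 + 1) + 1) ?_ ?_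
  · simp [Prog.steps]; omega
  · simp [Prog.wp, h2, h17]
    refine ⟨by omega, by omega, (hl _ ?_).mono le_rfl ?_⟩
    · refine ⟨⟨rfl, rfl, fun r hr => ?_⟩, ?_⟩
      · simp [show r ≠ 0 by omega]
      · simp [h2, h3]
    · rintro s' ⟨hf, e2, e3, -⟩
      exact ⟨hf, by omega, e3⟩

/-- Clear register `6` if the literal to which register `5` points is true. -/
def testLit : Prog :=
  (.load 2 5 ;; .sub 0 14 2) ;;
  .branch 0 .skip ((.sub 2 2 14 ;; .sub 0 16 2) ;;
    .branch 0 ((.const 3 0 ;; .add 3 3 7) ;; shift ;;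
      (.add 3 3 3 ;; .sub 0 15 3 ;;
      .branch 0 (.branch 2 .skip (.const 6 0)) (.branch 2 (.const 6 0) .skip))) .skip)

/-- Register `6` accumulates a conjunction: it can only be cleared. A literal outside the window
`[off, off + H)` belongs to the other half and counts as not true. -/
theorem testLit_within {M N H x off l : ℕ} {s : State} (h5 : s.mem (s.reg 5) = l)
    (h7 : s.reg 7 = x) (h14 : s.reg 14 = off) (h15 : s.reg 15 = N) (h16 : s.reg 16 = H)
    (h17 : s.reg 17 = 1) (h18 : s.reg 18 = 2)
    (hx : x < N) (hM : l + 2 * N + 2 ≤ M) (h5M : s.reg 5 ≤ M) (hoff : off ≤ M) (hH : H ≤ M) :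
    testLit.Within M s (8 * l + 20) fun s' => s'.mem = s.mem ∧ s'.coins = s.coins ∧
      (∀ r, 4 ≤ r → r ≠ 6 → s'.reg r = s.reg r) ∧
      s'.reg 6 = if litTrue N H off x l then 0 else s.reg 6 := by
  set Q : State → Prop := fun s' => s'.mem = s.mem ∧ s'.coins = s.coins ∧
      (∀ r, 4 ≤ r → r ≠ 6 → s'.reg r = s.reg r) ∧
      s'.reg 6 = if litTrue N H off x l then 0 else s.reg 6 with hQ
  clear_value Q
  -- The two early exits, for a literal below or above the window.
  have hskip : ∀ s', (s'.mem = s.mem ∧ s'.coins = s.coins ∧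
      (∀ r, 4 ≤ r → s'.reg r = s.reg r)) → litTrue N H off x l = false → Q s' := by
    rintro s' ⟨e1, e2, e3⟩ hl
    rw [hQ]
    exact ⟨e1, e2, fun r hr _ => e3 r hr, by simp [hl, e3 6 (by omega)]⟩
  refine Prog.Within.block_seq (8 * l + 18) (by simp only [Prog.steps]; omega) ?_
  simp [Prog.wp, h5, h14]
  refine ⟨by omega, by omega, by omega, by omega, Prog.Within.branch (k := 8 * l + 17)
    (by simp; omega) (fun h => ?_) fun h => ?_⟩
  · refine Prog.Within.block (by simp [Prog.steps]) (hskip _ ⟨rfl, rfl, fun r hr => ?_⟩ ?_)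
    · simp [show r ≠ 0 by omega, show r ≠ 2 by omega]
    · simp at h
      simp [litTrue, show ¬ off ≤ l by omega]
  · simp at h
    refine Prog.Within.block_seq (8 * l + 15) (by simp only [Prog.steps]; omega) ?_
    simp [Prog.wp, h16, h14]
    refine ⟨by omega, by omega, by omega, by omega, Prog.Within.branch (k := 8 * l + 14)
      (by simp; omega) (fun h' => ?_) fun h' => ?_⟩
    swap
    · refine Prog.Within.block (by simp [Prog.steps]) (hskip _ ⟨rfl, rfl, fun r hr => ?_⟩ ?_)
      · simp [show r ≠ 0 by omega, show r ≠ 2 by omega]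
      · simp at h'
        simp [litTrue, show ¬ l - off < H by omega]
    · simp at h'
      refine Prog.Within.block_seq (8 * l + 12) (by simp only [Prog.steps]; omega) ?_
      simp [Prog.wp, h7]
      refine ⟨by omega, (shift_within (d := l - off) (x := x) (N := N) ?_ ?_ ?_ ?_ ?_ hx
        (by omega)).then (l := 5) (by omega) ?_⟩
      all_goals try simp [h15, h17, h18]
      intro s' hf e2 e3
      have e15 : s'.reg 15 = N := by rw [hf.reg 15 (by omega)]; simp [h15]
      have hlt : s'.reg 3 < N := by rw [e3]; exact Nat.mod_lt _ (by omega)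
      have hreg : ∀ r, 4 ≤ r → s'.reg r = s.reg r := by
        intro r hr
        rw [hf.reg r hr]
        simp [show r ≠ 0 by omega, show r ≠ 2 by omega, show r ≠ 3 by omega]
      have hlit : litTrue N H off x l = decide (N ≤ 2 * s'.reg 3 ↔ s'.reg 2 = 1) := by
        simp [litTrue, e2, e3, show off ≤ l by omega, show l - off < H by omega]
      have h2 : s'.reg 2 < 2 := by rw [e2]; exact Nat.mod_lt _ (by omega)
      clear e2 e3
      refine Prog.Within.block (by decide) ?_
      simp [Prog.wp, e15]
      and_intros
      any_goals intro h
      any_goals and_intros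
      any_goals intro h
      any_goals omega
      all_goals
        simp only [hQ, hlit]
        refine ⟨by simpa using hf.mem, by simpa using hf.coins, fun r hr hr6 => ?_, ?_⟩
        · simp [show r ≠ 0 by omega, show r ≠ 3 by omega, hr6, hreg r hr]
        · simp [hreg]
          try omega

/-- The registers that hold the constants `N`, `H`, `1` and `2`. -/
structure State.Consts (N H : ℕ) (s : State) : Prop where
  reg15 : s.reg 15 = N
  reg16 : s.reg 16 = H
  reg17 : s.reg 17 = 1
  reg18 : s.reg 18 = 2

theorem State.Consts.congr {N H : ℕ} {s s' : State} (h : s.Consts N H)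
    (h' : ∀ r, 15 ≤ r → r ≤ 18 → s'.reg r = s.reg r) : s'.Consts N H :=
  ⟨(h' _ (by omega) (by omega)).trans h.reg15, (h' _ (by omega) (by omega)).trans h.reg16,
    (h' _ (by omega) (by omega)).trans h.reg17, (h' _ (by omega) (by omega)).trans h.reg18⟩

/-- Set register `6` to `1` if the clause to which register `8` points is falsified, and to `0`
otherwise. -/
def testClause : Prog :=
  (.const 6 1 ;; .load 4 8 ;; .add 5 8 17) ;; .loop 4 (testLit ;; (.add 5 5 17 ;; .sub 4 4 17))

theorem testClause_within {M N H x off p K : ℕ} {cl : List ℕ} {s : State} (hc : s.Consts N H)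
    (h7 : s.reg 7 = x) (h8 : s.reg 8 = p) (h14 : s.reg 14 = off)
    (hcl : HoldsAt s.mem p (cl.length :: cl))
    (hx : x < N) (hK : ∀ l ∈ cl, l ≤ K) (hlen : cl.length ≤ K)
    (hM : K + 2 * N + 2 ≤ M) (hpM : p + 1 + K ≤ M) (hoff : off ≤ M) (hH : H ≤ M) :
    testClause.Within M s (K * (8 * K + 23) + 4) fun s' => State.Frame 7 s s' ∧
      s'.reg 6 = (falsifies N H off x cl).toNat := by
  obtain ⟨hp, hcl⟩ := holdsAt_cons.1 hcl
  refine Prog.Within.block_seq (K * (8 * K + 23) + 1) (by simp only [Prog.steps]; omega) ?_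
  generalize hQ : Prog.Within M (Prog.loop 4 _) = Q
  simp [Prog.wp, h8, hc.reg17, hp]
  and_intros
  any_goals omega
  rw [← hQ]
  refine (Prog.Within.loop_const (fun i s' => State.Frame 7 s s' ∧ s'.reg 4 = cl.length - i ∧
    s'.reg 5 = p + 1 + i ∧ s'.reg 6 = (falsifies N H off x (cl.take i)).toNat) cl.length
    (8 * K + 22) ?_ ?_ ?_).mono ?_ ?_
  · rintro i hi s' ⟨hf, e4, e5, e6⟩
    have hc' := hc.congr fun r h1 h2 => hf.reg r (by omega)
    refine ⟨by omega, by omega, (testLit_within (N := N) (H := H) (x := x) (off := off)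
      (l := cl[i]) ?_ ?_ ?_ hc'.reg15 hc'.reg16 hc'.reg17 hc'.reg18 hx ?_ ?_ hoff hH).then
      (l := 2) ?_ ?_⟩
    · rw [e5, hf.mem, hcl]
    · rw [hf.reg 7 (by omega), h7]
    · rw [hf.reg 14 (by omega), h14]
    · have := hK cl[i] (by simp)
      omega
    · omega
    · have := hK cl[i] (by simp)
      omega
    · rintro s'' ⟨f1, f2, f3, f4⟩
      refine Prog.Within.block (by decide) ?_
      have g4 := f3 4 (by omega) (by omega)
      have g5 := f3 5 (by omega) (by omega)
      have g17 := (f3 17 (by omega) (by omega)).trans hc'.reg17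
      generalize hQ : (fun s' : State => (_ : Prop)) = Q
      simp [Prog.wp, g4, g5, g17]
      and_intros
      any_goals omega
      rw [← hQ]
      refine ⟨⟨f1.trans hf.mem, f2.trans hf.coins, fun r hr => ?_⟩, ?_, ?_, ?_⟩
      · simp [show r ≠ 4 by omega, show r ≠ 5 by omega, f3 r (by omega) (by omega), hf.reg r hr]
      · simp; omega
      · simp; omega
      · have ht : cl.take (i + 1) = cl.take i ++ [cl[i]] := by simp
        have h6 : falsifies N H off x (cl.take (i + 1)) =
            (falsifies N H off x (cl.take i) && !litTrue N H off x cl[i]) := by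
          rw [falsifies, ht, List.all_append]; simp [falsifies]
        rw [h6]
        by_cases hl : litTrue N H off x cl[i] <;> simp [hl, f4, e6]
  · rintro s' ⟨hf, e4, e5, e6⟩
    omega
  · refine ⟨⟨rfl, rfl, fun r hr => ?_⟩, ?_, ?_, ?_⟩
    · simp [show r ≠ 4 by omega, show r ≠ 5 by omega, show r ≠ 6 by omega]
    · simp
    · simp
    · simp [falsifies]
  · exact Nat.add_le_add_right (Nat.mul_le_mul_right (8 * K + 23) hlen) 1
  · rintro s' ⟨hf, e4, e5, e6⟩
    exact ⟨hf, by simpa using e6⟩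

end RAM

/-! ### Writing a single gate -/

namespace RAM

/-- Between the states `s` and `s'`, the word `l` has been written to the memory from the address in
register `9` on, and this register has been advanced. Nothing below has been changed, and at most
one cell above. -/
structure State.Emits (l : List ℕ) (s s' : State) : Prop where
  coins : s'.coins = s.coins
  reg : s'.reg 9 = s.reg 9 + l.length
  holds : HoldsAt s'.mem (s.reg 9) l
  low : ∀ a < s.reg 9, s'.mem a = s.mem a
  high : ∀ a > s.reg 9 + l.length, s'.mem a = s.mem a

theorem State.Emits.of_mem {s s' : State} (h : s'.mem = s.mem) (hc : s'.coins = s.coins)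
    (h9 : s'.reg 9 = s.reg 9) : s.Emits [] s' :=
  ⟨hc, by simp [h9], holdsAt_nil _ _, fun a _ => by rw [h], fun a _ => by rw [h]⟩

/-- The only cell above its output that the first phase may spoil is the one where the second phase
starts writing, so still at most one cell above the joint output is spoiled. -/
theorem State.Emits.trans {l l' : List ℕ} {s s' s'' : State} (h : s.Emits l s')
    (h' : s'.Emits l' s'') : s.Emits (l ++ l') s'' := by
  have hr := h.reg
  refine ⟨h'.coins.trans h.coins, ?_, holdsAt_append.2 ⟨?_, ?_⟩, fun a ha => ?_, fun a ha => ?_⟩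
  · rw [h'.reg, hr, List.length_append]; omega
  · exact h.holds.congr fun a _ ha => h'.low a (by omega)
  · rw [← hr]; exact h'.holds
  · rw [h'.low a (by omega), h.low a ha]
  · rw [List.length_append] at ha
    rw [h'.high a (by omega), h.high a (by omega)]

/-- Test the current clause, append the number in register `10` to the output if the clause is
falsified, and advance. -/
def selectBody (adv : Prog) : Prog :=
  testClause ;; (.store 9 10 ;; .add 9 9 6 ;; .add 10 10 17 ;; .sub 11 11 17) ;; adv

/-- The program `adv` replaces the numbers `x` and `p` in the registers `7` and `8` by `x'` and `p'`,
in every state that agrees with `s` up to the address `w`. -/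
def Advances (M : ℕ) (adv : Prog) (mem : ℕ → ℕ) (w x p x' p' : ℕ) : Prop :=
  ∀ s : State, (∀ a < w, s.mem a = mem a) → s.reg 7 = x → s.reg 8 = p → s.reg 17 = 1 →
    adv.Within M s 3 fun s' => s'.mem = s.mem ∧ s'.coins = s.coins ∧ s'.reg 7 = x' ∧
      s'.reg 8 = p' ∧ ∀ r, 9 ≤ r → s'.reg r = s.reg r

/-- The candidate `g + i` is stored unconditionally and the write pointer advances by the truth
value of the test, so a rejected candidate is overwritten by the next one. A last rejected candidate
is the spoiled cell that `State.Emits` tolerates. Letting both `x` and `p` depend on `i` covers the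
gates that scan partial assignments as well as those that scan clauses. -/
theorem selectLoop_within {M N H off K n g w : ℕ} {cl : ℕ → List ℕ} {x p : ℕ → ℕ} {adv : Prog}
    {s : State} (hc : s.Consts N H) (h7 : s.reg 7 = x 0) (h8 : s.reg 8 = p 0)
    (h9 : s.reg 9 = w) (h10 : s.reg 10 = g) (h11 : s.reg 11 = n) (h14 : s.reg 14 = off)
    (hcl : ∀ i < n, HoldsAt s.mem (p i) ((cl i).length :: cl i) ∧ p i + 1 + (cl i).length ≤ w ∧
      p i + 1 + K ≤ M)
    (hadv : ∀ i < n, Advances M adv s.mem w (x i) (p i) (x (i + 1)) (p (i + 1)))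
    (hx : ∀ i < n, x i < N) (hK : ∀ i < n, ∀ l ∈ cl i, l ≤ K) (hlen : ∀ i < n, (cl i).length ≤ K)
    (hM : K + 2 * N + 2 ≤ M) (hw : w + n ≤ M) (hg : g + n ≤ M)
    (hoff : off ≤ M) (hH : H ≤ M) :
    (Prog.loop 11 (selectBody adv)).Within M s (n * (K * (8 * K + 23) + 12) + 1) fun s' =>
      s.Emits (((List.range n).filter fun i => falsifies N H off (x i) (cl i)).map (g + ·)) s' ∧
      s'.reg 7 = x n ∧ s'.reg 8 = p n ∧ ∀ r, 12 ≤ r → s'.reg r = s.reg r := by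
  refine (Prog.Within.loop_const (fun i s' => s.Emits (((List.range i).filter
      fun i => falsifies N H off (x i) (cl i)).map (g + ·)) s' ∧
      s'.reg 7 = x i ∧ s'.reg 8 = p i ∧ s'.reg 10 = g + i ∧ s'.reg 11 = n - i ∧
      ∀ r, 12 ≤ r → s'.reg r = s.reg r) n (K * (8 * K + 23) + 11) ?_ ?_ ?_).mono le_rfl ?_
  · rintro i hi s' ⟨he, e7, e8, e10, e11, hr⟩
    have hc' := hc.congr fun r h1 h2 => hr r (by omega)
    obtain ⟨hcl1, hcl2, hcl3⟩ := hcl i hi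
    have e9 := he.reg
    have hlenf : (((List.range i).filter
      fun i => falsifies N H off (x i) (cl i)).map (g + ·)).length ≤ i := by
      simpa using List.length_filter_le (fun i => falsifies N H off (x i) (cl i)) (List.range i)
    set L := ((List.range i).filter fun i => falsifies N H off (x i) (cl i)).map (g + ·) with hL
    refine ⟨by omega, by omega, (testClause_within (K := K) hc' e7 e8 ((hr 14 (by omega)).trans h14)
      (hcl1.congr fun a h1 h2 => he.low a ?_) (hx i hi) (hK i hi) (hlen i hi) hM hcl3 hoff
      hH).then (l := 7) (by omega) ?_⟩
    · simp at h2; omega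
    · rintro s1 ⟨hf, e6⟩
      have g7 := (hf.reg 7 (by omega)).trans e7
      have g8 := (hf.reg 8 (by omega)).trans e8
      have g9 := (hf.reg 9 (by omega)).trans e9
      have g10 := (hf.reg 10 (by omega)).trans e10
      have g11 := (hf.reg 11 (by omega)).trans e11
      have g17 := (hf.reg 17 (by omega)).trans hc'.reg17
      have hb := Bool.toNat_le (falsifies N H off (x i) (cl i))
      refine Prog.Within.block_seq 3 (by decide) ?_
      generalize hQ : Prog.Within M adv = Q
      simp [Prog.wp, g9, g10, g11, g17, e6]
      and_intros
      any_goals omega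
      rw [← hQ]
      refine (hadv i hi _ ?_ ?_ ?_ ?_).mono le_rfl ?_
      · intro a ha
        simp [show a ≠ s.reg 9 + L.length by omega]
        rw [hf.mem, he.low a (by omega)]
      · simp [g7]
      · simp [g8]
      · simp [g17]
      · rintro s2 ⟨k1, k2, k7, k8, kr⟩
        refine ⟨?_, k7, k8, ?_, ?_, ?_⟩
        · rw [List.range_succ, List.filter_append, List.map_append]
          refine he.trans ⟨?_, ?_, ?_, ?_, ?_⟩
          · rw [k2]; simp [hf.coins]
          · rw [kr 9 (by omega)]
            by_cases hfal : falsifies N H off (x i) (cl i) <;> simp [hfal, e9]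
          · rw [k1]
            by_cases hfal : falsifies N H off (x i) (cl i)
            · simp [hfal, holdsAt_cons, holdsAt_nil, e9]
            · simp [hfal, holdsAt_nil]
          · intro a ha
            rw [k1]
            simp [hf.mem, show a ≠ s.reg 9 + L.length by omega]
          · intro a ha
            rw [k1]
            simp [hf.mem, show a ≠ s.reg 9 + L.length by omega]
        · rw [kr 10 (by omega)]; simp; omega
        · rw [kr 11 (by omega)]; simp; omega
        · intro r h12
          rw [kr r (by omega)]
          simp [show r ≠ 9 by omega, show r ≠ 10 by omega, show r ≠ 11 by omega,
            hf.reg r (by omega), hr r h12]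
  · rintro s' ⟨-, -, -, -, e11, -⟩
    omega
  · exact ⟨State.Emits.of_mem rfl rfl rfl, h7, h8, h10, h11, fun r _ => rfl⟩
  · rintro s' ⟨he, e7, e8, e10, e11, hr⟩
    exact ⟨he, e7, e8, hr⟩

/-- The start and the end of the representation of a gate. -/
def openGate : Prog :=
  .const 12 0 ;; .add 12 12 9 ;; .add 9 9 17 ;; .store 9 15 ;; .add 9 9 17

/-- Write the fan-in of a gate. -/
def closeGate : Prog := .sub 0 9 12 ;; .sub 0 0 17 ;; .store 12 0

/-- Write a gate whose predecessors are the vertex `N` and the selected vertices. -/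
def gate (adv : Prog) : Prog := openGate ;; .loop 11 (selectBody adv) ;; closeGate

/-- The predecessors of a gate that is written by `gate`. -/
def gatePreds (N g n : ℕ) (f : ℕ → Bool) : List ℕ := N :: ((List.range n).filter f).map (g + ·)

theorem length_gatePreds_le (N g n : ℕ) (f : ℕ → Bool) : (gatePreds N g n f).length ≤ n + 1 := by
  simpa [gatePreds] using List.length_filter_le f (List.range n)

/-- The fan-in precedes the predecessors in the encoding but is known only after them. Cell `w` is
therefore left open and filled at the end with the distance covered by the write pointer. The first
predecessor is always the vertex `N`. -/
theorem gate_within {M N H off K n g w : ℕ} {cl : ℕ → List ℕ} {x p : ℕ → ℕ} {adv : Prog}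
    {s : State} (hc : s.Consts N H) (h7 : s.reg 7 = x 0) (h8 : s.reg 8 = p 0)
    (h9 : s.reg 9 = w) (h10 : s.reg 10 = g) (h11 : s.reg 11 = n) (h14 : s.reg 14 = off)
    (hcl : ∀ i < n, HoldsAt s.mem (p i) ((cl i).length :: cl i) ∧ p i + 1 + (cl i).length ≤ w ∧
      p i + 1 + K ≤ M)
    (hadv : ∀ i < n, Advances M adv s.mem w (x i) (p i) (x (i + 1)) (p (i + 1)))
    (hx : ∀ i < n, x i < N) (hK : ∀ i < n, ∀ l ∈ cl i, l ≤ K) (hlen : ∀ i < n, (cl i).length ≤ K)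
    (hM : K + 2 * N + 2 ≤ M) (hw : w + 2 + n ≤ M) (hg : g + n ≤ M)
    (hoff : off ≤ M) (hH : H ≤ M) :
    (gate adv).Within M s (n * (K * (8 * K + 23) + 12) + 9) fun s' =>
      s.Emits ((gatePreds N g n fun i => falsifies N H off (x i) (cl i)).length ::
        gatePreds N g n fun i => falsifies N H off (x i) (cl i)) s' ∧
      s'.reg 7 = x n ∧ s'.reg 8 = p n ∧ ∀ r, 13 ≤ r → s'.reg r = s.reg r := by
  refine Prog.Within.block_seq (n * (K * (8 * K + 23) + 12) + 4)
    (by simp only [openGate, Prog.steps]; omega) ?_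
  generalize hQ : Prog.Within M (_ ;; _) = Q
  simp [openGate, Prog.wp, h9, hc.reg17, hc.reg15]
  and_intros
  any_goals omega
  rw [← hQ]
  have hmem : ∀ a < w, ((((((s.setReg 12 0).setReg 12 w).setReg 9 (w + 1)).setMem (w + 1)
      N).setReg 9 (w + 1 + 1))).mem a = s.mem a := by
    intro a ha
    simp [show a ≠ w + 1 by omega]
  refine (selectLoop_within (K := K) (n := n) (g := g) (w := w + 2) (cl := cl) (x := x) (p := p)
    (off := off) (hc.congr fun r hr _ => ?_) ?_ ?_ ?_ ?_ ?_ ?_ ?_ ?_ hx hK hlen hM hw hg hoff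
    hH).then (l := 3) (by omega) ?_
  · simp [show r ≠ 9 by omega, show r ≠ 12 by omega]
  · simp [h7]
  · simp [h8]
  · simp
  · simp [h10]
  · simp [h11]
  · simp [h14]
  · intro i hi
    obtain ⟨k1, k2, k3⟩ := hcl i hi
    exact ⟨k1.congr fun a _ ha => hmem a (by simp at ha; omega), by omega, k3⟩
  · intro i hi s' hs'
    exact hadv i hi s' fun a ha => (hs' a (by omega)).trans (hmem a ha)
  · rintro s' ⟨he, e7, e8, hr⟩
    have e9 := he.reg
    have e12 := hr 12 (by omega)
    have e17 := hr 17 (by omega)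
    simp at e9 e12 e17
    rw [hc.reg17] at e17
    have hlenf := List.length_filter_le (fun i => falsifies N H off (x i) (cl i)) (List.range n)
    simp at hlenf
    refine Prog.Within.block (by decide) ?_
    generalize hQ : (fun s' : State => (_ : Prop)) = Q
    simp [closeGate, Prog.wp, e9, e12, e17]
    and_intros
    any_goals omega
    rw [← hQ]
    refine ⟨⟨?_, ?_, ?_, ?_, ?_⟩, ?_, ?_, ?_⟩
    · simp [he.coins]
    · simp [e9, h9, gatePreds]; omega
    · rw [h9, gatePreds, holdsAt_cons, holdsAt_cons]
      refine ⟨?_, ?_, ?_⟩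
      · simp; omega
      · simp
        rw [he.low _ (by simp)]
        simp
      · have := he.holds
        simp at this
        refine this.congr fun a h1 h2 => ?_
        simp [show a ≠ w by omega]
    · intro a ha
      simp [show a ≠ w by omega]
      rw [he.low a (by simp; omega)]
      exact hmem a (by omega)
    · intro a ha
      simp [gatePreds] at ha
      simp [show a ≠ w by omega]
      rw [he.high a (by simp; omega)]
      simp [show a ≠ w + 1 by omega]
    · simp [e7]
    · simp [e8]
    · intro r h13
      simp [show r ≠ 0 by omega]
      rw [hr r (by omega)]
      simp [show r ≠ 9 by omega, show r ≠ 12 by omega]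

end RAM

/-! ### Writing the two layers of gates -/

namespace RAM

/-- A list, preceded by its length. -/
def withLength (l : List ℕ) : List ℕ := l.length :: l

@[simp] theorem length_withLength (l : List ℕ) : (withLength l).length = l.length + 1 := rfl

/-- The `i`-th list of a list of lists. -/
def nthList (cls : List (List ℕ)) (i : ℕ) : List ℕ := cls.getD i []

/-- The representation of the formula with `n` variables and the clauses `cls`. -/
def formulaWord (n : ℕ) (cls : List (List ℕ)) : List ℕ :=
  n :: cls.length :: cls.flatMap withLength

/-- The address of the `i`-th list in the representation of a list of lists that starts at the
address `2`. -/
def listPos (cls : List (List ℕ)) (i : ℕ) : ℕ := 2 + ((cls.take i).flatMap withLength).length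

@[simp] theorem listPos_zero (cls : List (List ℕ)) : listPos cls 0 = 2 := rfl

theorem listPos_succ {cls : List (List ℕ)} {i : ℕ} (hi : i < cls.length) :
    listPos cls (i + 1) = listPos cls i + 1 + (nthList cls i).length := by
  have : cls.take (i + 1) = cls.take i ++ [cls[i]] := by simp
  rw [listPos, this, List.flatMap_append, List.length_append]
  simp only [List.flatMap_singleton, length_withLength, listPos, nthList,
    List.getD_eq_getElem _ _ hi]
  omega

theorem listPos_length (n : ℕ) (cls : List (List ℕ)) :
    listPos cls cls.length = (formulaWord n cls).length := by
  simp [listPos, formulaWord]; omega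

theorem listPos_le (cls : List (List ℕ)) {i : ℕ} (hi : i ≤ cls.length) :
    listPos cls i ≤ listPos cls cls.length := by
  induction hi using Nat.decreasingInduction with
  | of_succ k hk ih => rw [listPos_succ hk] at ih; omega
  | self => exact le_rfl

theorem holdsAt_listPos {mem : ℕ → ℕ} {cls : List (List ℕ)}
    (h : HoldsAt mem 2 (cls.flatMap withLength)) {i : ℕ} (hi : i < cls.length) :
    HoldsAt mem (listPos cls i) (withLength (nthList cls i)) := by
  have hs : cls = cls.take i ++ cls[i] :: cls.drop (i + 1) := by simp
  rw [hs, List.flatMap_append, holdsAt_append, List.flatMap_cons, holdsAt_append] at h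
  rw [nthList, List.getD_eq_getElem _ _ hi]
  exact h.2.1

/-- Advance register `8` from one list to the next one. -/
def nextList : Prog := .load 0 8 ;; .add 8 8 0 ;; .add 8 8 17

/-- Lists are stored behind their lengths, so the pointer moves by the entry it points to, plus one.
The header of a formula and that of a circuit both have two cells, so the same program scans clauses
and gates. -/
theorem advances_nextList {M w x i : ℕ} {mem : ℕ → ℕ} {cls : List (List ℕ)}
    (h : HoldsAt mem 2 (cls.flatMap withLength)) (hi : i < cls.length)
    (hw : listPos cls cls.length ≤ w) (hM : listPos cls cls.length ≤ M) :
    Advances M nextList mem w x (listPos cls i) x (listPos cls (i + 1)) := by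
  intro s hs h7 h8 h17
  have hle := listPos_le cls (i := i + 1) (by omega)
  have hsucc := listPos_succ hi
  have hmem : s.mem (listPos cls i) = (nthList cls i).length := by
    rw [hs _ (by omega)]
    exact (holdsAt_cons.1 (holdsAt_listPos h hi)).1
  refine Prog.Within.block (by decide) ?_
  generalize hQ : (fun s' : State => (_ : Prop)) = Q
  simp [nextList, Prog.wp, h8, h17, hmem]
  and_intros
  any_goals omega
  rw [← hQ]
  refine ⟨by simp, by simp, by simp [h7], by simp; omega, fun r hr => ?_⟩
  simp [show r ≠ 0 by omega, show r ≠ 8 by omega]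

theorem advances_input {M w x p : ℕ} {mem : ℕ → ℕ} (hM : x < M) :
    Advances M (.add 7 7 17) mem w x p (x + 1) p := by
  intro s hs h7 h8 h17
  refine Prog.Within.block (by decide) ?_
  simp [Prog.wp, h7, h8, h17]
  exact ⟨by omega, by omega, fun r h1 h2 => by omega⟩

/-- Write the gates for the clauses. -/
def leftGates : Prog :=
  .loop 13 ((.const 7 0 ;; .const 10 0 ;; .const 11 0 ;; .add 11 11 15) ;; gate (.add 7 7 17) ;;
    (nextList ;; .sub 13 13 17))

/-- The predecessors of the gate for the `j`-th clause. -/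
def leftPreds (N H : ℕ) (cls : List (List ℕ)) (j : ℕ) : List ℕ :=
  gatePreds N 0 N fun x => falsifies N H 0 x (nthList cls j)

/-- The predecessors of the gate for the partial assignment `y`. -/
def rightPreds (N H : ℕ) (cls : List (List ℕ)) (y : ℕ) : List ℕ :=
  gatePreds N (N + 1) cls.length fun j => falsifies N H H y (nthList cls j)

theorem length_flatMap_range_le {f : ℕ → List ℕ} {n k : ℕ} (h : ∀ i, (f i).length ≤ k) :
    ((List.range n).flatMap f).length ≤ n * k := by
  induction n with
  | zero => simp
  | succ n ih =>
    rw [List.range_succ, List.flatMap_append, List.length_append, add_mul]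
    simpa using add_le_add ih (h n)

theorem nthList_mem_or (cls : List (List ℕ)) (i : ℕ) : nthList cls i ∈ cls ∨ nthList cls i = [] := by
  by_cases hi : i < cls.length
  · left; rw [nthList, List.getD_eq_getElem _ _ hi]; exact List.getElem_mem hi
  · right; rw [nthList, List.getD_eq_default _ _ (by omega)]

/-- In each round the clause pointer is fixed while `x` runs through `0, …, N - 1`; the inputs of
the circuit are the vertices with these very numbers, whence the offset `g = 0` in `gate_within`. -/
theorem leftGates_within {M N H K w : ℕ} {cls : List (List ℕ)}
    {s : State} (hc : s.Consts N H) (hcls : HoldsAt s.mem 2 (cls.flatMap withLength))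
    (h8 : s.reg 8 = 2) (h9 : s.reg 9 = w) (h13 : s.reg 13 = cls.length) (h14 : s.reg 14 = 0)
    (hw : listPos cls cls.length ≤ w)
    (hK : ∀ cl ∈ cls, cl.length ≤ K ∧ ∀ l ∈ cl, l ≤ K)
    (hM : K + 2 * N + 2 ≤ M) (hm : cls.length ≤ M)
    (hwM : w + cls.length * (N + 2) + K + 2 ≤ M) (hH : H ≤ M) :
    leftGates.Within M s (cls.length * (N * (K * (8 * K + 23) + 12) + 18) + 1) fun s' =>
      s.Emits ((List.range cls.length).flatMap fun j => withLength (leftPreds N H cls j)) s' ∧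
      ∀ r, 14 ≤ r → s'.reg r = s.reg r := by
  have hK' : ∀ i, (nthList cls i).length ≤ K ∧ ∀ l ∈ nthList cls i, l ≤ K := by
    intro i
    rcases nthList_mem_or cls i with h | h
    · exact hK _ h
    · rw [h]; simp
  have hlen : ∀ j, (withLength (leftPreds N H cls j)).length ≤ N + 2 := by
    intro j
    have := length_gatePreds_le N 0 N fun x => falsifies N H 0 x (nthList cls j)
    rw [length_withLength, leftPreds]; omega
  refine (Prog.Within.loop_const (fun i s' =>
      s.Emits ((List.range i).flatMap fun j => withLength (leftPreds N H cls j)) s' ∧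
      s'.reg 8 = listPos cls i ∧ s'.reg 13 = cls.length - i ∧ ∀ r, 14 ≤ r → s'.reg r = s.reg r)
      cls.length (N * (K * (8 * K + 23) + 12) + 17) ?_ ?_ ?_).mono le_rfl ?_
  · rintro i hi s' ⟨he, e8, e13, hr⟩
    have hc' := hc.congr fun r h1 h2 => hr r (by omega)
    have e9 := he.reg
    have hL := length_flatMap_range_le (n := i) hlen
    set L := (List.range i).flatMap fun j => withLength (leftPreds N H cls j) with hLdef
    have hmul : i * (N + 2) + (N + 2) ≤ cls.length * (N + 2) := by
      rw [← Nat.succ_mul]; exact Nat.mul_le_mul_right _ hi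
    have hle := listPos_le cls (i := i + 1) (by omega)
    have hsucc := listPos_succ hi
    have hcls' : HoldsAt s'.mem 2 (cls.flatMap withLength) := hcls.congr fun a _ ha => by
      simp only [listPos, List.take_length] at hw
      exact he.low a (by omega)
    refine ⟨by omega, by omega, Prog.Within.block_seq (N * (K * (8 * K + 23) + 12) + 13)
      (by simp only [Prog.steps]; omega) ?_⟩
    generalize hQ : Prog.Within M (_ ;; _) = Q
    simp [Prog.wp, hc'.reg15]
    and_intros
    any_goals omega
    rw [← hQ]
    refine (gate_within (K := K) (n := N) (g := 0) (w := w + L.length) (off := 0)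
      (cl := fun _ => nthList cls i) (x := fun x => x) (p := fun _ => listPos cls i)
      (hc'.congr fun r hr _ => ?_) ?_ ?_ ?_ ?_ ?_ ?_ ?_ ?_ ?_ ?_ ?_ hM ?_ ?_ ?_ hH).then (l := 4)
      (by omega) ?_
    · simp [show r ≠ 7 by omega, show r ≠ 10 by omega, show r ≠ 11 by omega]
    · simp
    · simp [e8]
    · simp [e9, h9]
    · simp
    · simp
    · simp [hr, h14]
    · intro _ _
      refine ⟨holdsAt_listPos hcls' hi, by omega, by omega⟩
    · intro x hx
      exact advances_input (by omega)
    · intro x hx; exact hx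
    · intro _ _; exact (hK' i).2
    · intro _ _; exact (hK' i).1
    · omega
    · omega
    · omega
    · rintro s1 ⟨he1, f7, f8, hr1⟩
      change State.Emits (withLength (leftPreds N H cls i)) _ s1 at he1
      have k9 : w + L.length ≥ listPos cls cls.length := by omega
      have hr13 := hr1 13 (by omega)
      have hr17 := hr1 17 (by omega)
      simp [e13, hc'.reg17] at hr13 hr17
      refine (advances_nextList (x := N) hcls' hi le_rfl (by omega) s1 ?_ f7 f8 hr17).then
        (l := 1) (by omega) ?_
      · intro a ha
        rw [he1.low a (by simp; omega)]
        simp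
      · rintro s2 ⟨k1, k2, k7, k8, kr⟩
        refine Prog.Within.block (by decide) ?_
        have g13 := (kr 13 (by omega)).trans hr13
        have g17 := (kr 17 (by omega)).trans hr17
        generalize hQ : (fun s' : State => (_ : Prop)) = Q
        simp [Prog.wp, g13, g17]
        and_intros
        any_goals omega
        rw [← hQ]
        refine ⟨?_, by simp [k8], by simp; omega, fun r h14 => ?_⟩
        · rw [List.range_succ, List.flatMap_append, List.flatMap_singleton]
          refine he.trans ⟨?_, ?_, ?_, ?_, ?_⟩
          · have := he1.coins
            simp at this
            simp [k2, this]
          · have := he1.reg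
            simp at this
            simp [kr, this]
          · have := he1.holds
            simp at this
            simpa [k1] using this
          · intro a ha
            have := he1.low a (by simpa using ha)
            simpa [k1] using this
          · intro a ha
            have := he1.high a (by simpa using ha)
            simpa [k1] using this
        · simp [show r ≠ 13 by omega, kr r (by omega), hr1 r (by omega), show r ≠ 7 by omega,
            show r ≠ 10 by omega, show r ≠ 11 by omega, hr r h14]
  · rintro s' ⟨-, -, e13, -⟩
    omega
  · exact ⟨State.Emits.of_mem rfl rfl rfl, h8, h13, fun r _ => rfl⟩
  · rintro s' ⟨he, -, -, hr⟩
    exact ⟨he, hr⟩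

/-- Write the gates for the partial assignments. -/
def rightGates : Prog :=
  .loop 13 ((.const 8 2 ;; .const 10 0 ;; .add 10 10 21 ;; .const 11 0 ;; .add 11 11 19) ;;
    gate nextList ;; (.add 7 7 17 ;; .sub 13 13 17))

/-- Here `y` is fixed and the clauses are scanned. The gate of the `j`-th clause is the vertex `N +
1 + j`, whence the offset `g = N + 1`, and the window of the second half starts at `off = H`. -/
theorem rightGates_within {M N H K w : ℕ} {cls : List (List ℕ)}
    {s : State} (hc : s.Consts N H) (hcls : HoldsAt s.mem 2 (cls.flatMap withLength))
    (h7 : s.reg 7 = 0) (h9 : s.reg 9 = w) (h13 : s.reg 13 = N) (h14 : s.reg 14 = H)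
    (h19 : s.reg 19 = cls.length) (h21 : s.reg 21 = N + 1)
    (hw : listPos cls cls.length ≤ w)
    (hK : ∀ cl ∈ cls, cl.length ≤ K ∧ ∀ l ∈ cl, l ≤ K)
    (hM : K + 2 * N + cls.length + 2 ≤ M)
    (hwM : w + N * (cls.length + 2) + K + 2 ≤ M) (hH : H ≤ M) :
    rightGates.Within M s (N * (cls.length * (K * (8 * K + 23) + 12) + 17) + 1) fun s' =>
      s.Emits ((List.range N).flatMap fun y => withLength (rightPreds N H cls y)) s' ∧
      ∀ r, 14 ≤ r → s'.reg r = s.reg r := by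
  have hK' : ∀ i, (nthList cls i).length ≤ K ∧ ∀ l ∈ nthList cls i, l ≤ K := by
    intro i
    rcases nthList_mem_or cls i with h | h
    · exact hK _ h
    · rw [h]; simp
  have hlen : ∀ j, (withLength (rightPreds N H cls j)).length ≤ cls.length + 2 := by
    intro y
    have := length_gatePreds_le N (N + 1) cls.length fun j => falsifies N H H y (nthList cls j)
    rw [length_withLength, rightPreds]; omega
  refine (Prog.Within.loop_const (fun i s' =>
      s.Emits ((List.range i).flatMap fun j => withLength (rightPreds N H cls j)) s' ∧
      s'.reg 7 = i ∧ s'.reg 13 = N - i ∧ ∀ r, 14 ≤ r → s'.reg r = s.reg r)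
      N (cls.length * (K * (8 * K + 23) + 12) + 16) ?_ ?_ ?_).mono le_rfl ?_
  · rintro i hi s' ⟨he, e7, e13, hr⟩
    have hc' := hc.congr fun r h1 h2 => hr r (by omega)
    have e9 := he.reg
    have hL := length_flatMap_range_le (n := i) hlen
    set L := (List.range i).flatMap fun j => withLength (rightPreds N H cls j) with hLdef
    have hmul : i * (cls.length + 2) + (cls.length + 2) ≤ N * (cls.length + 2) := by
      rw [← Nat.succ_mul]; exact Nat.mul_le_mul_right _ hi
    have hcls' : HoldsAt s'.mem 2 (cls.flatMap withLength) := hcls.congr fun a _ ha => by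
      simp only [listPos, List.take_length] at hw
      exact he.low a (by omega)
    have e19 := (hr 19 (by omega)).trans h19
    have e21 := (hr 21 (by omega)).trans h21
    refine ⟨by omega, by omega, Prog.Within.block_seq (cls.length * (K * (8 * K + 23) + 12) + 11)
      (by simp only [Prog.steps]; omega) ?_⟩
    generalize hQ : Prog.Within M (_ ;; _) = Q
    simp [Prog.wp, e19, e21]
    and_intros
    any_goals omega
    rw [← hQ]
    refine (gate_within (K := K) (n := cls.length) (g := N + 1) (w := w + L.length) (off := H)
      (cl := fun j => nthList cls j) (x := fun _ => i) (p := fun j => listPos cls j)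
      (hc'.congr fun r hr _ => ?_) ?_ ?_ ?_ ?_ ?_ ?_ ?_ ?_ ?_ ?_ ?_ ?_ ?_ ?_ hH hH).then (l := 2)
      (by omega) ?_
    · simp [show r ≠ 8 by omega, show r ≠ 10 by omega, show r ≠ 11 by omega]
    · simp [e7]
    · simp
    · simp [e9, h9]
    · simp
    · simp
    · simp [hr, h14]
    · intro j hj
      have hle := listPos_le cls (i := j + 1) (by omega)
      have hsucc := listPos_succ hj
      refine ⟨holdsAt_listPos hcls' hj, by omega, by omega⟩
    · intro j hj
      exact advances_nextList hcls' hj (by omega) (by omega)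
    · intro _ _; exact hi
    · intro j _; exact (hK' j).2
    · intro j _; exact (hK' j).1
    · omega
    · omega
    · omega
    · rintro s1 ⟨he1, f7, f8, hr1⟩
      change State.Emits (withLength (rightPreds N H cls i)) _ s1 at he1
      have hr13 := hr1 13 (by omega)
      have hr17 := hr1 17 (by omega)
      simp [e13, hc'.reg17] at hr13 hr17
      refine Prog.Within.block (by decide) ?_
      generalize hQ : (fun s' : State => (_ : Prop)) = Q
      simp [Prog.wp, hr13, hr17, f7]
      and_intros
      any_goals omega
      rw [← hQ]
      refine ⟨?_, by simp, by simp; omega, fun r h14 => ?_⟩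
      · rw [List.range_succ, List.flatMap_append, List.flatMap_singleton]
        refine he.trans ⟨?_, ?_, ?_, ?_, ?_⟩
        · have := he1.coins
          simp at this
          simp [this]
        · have := he1.reg
          simp at this
          simp [this]
        · have := he1.holds
          simp at this
          simpa using this
        · intro a ha
          have := he1.low a (by simpa using ha)
          simpa using this
        · intro a ha
          have := he1.high a (by simpa using ha)
          simpa using this
      · simp [show r ≠ 13 by omega, show r ≠ 7 by omega, show r ≠ 8 by omega, hr1 r (by omega),
          show r ≠ 10 by omega, show r ≠ 11 by omega, hr r h14]
  · rintro s' ⟨-, -, e13, -⟩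
    omega
  · exact ⟨State.Emits.of_mem rfl rfl rfl, h7, h13, fun r _ => rfl⟩
  · rintro s' ⟨he, -, -, hr⟩
    exact ⟨he, hr⟩

end RAM

/-- The circuit for a formula with the clauses `cls`: there is an input gate for each partial
assignment `x < N`, and an additional input gate `N`. There is an arithmetic gate for each clause,
with the inputs that falsify it, an arithmetic gate with the input `N` only, and an output gate for
each partial assignment `y < N`, with the clauses that it falsifies. -/
def satCircuit (N H : ℕ) (cls : List (List ℕ)) : Circuit where
  inputs := N + 1
  gates := (List.range cls.length).map (RAM.leftPreds N H cls) ++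
    [N] :: (List.range N).map (RAM.rightPreds N H cls)
  outputs := (List.range N).map (N + cls.length + 2 + ·)

theorem encode_satCircuit (N H : ℕ) (cls : List (List ℕ)) :
    (satCircuit N H cls).encode = [N + 1, cls.length + (N + 1)] ++
      ((List.range cls.length).flatMap (fun j => RAM.withLength (RAM.leftPreds N H cls j)) ++
      ([1, N] ++ ((List.range N).flatMap (fun y => RAM.withLength (RAM.rightPreds N H cls y)) ++
      ([N] ++ (List.range N).map (N + cls.length + 2 + ·))))) := by
  simp [satCircuit, Circuit.encode, List.flatMap_map, List.flatMap_append, RAM.withLength,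
    List.flatMap_cons]

/-! ### Writing the whole circuit and moving it to the start of the memory -/

namespace RAM

theorem length_encode_satCircuit (N H : ℕ) (cls : List (List ℕ)) :
    (satCircuit N H cls).encode.length ≤ cls.length * (N + 2) + N * (cls.length + 2) + N + 5 := by
  have hl : ∀ j, (withLength (leftPreds N H cls j)).length ≤ N + 2 := by
    intro j
    have := length_gatePreds_le N 0 N fun x => falsifies N H 0 x (nthList cls j)
    rw [length_withLength, leftPreds]; omega
  have hr : ∀ j, (withLength (rightPreds N H cls j)).length ≤ cls.length + 2 := by
    intro y
    have := length_gatePreds_le N (N + 1) cls.length fun j => falsifies N H H y (nthList cls j)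
    rw [length_withLength, rightPreds]; omega
  have h1 := length_flatMap_range_le (n := cls.length) hl
  have h2 := length_flatMap_range_le (n := N) hr
  rw [encode_satCircuit]
  simp only [List.length_append, List.length_cons, List.length_nil, List.length_map,
    List.length_range]
  omega

theorem State.Emits.of_update {s s' : State} {v : ℕ}
    (hm : s'.mem = Function.update s.mem (s.reg 9) v) (hc : s'.coins = s.coins)
    (h9 : s'.reg 9 = s.reg 9 + 1) : s.Emits [v] s' := by
  refine ⟨hc, h9, ?_, fun a ha => ?_, fun a ha => ?_⟩
  · rw [holdsAt_cons, hm]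
    exact ⟨by simp, holdsAt_nil _ _⟩
  · rw [hm, Function.update_of_ne (by omega)]
  · simp at ha
    rw [hm, Function.update_of_ne (by omega)]

/-- Write the register `r`. -/
def emit (r : ℕ) : Prog := .store 9 r ;; .add 9 9 17

theorem emit_within {M r v : ℕ} {s : State} (h17 : s.reg 17 = 1) (h9 : s.reg 9 ≤ M)
    (hr : s.reg r = v) (hv : v ≤ M) (hM : 1 ≤ M) :
    (emit r).Within M s 2 fun s' => s.Emits [v] s' ∧ ∀ i ≠ 9, s'.reg i = s.reg i := by
  refine Prog.Within.block (by simp [emit, Prog.steps]) ?_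
  generalize hQ : (fun s' : State => (_ : Prop)) = Q
  simp [emit, Prog.wp, h17, hr]
  and_intros
  any_goals omega
  rw [← hQ]
  exact ⟨State.Emits.of_update rfl rfl (by simp), fun i hi => by simp [hi]⟩

/-- Write the list of the outputs. -/
def emitOutputs : Prog :=
  emit 15 ;; (.add 10 19 21 ;; .add 10 10 17 ;; .const 13 0 ;; .add 13 13 15) ;;
    .loop 13 (emit 10 ;; (.add 10 10 17 ;; .sub 13 13 17))

theorem emitOutputs_within {M N H m w : ℕ} {s : State} (hc : s.Consts N H)
    (h9 : s.reg 9 = w) (h19 : s.reg 19 = m) (h21 : s.reg 21 = N + 1)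
    (hwM : w + N + 2 ≤ M) (hM : 2 * N + m + 3 ≤ M) :
    emitOutputs.Within M s (N * 5 + 7) fun s' =>
      s.Emits ([N] ++ (List.range N).map (N + m + 2 + ·)) s' ∧
      ∀ r, 14 ≤ r → s'.reg r = s.reg r := by
  refine (emit_within hc.reg17 (by omega) hc.reg15 (by omega) (by omega)).then (l := N * 5 + 5)
    (by omega) ?_
  rintro s1 ⟨he, hr⟩
  have e15 := (hr 15 (by omega)).trans hc.reg15
  have e17 := (hr 17 (by omega)).trans hc.reg17
  have e19 := (hr 19 (by omega)).trans h19
  have e21 := (hr 21 (by omega)).trans h21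
  have e9 := he.reg
  simp at e9
  refine Prog.Within.block_seq (N * 5 + 1) (by simp only [Prog.steps]; omega) ?_
  generalize hQ : Prog.Within M (Prog.loop _ _) = Q
  simp [Prog.wp, e15, e17, e19, e21]
  and_intros
  any_goals omega
  rw [← hQ]
  refine (Prog.Within.loop_const (fun i s' => s.Emits ([N] ++ (List.range i).map (N + m + 2 + ·)) s' ∧
    s'.reg 10 = N + m + 2 + i ∧ s'.reg 13 = N - i ∧ ∀ r, 14 ≤ r → s'.reg r = s.reg r)
    N 4 ?_ ?_ ?_).mono le_rfl ?_
  · rintro i hi s2 ⟨he2, f10, f13, hr2⟩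
    have f9 := he2.reg
    simp at f9
    have f17 := (hr2 17 (by omega)).trans hc.reg17
    refine ⟨by omega, by omega, (emit_within f17 (by omega) f10 (by omega) (by omega)).then
      (l := 2) (by omega) ?_⟩
    rintro s3 ⟨he3, hr3⟩
    have g10 := (hr3 10 (by omega)).trans f10
    have g13 := (hr3 13 (by omega)).trans f13
    have g17 := (hr3 17 (by omega)).trans f17
    refine Prog.Within.block (by decide) ?_
    generalize hQ : (fun s' : State => (_ : Prop)) = Q
    simp [Prog.wp, g10, g13, g17]
    and_intros
    any_goals omega
    rw [← hQ]
    refine ⟨?_, by simp; omega, by simp; omega, fun r h => ?_⟩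
    · rw [List.range_succ, List.map_append, ← List.append_assoc]
      refine he2.trans ?_
      have := he3.trans (State.Emits.of_mem (s := s3) (s' := ((s3.setReg 10 (N + m + 2 + i + 1)).setReg 13
        (N - i - 1))) rfl rfl (by simp))
      simpa using this
    · simp [show r ≠ 10 by omega, show r ≠ 13 by omega, hr3 r (by omega), hr2 r h]
  · rintro s' ⟨-, -, h, -⟩
    omega
  · refine ⟨?_, by simp; omega, by simp, fun r h => ?_⟩
    · simpa using he.trans (State.Emits.of_mem (s := s1) (s' := ((((s1.setReg 10 (m + (N + 1))).setReg 10
        (m + (N + 1) + 1)).setReg 13 0).setReg 13 N)) rfl rfl (by simp))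
    · simp [show r ≠ 10 by omega, show r ≠ 13 by omega, hr r (by omega)]
  · rintro s' ⟨he, -, -, hr⟩
    exact ⟨he, hr⟩

/-- Write the representation of the circuit. -/
def emitCircuit : Prog :=
  emit 21 ;; (.add 0 19 21) ;; emit 0 ;;
  (.const 8 2 ;; .const 13 0 ;; .add 13 13 19 ;; .const 14 0) ;; leftGates ;;
  emit 17 ;; emit 15 ;;
  (.const 7 0 ;; .const 13 0 ;; .add 13 13 15 ;; .const 14 0 ;; .add 14 14 16) ;; rightGates ;;
  emitOutputs

/-- The phases write consecutive pieces of `satCircuit.encode`. The formula lies entirely below `w`,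
so it stays readable during all of them. -/
theorem emitCircuit_within {M N H K w : ℕ} {cls : List (List ℕ)}
    {s : State} (hc : s.Consts N H) (hcls : HoldsAt s.mem 2 (cls.flatMap withLength))
    (h9 : s.reg 9 = w) (h19 : s.reg 19 = cls.length) (h21 : s.reg 21 = N + 1)
    (hw : listPos cls cls.length ≤ w)
    (hK : ∀ cl ∈ cls, cl.length ≤ K ∧ ∀ l ∈ cl, l ≤ K)
    (hM : K + 2 * N + cls.length + 3 ≤ M)
    (hwM : w + cls.length * (N + 2) + N * (cls.length + 2) + N + K + 10 ≤ M) (hH : H ≤ M) :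
    emitCircuit.Within M s (cls.length * (N * (K * (8 * K + 23) + 12) + 18) +
        N * (cls.length * (K * (8 * K + 23) + 12) + 22) + 30) fun s' =>
      s.Emits (satCircuit N H cls).encode s' ∧ ∀ r, 15 ≤ r → s'.reg r = s.reg r := by
  have hpos : listPos cls cls.length = 2 + (cls.flatMap withLength).length := by
    simp [listPos]
  have hl : ∀ j, (withLength (leftPreds N H cls j)).length ≤ N + 2 := by
    intro j
    have := length_gatePreds_le N 0 N fun x => falsifies N H 0 x (nthList cls j)
    rw [length_withLength, leftPreds]; omega
  have hr : ∀ j, (withLength (rightPreds N H cls j)).length ≤ cls.length + 2 := by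
    intro y
    have := length_gatePreds_le N (N + 1) cls.length fun j => falsifies N H H y (nthList cls j)
    rw [length_withLength, rightPreds]; omega
  have h1 := length_flatMap_range_le (n := cls.length) hl
  have h2 := length_flatMap_range_le (n := N) hr
  have hcls_of : ∀ {l : List ℕ} {s' : State}, s.Emits l s' →
      HoldsAt s'.mem 2 (cls.flatMap withLength) := fun h =>
    hcls.congr fun a _ ha => h.low a (by omega)
  set T1 := cls.length * (N * (K * (8 * K + 23) + 12) + 18) with hT1
  -- Of the `22` instructions per output beyond the scan of the clauses, `17` belong to its gate and
  -- `5` to its entry in the list of outputs.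
  have hT2 : N * (cls.length * (K * (8 * K + 23) + 12) + 22) =
    N * (cls.length * (K * (8 * K + 23) + 12) + 17) + N * 5 := by rw [← mul_add]
  set T2 := N * (cls.length * (K * (8 * K + 23) + 12) + 17) with hT2'
  rw [hT2, encode_satCircuit]
  clear hT1 hT2 hT2'
  -- the header
  refine (emit_within hc.reg17 (by omega) h21 (by omega) (by omega)).then
    (l := T1 + T2 + N * 5 + 28) (by omega) ?_
  rintro s1 ⟨a1, r1⟩
  have a9 := a1.reg
  simp at a9
  refine Prog.Within.block_seq (T1 + T2 + N * 5 + 27) (by simp only [Prog.steps]; omega) ?_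
  refine ⟨?_, ?_, ?_⟩
  · rw [r1 _ (by omega)]; omega
  · rw [r1 _ (by omega)]; omega
  rw [r1 19 (by omega), r1 21 (by omega), h19, h21]
  refine (emit_within (M := M) (v := cls.length + (N + 1)) ?_ ?_ ?_ ?_ ?_).then
    (l := T1 + T2 + N * 5 + 25) (by omega) ?_
  · simp [r1, hc.reg17]
  · simp; omega
  · simp
  · omega
  · omega
  rintro s2 ⟨a2, r2⟩
  replace a2 : s.Emits [N + 1, cls.length + (N + 1)] s2 :=
    a1.trans ((State.Emits.of_mem (s := s1) (s' := s1.setReg 0 (cls.length + (N + 1))) rfl rfl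
      (by simp)).trans a2)
  replace r2 : ∀ i, i ≠ 9 → i ≠ 0 → s2.reg i = s.reg i := fun i hi hi0 => by
    rw [r2 i hi]; simp [hi0, r1 i hi]
  have a9 := a2.reg
  simp at a9
  -- the gates for the clauses
  refine Prog.Within.block_seq (T1 + T2 + N * 5 + 21) (by simp only [Prog.steps]; omega) ?_
  generalize hQ : Prog.Within M (_ ;; _) = Q
  simp [Prog.wp, r2, h19]
  and_intros
  any_goals omega
  rw [← hQ]
  clear hQ Q
  refine (leftGates_within (N := N) (H := H) (K := K) (w := w + 2) (cls := cls)
    (hc.congr fun r hr _ => ?_) ?_ ?_ ?_ ?_ ?_ ?_ hK ?_ ?_ ?_ hH).then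
    (l := T2 + N * 5 + 20) (by omega) ?_
  · simp [show r ≠ 8 by omega, show r ≠ 13 by omega, show r ≠ 14 by omega, r2 r (by omega)
      (by omega)]
  · simpa using hcls_of a2
  · simp
  · simp [a9, h9]
  · simp
  · simp
  · omega
  · omega
  · omega
  · omega
  rintro s3 ⟨a3, r3⟩
  replace a3 := a2.trans ((State.Emits.of_mem (s := s2) (s' := ((((s2.setReg 8 2).setReg 13 0).setReg
    13 cls.length).setReg 14 0)) rfl rfl (by simp)).trans a3)
  rw [List.nil_append] at a3
  replace r3 : ∀ i, 15 ≤ i → s3.reg i = s.reg i := fun i hi => by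
    rw [r3 i (by omega)]
    simp [show i ≠ 8 by omega, show i ≠ 13 by omega, show i ≠ 14 by omega, r2 i (by omega)
      (by omega)]
  have a9 := a3.reg
  simp only [List.length_append, List.length_cons, List.length_nil] at a9
  -- the gate in the middle
  refine (emit_within (M := M) (v := 1) ?_ ?_ ?_ ?_ ?_).then (l := T2 + N * 5 + 18) (by omega) ?_
  · simp [r3, hc.reg17]
  · omega
  · simp [r3, hc.reg17]
  · omega
  · omega
  rintro s4 ⟨a4, r4⟩
  replace a4 := a3.trans a4
  replace r4 : ∀ i, 15 ≤ i → s4.reg i = s.reg i := fun i hi => by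
    rw [r4 i (by omega), r3 i hi]
  have a9 := a4.reg
  simp only [List.length_append, List.length_cons, List.length_nil] at a9
  refine (emit_within (M := M) (v := N) ?_ ?_ ?_ ?_ ?_).then (l := T2 + N * 5 + 16) (by omega) ?_
  · simp [r4, hc.reg17]
  · omega
  · simp [r4, hc.reg15]
  · omega
  · omega
  rintro s5 ⟨a5, r5⟩
  replace a5 := a4.trans a5
  replace r5 : ∀ i, 15 ≤ i → s5.reg i = s.reg i := fun i hi => by
    rw [r5 i (by omega), r4 i hi]
  have a9 := a5.reg
  simp only [List.length_append, List.length_cons, List.length_nil] at a9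
  -- the gates for the partial assignments
  refine Prog.Within.block_seq (T2 + N * 5 + 11) (by simp only [Prog.steps]; omega) ?_
  generalize hQ : Prog.Within M (_ ;; _) = Q
  simp [Prog.wp, r5, hc.reg15, hc.reg16]
  and_intros
  any_goals omega
  rw [← hQ]
  clear hQ Q
  refine (rightGates_within (N := N) (H := H) (K := K) (w := s5.reg 9)
    (cls := cls) (hc.congr fun r hr _ => ?_) ?_ ?_ ?_ ?_ ?_ ?_ ?_ ?_ hK ?_ ?_ hH).then
    (l := N * 5 + 8) (by omega) ?_
  · simp [show r ≠ 7 by omega, show r ≠ 13 by omega, show r ≠ 14 by omega, r5 r hr]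
  · simpa using hcls_of a5
  · simp
  · simp
  · simp
  · simp
  · simp [r5, h19]
  · simp [r5, h21]
  · omega
  · omega
  · omega
  rintro s6 ⟨a6, r6⟩
  replace a6 := a5.trans ((State.Emits.of_mem (s := s5) (s' := (((((s5.setReg 7 0).setReg 13
    0).setReg 13 N).setReg 14 0).setReg 14 H)) rfl rfl (by simp)).trans a6)
  rw [List.nil_append] at a6
  replace r6 : ∀ i, 15 ≤ i → s6.reg i = s.reg i := fun i hi => by
    rw [r6 i (by omega)]
    simp [show i ≠ 7 by omega, show i ≠ 13 by omega, show i ≠ 14 by omega, r5 i hi]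
  have a9 := a6.reg
  simp only [List.length_append, List.length_cons, List.length_nil] at a9
  -- the outputs
  refine (emitOutputs_within (m := cls.length) (hc.congr fun r h1 _ => r6 r h1) rfl
    ((r6 _ (by omega)).trans h19) ((r6 _ (by omega)).trans h21) ?_ ?_).mono (by omega) ?_
  · omega
  · omega
  rintro s7 ⟨a7, r7⟩
  refine ⟨?_, fun r hr => (r7 r (by omega)).trans (r6 r hr)⟩
  simpa only [List.append_assoc, List.cons_append, List.nil_append] using a6.trans a7

/-- Clear the registers below `n`. -/
def clearRegs : ℕ → Prog
  | 0 => .skip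
  | n + 1 => clearRegs n ;; .const n 0

theorem clearRegs_within {M n : ℕ} {s : State} :
    (clearRegs n).Within M s (n + 1) fun s' => s'.mem = s.mem ∧ s'.coins = s.coins ∧
      ∀ r, s'.reg r = if r < n then 0 else s.reg r := by
  induction n with
  | zero => exact Prog.Within.block (by simp [clearRegs, Prog.steps]) ⟨rfl, rfl, by simp⟩
  | succ n ih =>
    refine ih.then (l := 1) (by omega) ?_
    rintro s' ⟨h1, h2, h3⟩
    refine Prog.Within.block (by simp [Prog.steps]) ⟨by omega, h1, h2, fun r => ?_⟩
    simp only [State.setReg_reg, h3]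
    split_ifs <;> omega

/-- Move the output to the beginning of the memory, and clear the rest of the memory and the
registers. -/
def moveOutput : Prog :=
  (.const 1 0 ;; .add 1 1 20 ;; .const 2 0 ;; .sub 3 9 1) ;;
  .loop 3 (.load 4 1 ;; .store 2 4 ;; .add 1 1 17 ;; .add 2 2 17 ;; .sub 3 3 17) ;;
  (.const 5 0 ;; .sub 3 9 2 ;; .add 3 3 17) ;;
  .loop 3 (.store 2 5 ;; .add 2 2 17 ;; .sub 3 3 17) ;; clearRegs 22

/-- The word moves towards lower addresses in increasing order, so no cell is overwritten before it
has been read. The conclusion is an equality of states, not just of the relevant cells, because the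
rewriting program is specified only on genuine initial states. -/
theorem moveOutput_within {M b : ℕ} {l : List ℕ} {s : State} (h17 : s.reg 17 = 1)
    (h9 : s.reg 9 = b + l.length) (h20 : s.reg 20 = b) (hl : HoldsAt s.mem b l)
    (hM : b + l.length + 1 ≤ M) (hlM : ∀ v ∈ l, v ≤ M)
    (hmem : ∀ a > b + l.length, s.mem a = 0) (hreg : ∀ r, 22 ≤ r → s.reg r = 0) :
    moveOutput.Within M s (6 * l.length + 4 * b + 36) fun s' => s' = init l s.coins := by
  refine Prog.Within.block_seq (6 * l.length + 4 * b + 32) (by simp only [Prog.steps]; omega) ?_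
  generalize hQ : Prog.Within M (_ ;; _) = Q
  simp [Prog.wp, h9, h20]
  and_intros
  any_goals omega
  rw [← hQ]
  clear hQ Q
  refine (Prog.Within.loop_const (fun i s' => s'.coins = s.coins ∧
    (∀ a, s'.mem a = if a < i then s.mem (b + a) else s.mem a) ∧
    s'.reg 1 = b + i ∧ s'.reg 2 = i ∧ s'.reg 3 = l.length - i ∧
    ∀ r, 5 ≤ r → s'.reg r = s.reg r) l.length 5 ?_ ?_ ?_).then (l := 4 * b + 31) (by omega) ?_
  · rintro i hi s1 ⟨k1, k2, k3, k4, k5, k6⟩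
    have k17 := (k6 17 (by omega)).trans h17
    have hv : s1.mem (b + i) = l[i] := by
      rw [k2, if_neg (by omega), hl i hi]
    have := hlM l[i] (by simp)
    refine ⟨by omega, by omega, Prog.Within.block (by decide) ?_⟩
    generalize hQ : (fun s' : State => (_ : Prop)) = Q
    simp [Prog.wp, k3, k4, k5, k17, hv]
    and_intros
    any_goals omega
    rw [← hQ]
    refine ⟨by simp [k1], fun a => ?_, by simp; omega, by simp, by simp; omega, fun r hr => ?_⟩
    · rcases lt_trichotomy a i with h | rfl | h
      · simp [show a ≠ i by omega, k2, h, show a < i + 1 by omega]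
      · simp [hl a hi]
      · simp [show a ≠ i by omega, k2, show ¬ a < i by omega, show ¬ a < i + 1 by omega]
    · simp [show r ≠ 1 by omega, show r ≠ 2 by omega, show r ≠ 3 by omega, show r ≠ 4 by omega,
        k6 r hr]
  · rintro s' ⟨-, -, -, -, h, -⟩
    omega
  · refine ⟨rfl, by simp, by simp, by simp, by simp, fun r hr => ?_⟩
    simp [show r ≠ 1 by omega, show r ≠ 2 by omega, show r ≠ 3 by omega]
  · rintro s1 ⟨k1, k2, k3, k4, k5, k6⟩
    have k17 := (k6 17 (by omega)).trans h17
    have k9 := (k6 9 (by omega)).trans h9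
    refine Prog.Within.block_seq (4 * b + 28) (by simp only [Prog.steps]; omega) ?_
    generalize hQ : Prog.Within M (_ ;; _) = Q
    simp [Prog.wp, k4, k9, k17]
    and_intros
    any_goals omega
    rw [← hQ]
    clear hQ Q
    -- After the move, the cells from `l.length` to `b + l.length` inclusive may be nonzero. These
    -- are `b + 1` cells; the last one is the cell that the construction may have spoiled above its
    -- output.
    refine (Prog.Within.loop_const (fun i s' => s'.coins = s.coins ∧
      (∀ a, s'.mem a = if l.length ≤ a ∧ a < l.length + i then 0 else s1.mem a) ∧
      s'.reg 2 = l.length + i ∧ s'.reg 3 = b + 1 - i ∧ s'.reg 5 = 0 ∧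
      ∀ r, 6 ≤ r → s'.reg r = s.reg r) (b + 1) 3 ?_ ?_ ?_).then (l := 23) (by omega) ?_
    · rintro i hi s2 ⟨j1, j2, j3, j4, j5, j6⟩
      have j17 := (j6 17 (by omega)).trans h17
      refine ⟨by omega, by omega, Prog.Within.block (by decide) ?_⟩
      generalize hQ : (fun s' : State => (_ : Prop)) = Q
      simp [Prog.wp, j3, j4, j5, j17]
      and_intros
      any_goals omega
      rw [← hQ]
      refine ⟨by simp [j1], fun a => ?_, by simp; omega, by simp; omega, by simp [j5],
        fun r hr => ?_⟩
      · simp only [State.setReg_mem, State.setMem_mem, j2]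
        split_ifs <;> omega
      · simp [show r ≠ 2 by omega, show r ≠ 3 by omega, j6 r hr]
    · rintro s' ⟨-, -, -, h, -⟩
      omega
    · refine ⟨k1, fun a => ?_, by simp [k4], by simp, by simp, fun r hr => ?_⟩
      · simp [show ¬ (l.length ≤ a ∧ a < l.length) by omega]
      · simp [show r ≠ 5 by omega, show r ≠ 3 by omega, k6 r (by omega)]
    · rintro s2 ⟨j1, j2, j3, j4, j5, j6⟩
      refine clearRegs_within.mono le_rfl ?_
      rintro s3 ⟨i1, i2, i3⟩
      refine State.ext_iff'.2 ⟨funext fun r => ?_, funext fun a => ?_, i2.trans j1⟩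
      · rw [i3]
        split_ifs with h
        · rfl
        · rw [j6 r (by omega), hreg r (by omega)]; rfl
      · rw [i1, j2, k2]
        simp only [init]
        by_cases ha : a < l.length
        · rw [if_neg (by omega), if_pos ha, hl a ha, List.getD_eq_getElem _ _ ha]
        · rw [List.getD_eq_default _ _ (by omega)]
          split_ifs
          · rfl
          · exact hmem a (by omega)

end RAM

/-! ### From a formula to the initial state for its circuit -/

namespace RAM

/-- Skip the lists whose number is in register `13`. -/
def skipLists : Prog := .loop 13 (nextList ;; .sub 13 13 17)

theorem skipLists_within {M : ℕ} {ls : List (List ℕ)} {s : State} (h17 : s.reg 17 = 1)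
    (hls : HoldsAt s.mem 2 (ls.flatMap withLength)) (h8 : s.reg 8 = 2)
    (h13 : s.reg 13 = ls.length) (hM : listPos ls ls.length + ls.length + 1 ≤ M) :
    skipLists.Within M s (ls.length * 5 + 1) fun s' => s'.mem = s.mem ∧ s'.coins = s.coins ∧
      s'.reg 8 = listPos ls ls.length ∧ ∀ r, 9 ≤ r → r ≠ 13 →
        s'.reg r = s.reg r := by
  refine (Prog.Within.loop_const (fun i s' => s'.mem = s.mem ∧ s'.coins = s.coins ∧
      s'.reg 8 = listPos ls i ∧ s'.reg 13 = ls.length - i ∧ ∀ r, 9 ≤ r → r ≠ 13 →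
        s'.reg r = s.reg r) ls.length 4 ?_ ?_ ?_).mono le_rfl ?_
  · rintro i hi s1 ⟨k1, k2, k8, k13, kr⟩
    have k17 := (kr 17 (by omega) (by omega)).trans h17
    refine ⟨by omega, by omega, (advances_nextList (x := s1.reg 7) hls hi le_rfl (by omega) s1
      (fun a _ => by rw [k1]) rfl k8 k17).then (l := 1) (by omega) ?_⟩
    rintro s2 ⟨j1, j2, -, j8, jr⟩
    have j13 := (jr 13 (by omega)).trans k13
    have j17 := (jr 17 (by omega)).trans k17
    refine Prog.Within.block (by decide) ?_
    generalize hQ : (fun s' : State => (_ : Prop)) = Q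
    simp [Prog.wp, j13, j17]
    and_intros
    any_goals omega
    rw [← hQ]
    refine ⟨by simp [j1, k1], by simp [j2, k2], by simp [j8], by simp; omega, fun r hr h => ?_⟩
    simp [h, jr r hr, kr r hr h]
  · rintro s' ⟨-, -, -, h, -⟩
    omega
  · exact ⟨rfl, rfl, h8, h13, fun r _ _ => rfl⟩
  · rintro s' ⟨k1, k2, k8, k13, kr⟩
    exact ⟨k1, k2, k8, kr⟩

/-- Compute the constants that the construction of the circuit needs. -/
def prologue : Prog :=
  (.const 17 1 ;; .const 18 2 ;; .const 3 0 ;; .load 4 3 ;; .load 19 17 ;; .const 15 1 ;;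
    .const 16 0) ;;
  .loop 4 (.add 15 15 15 ;; .add 16 16 18 ;; .sub 4 4 18) ;;
  (.const 8 2 ;; .const 13 0 ;; .add 13 13 19) ;; skipLists ;;
  (.const 20 0 ;; .add 20 20 8 ;; .const 9 0 ;; .add 9 9 8 ;; .add 21 15 17)

/-- Subtracting two from `n` reaches zero after `⌈n / 2⌉ = h` rounds, during which register `15` is
doubled. Skipping all clauses yields the first free address, where the circuit will be written. -/
theorem prologue_within {M n h : ℕ} {cls : List (List ℕ)} (ω : ℕ → Bool) (hh : h = (n + 1) / 2)
    (hM : 2 * 2 ^ h + 2 * n + cls.length + (formulaWord n cls).length + 5 ≤ M) :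
    prologue.Within M (init (formulaWord n cls) ω) (4 * n + 5 * cls.length + 25) fun s' =>
      s'.Consts (2 ^ h) (2 * h) ∧ s'.mem = (init (formulaWord n cls) ω).mem ∧ s'.coins = ω ∧
      s'.reg 9 = (formulaWord n cls).length ∧ s'.reg 19 = cls.length ∧
      s'.reg 20 = (formulaWord n cls).length ∧ s'.reg 21 = 2 ^ h + 1 ∧
      ∀ r, 22 ≤ r → s'.reg r = 0 := by
  have m0 : (init (formulaWord n cls) ω).mem 0 = n := rfl
  have m1 : (init (formulaWord n cls) ω).mem 1 = cls.length := rfl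
  have r0 : ∀ r, (init (formulaWord n cls) ω).reg r = 0 := fun _ => rfl
  have hpos := listPos_length n cls
  refine Prog.Within.block_seq (4 * n + 5 * cls.length + 18) (by simp only [Prog.steps]; omega) ?_
  generalize hQ : Prog.Within M (_ ;; _) = Q
  simp [Prog.wp, m0, m1]
  and_intros
  any_goals omega
  rw [← hQ]
  clear hQ Q
  refine (Prog.Within.loop_const (fun i s' => s'.mem = (init (formulaWord n cls) ω).mem ∧
    s'.coins = ω ∧ s'.reg 15 = 2 ^ i ∧ s'.reg 16 = 2 * i ∧ s'.reg 17 = 1 ∧ s'.reg 18 = 2 ∧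
    s'.reg 19 = cls.length ∧ s'.reg 4 = n - 2 * i ∧ ∀ r, 20 ≤ r → s'.reg r = 0) h 3
    ?_ ?_ ?_).then (l := 5 * cls.length + 9) (by omega) ?_
  · rintro i hi s1 ⟨k1, k2, k15, k16, k17, k18, k19, k4, kr⟩
    have hp : 2 ^ i ≤ 2 ^ h := Nat.pow_le_pow_right (by omega) hi.le
    refine ⟨by omega, by omega, Prog.Within.block (by decide) ?_⟩
    generalize hQ : (fun s' : State => (_ : Prop)) = Q
    simp [Prog.wp, k15, k16, k18, k4]
    and_intros
    any_goals omega
    rw [← hQ]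
    refine ⟨by simp [k1], by simp [k2], by simp [pow_succ]; omega, by simp; omega, by simp [k17],
      by simp [k18], by simp [k19], by simp; omega, fun r hr => ?_⟩
    simp [kr r hr, show r ≠ 4 by omega, show r ≠ 15 by omega, show r ≠ 16 by omega]
  · rintro s' ⟨-, -, -, -, -, -, -, h4, -⟩
    omega
  · refine ⟨by simp, by simp [init], by simp, by simp, by simp, by simp, by simp, by simp,
      fun r hr => ?_⟩
    simp [r0, show r ≠ 4 by omega, show r ≠ 15 by omega, show r ≠ 16 by omega,
      show r ≠ 3 by omega, show r ≠ 17 by omega, show r ≠ 18 by omega, show r ≠ 19 by omega]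
  · rintro s1 ⟨k1, k2, k15, k16, k17, k18, k19, k4, kr⟩
    refine Prog.Within.block_seq (5 * cls.length + 6) (by simp only [Prog.steps]; omega) ?_
    generalize hQ : Prog.Within M (_ ;; _) = Q
    simp [Prog.wp, k19]
    and_intros
    any_goals omega
    rw [← hQ]
    clear hQ Q
    refine (skipLists_within (ls := cls) ?_ ?_ ?_ ?_ ?_).then (l := 5) (by omega) ?_
    · simp [k17]
    · intro i hi
      simp only [State.setReg_mem, k1, init, formulaWord]
      rw [add_comm 2 i, List.getD_cons_succ, List.getD_cons_succ, List.getD_eq_getElem _ _ hi]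
    · simp
    · simp
    · omega
    · rintro s2 ⟨j1, j2, j8, jr⟩
      have j : ∀ r, 14 ≤ r → s2.reg r = s1.reg r := fun r hr => by
        rw [jr r (by omega) (by omega)]
        simp [show r ≠ 8 by omega, show r ≠ 13 by omega]
      refine Prog.Within.block (by decide) ?_
      generalize hQ : (fun s' : State => (_ : Prop)) = Q
      simp [Prog.wp, j8, j 15, j 17, k15, k17]
      and_intros
      any_goals omega
      rw [← hQ]
      refine ⟨⟨by simp [j, k15], by simp [j, k16], by simp [j, k17], by simp [j, k18]⟩,
        by simp [j1, k1], by simp [j2, k2], by simp [hpos], by simp [j, k19], by simp [hpos],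
        by simp, fun r hr => ?_⟩
      simp [show r ≠ 21 by omega, show r ≠ 20 by omega, show r ≠ 9 by omega, j r (by omega),
        kr r (by omega)]

/-- Replace a formula by the circuit for it. -/
def build : Prog := prologue ;; emitCircuit ;; moveOutput

theorem mem_gatePreds {N g n v : ℕ} {f : ℕ → Bool} :
    v ∈ gatePreds N g n f ↔ v = N ∨ ∃ i < n, f i ∧ v = g + i := by
  simp only [gatePreds, List.mem_cons, List.mem_map, List.mem_filter, List.mem_range]
  constructor
  · rintro (rfl | ⟨i, ⟨hi, hf⟩, rfl⟩)
    · exact .inl rfl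
    · exact .inr ⟨i, hi, hf, rfl⟩
  · rintro (rfl | ⟨i, hi, hf, rfl⟩)
    · exact .inl rfl
    · exact .inr ⟨i, ⟨hi, hf⟩, rfl⟩

/-- Under logarithmic cost, moving the word is cheap only if its entries are small. -/
theorem le_of_mem_encode_satCircuit {N H v : ℕ} {cls : List (List ℕ)}
    (hv : v ∈ (satCircuit N H cls).encode) : v ≤ 2 * N + cls.length + 3 := by
  simp only [encode_satCircuit, List.mem_append, List.mem_cons, List.not_mem_nil, or_false,
    List.mem_flatMap, List.mem_map, List.mem_range, withLength, leftPreds, rightPreds] at hv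
  rcases hv with (rfl | rfl) | ⟨j, hj, rfl | h⟩ | (rfl | rfl) | ⟨j, hj, rfl | h⟩ | rfl | ⟨j, hj, rfl⟩
  any_goals omega
  · have := length_gatePreds_le N 0 N fun x => falsifies N H 0 x (nthList cls j)
    omega
  · rcases mem_gatePreds.1 h with rfl | ⟨i, hi, -, rfl⟩ <;> omega
  · have := length_gatePreds_le N (N + 1) cls.length fun i => falsifies N H H j (nthList cls i)
    omega
  · rcases mem_gatePreds.1 h with rfl | ⟨i, hi, -, rfl⟩ <;> omega

/-- The leading term is `O(m N K ^ 2)`: each pair of a clause and a partial assignment, for either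
half, is tested once, with at most `K` literals and `O(K)` instructions per literal. -/
theorem build_within {M n h K : ℕ} {cls : List (List ℕ)} (ω : ℕ → Bool) (hh : h = (n + 1) / 2)
    (hK : ∀ cl ∈ cls, cl.length ≤ K ∧ ∀ l ∈ cl, l ≤ K)
    (hM : 2 * (formulaWord n cls).length + cls.length * (2 ^ h + 2) + 2 ^ h * (cls.length + 2) +
      3 * 2 ^ h + 2 * n + cls.length + K + 20 ≤ M) :
    build.Within M (init (formulaWord n cls) ω)
      (cls.length * (2 ^ h * (K * (8 * K + 23) + 12) + 18) +
        2 ^ h * (cls.length * (K * (8 * K + 23) + 12) + 22) +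
        6 * (cls.length * (2 ^ h + 2) + 2 ^ h * (cls.length + 2) + 2 ^ h + 5) +
        4 * n + 5 * cls.length + 4 * (formulaWord n cls).length + 91)
      fun s' => s' = init (satCircuit (2 ^ h) (2 * h) cls).encode ω := by
  have hlen := length_encode_satCircuit (2 ^ h) (2 * h) cls
  have hpos := listPos_length n cls
  set T := cls.length * (2 ^ h * (K * (8 * K + 23) + 12) + 18) +
        2 ^ h * (cls.length * (K * (8 * K + 23) + 12) + 22)
  refine (prologue_within ω hh (by omega)).then (l := T + 30 +
    (6 * (satCircuit (2 ^ h) (2 * h) cls).encode.length + 4 * (formulaWord n cls).length + 36))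
    (by omega) ?_
  rintro s1 ⟨hc, k1, k2, k9, k19, k20, k21, kr⟩
  refine (emitCircuit_within (K := K) hc ?_ k9 k19 k21 (by omega) hK (by omega) (by omega)
    (by omega)).then (l := 6 * (satCircuit (2 ^ h) (2 * h) cls).encode.length +
      4 * (formulaWord n cls).length + 36) (by omega) ?_
  · intro i hi
    simp only [k1, init, formulaWord]
    rw [add_comm 2 i, List.getD_cons_succ, List.getD_cons_succ, List.getD_eq_getElem _ _ hi]
  rintro s2 ⟨he, hr⟩
  refine (moveOutput_within (l := (satCircuit (2 ^ h) (2 * h) cls).encode)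
    (b := (formulaWord n cls).length) ?_ ?_ ?_ ?_ (by omega) ?_ ?_ ?_).mono
    le_rfl ?_
  · rw [hr 17 (by omega), hc.reg17]
  · rw [he.reg, k9]
  · rw [hr 20 (by omega), k20]
  · rw [← k9]; exact he.holds
  · intro v hv
    have := le_of_mem_encode_satCircuit hv
    omega
  · intro a ha
    rw [he.high a (by omega), k1]
    exact List.getD_eq_default _ _ (by omega)
  · intro r h22
    rw [hr r (by omega), kr r h22]
  · rintro s' rfl
    rw [he.coins, k2]

end RAM

/-! ### Values of the gates, one gate at a time -/

namespace Circuit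

/-- The values of the input gates and of the first `k` arithmetic gates. -/
def valuesUpTo {R : Type} (op : R → R → R) (z : R) (C : Circuit) (x : List R) (k : ℕ) : List R :=
  (C.gates.take k).foldl (fun vs ps => vs ++ [(ps.map (fun p => vs.getD p z)).foldr op z]) x

variable {R : Type} (op : R → R → R) (z : R) (C : Circuit) (x : List R)

@[simp] theorem valuesUpTo_zero : C.valuesUpTo op z x 0 = x := rfl

theorem valuesUpTo_length : C.valuesUpTo op z x C.gates.length = C.values op z x := by
  simp [valuesUpTo, values]

theorem valuesUpTo_succ {k : ℕ} (hk : k < C.gates.length) :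
    C.valuesUpTo op z x (k + 1) = C.valuesUpTo op z x k ++
      [((RAM.nthList C.gates k).map (fun p => (C.valuesUpTo op z x k).getD p z)).foldr op z] := by
  have : C.gates.take (k + 1) = C.gates.take k ++ [C.gates[k]] := by simp
  rw [valuesUpTo, this, List.foldl_append]
  simp only [List.foldl_cons, List.foldl_nil, RAM.nthList, List.getD_eq_getElem _ _ hk]
  rfl

theorem length_valuesUpTo {k : ℕ} (hk : k ≤ C.gates.length) :
    (C.valuesUpTo op z x k).length = x.length + k := by
  induction k with
  | zero => simp
  | succ k ih => rw [valuesUpTo_succ _ _ _ _ (by omega), List.length_append, ih (by omega)]; simp; rfl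

end Circuit

/-! ### Evaluating a circuit modulo a number -/

namespace RAM

theorem add_mod_eq {Q x y : ℕ} (hx : x < Q) (hy : y < Q) :
    (x + y) % Q = if Q - (x + y) = 0 then x + y - Q else x + y := by
  split_ifs with h
  · rw [Nat.mod_eq_sub_mod (by omega), Nat.mod_eq_of_lt (by omega)]
  · rw [Nat.mod_eq_of_lt (by omega)]

/-- Add register `6` to the register `a`, modulo register `9`. -/
def modAdd (a : ℕ) : Prog := .add a a 6 ;; .sub 0 9 a ;; .branch 0 .skip (.sub a a 9)

theorem modAdd_within {M Q x y a : ℕ} {s : State} (ha : s.reg a = x) (h6 : s.reg 6 = y)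
    (h9 : s.reg 9 = Q) (hx : x < Q) (hy : y < Q) (hM : 2 * Q ≤ M) (ha0 : a ≠ 0) (ha9 : a ≠ 9) :
    (modAdd a).Within M s 4 fun s' => s'.mem = s.mem ∧ s'.coins = s.coins ∧
      s'.reg a = (x + y) % Q ∧ ∀ r, r ≠ 0 → r ≠ a → s'.reg r = s.reg r := by
  refine Prog.Within.block (by simp [modAdd, Prog.steps]) ?_
  rw [add_mod_eq hx hy]
  generalize hQ : (fun s' : State => (_ : Prop)) = P
  simp [modAdd, Prog.wp, ha, h6, h9, ha0, ha9.symm]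
  and_intros
  any_goals intro h
  any_goals and_intros
  any_goals omega
  all_goals rw [← hQ]
  · refine ⟨rfl, rfl, ?_, fun r h0 hr => by simp [h0, hr]⟩
    simp [ha0]; omega
  · refine ⟨rfl, rfl, ?_, fun r h0 hr => by simp [h0, hr]⟩
    simp; omega

/-- Write the values of the inputs, which the program `gen` generates, and compute their sum. -/
def writeInputs (gen : Prog) : Prog :=
  (.const 10 0 ;; .const 12 0 ;; .add 12 12 7) ;;
  .loop 14 (gen ;; .store 12 6 ;; modAdd 10 ;; (.add 12 12 17 ;; .sub 14 14 17))

/-- The program `gen` writes the numbers `u 0, u 1, …` one after the other to register `6`. -/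
def Generates (M : ℕ) (gen : Prog) (n : ℕ) (u : ℕ → ℕ) (coins : ℕ → ℕ → Bool) : Prop :=
  ∀ i < n, ∀ s : State, s.coins = coins i → gen.Within M s 1 fun s' => s'.mem = s.mem ∧
    s'.coins = coins (i + 1) ∧ s'.reg 6 = u i ∧ ∀ r, r ≠ 6 → s'.reg r = s.reg r

/-- The inputs must be stored and summed in the same pass, since random ones cannot be generated
again. Their sum modulo `Q` is the value that the outputs are compared with. -/
theorem writeInputs_within {M V Q n : ℕ} {gen : Prog} {u : ℕ → ℕ} {coins : ℕ → ℕ → Bool}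
    {s : State} (hgen : Generates M gen n u coins) (hu : ∀ i < n, u i < Q)
    (h7 : s.reg 7 = V) (h9 : s.reg 9 = Q) (h14 : s.reg 14 = n) (h17 : s.reg 17 = 1)
    (hc : s.coins = coins 0) (hQ0 : 0 < Q) (hM : 2 * Q + V + n ≤ M) :
    (writeInputs gen).Within M s (9 * n + 4) fun s' =>
      (∀ a < V, s'.mem a = s.mem a) ∧ HoldsAt s'.mem V ((List.range n).map u) ∧
      s'.reg 10 = (∑ i ∈ Finset.range n, u i) % Q ∧ s'.reg 12 = V + n ∧
      ∀ r, r ≠ 0 → r ≠ 6 → r ≠ 10 → r ≠ 12 → r ≠ 14 → s'.reg r = s.reg r := by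
  refine Prog.Within.block_seq (9 * n + 1) (by simp only [Prog.steps]; omega) ?_
  generalize hQ : Prog.Within M (Prog.loop _ _) = P
  simp [Prog.wp, h7]
  and_intros
  any_goals omega
  rw [← hQ]
  clear hQ P
  refine (Prog.Within.loop_const (fun i s' => s'.coins = coins i ∧
      (∀ a < V, s'.mem a = s.mem a) ∧ HoldsAt s'.mem V ((List.range i).map u) ∧
      s'.reg 10 = (∑ i ∈ Finset.range i, u i) % Q ∧ s'.reg 12 = V + i ∧ s'.reg 14 = n - i ∧
      ∀ r, r ≠ 0 → r ≠ 6 → r ≠ 10 → r ≠ 12 → r ≠ 14 → s'.reg r = s.reg r) n 8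
      ?_ ?_ ?_).mono (by omega) ?_
  · rintro i hi s1 ⟨k1, k2, k3, k10, k12, k14, kr⟩
    refine ⟨by omega, by omega, (hgen i hi s1 k1).then (l := 7) (by omega) ?_⟩
    rintro s2 ⟨j1, j2, j6, jr⟩
    have hui := hu i hi
    have j9 := (jr 9 (by omega)).trans ((kr 9 (by omega) (by omega) (by omega) (by omega)
      (by omega)).trans h9)
    have j10 := (jr 10 (by omega)).trans k10
    have j12 := (jr 12 (by omega)).trans k12
    refine Prog.Within.block_seq 6 (by decide) ⟨by omega, by omega, ?_⟩
    rw [j12, j6]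
    refine (modAdd_within (M := M) (x := (∑ i ∈ Finset.range i, u i) % Q) (y := u i) (Q := Q)
      ?_ ?_ ?_ (Nat.mod_lt _ hQ0) hui (by omega) (by omega) (by omega)).then (l := 2)
      (by omega) ?_
    · simpa using j10
    · simpa using j6
    · simpa using j9
    rintro s3 ⟨i1, i2, i10, ir⟩
    have i12 := (ir 12 (by omega) (by omega)).trans j12
    have i14 := (ir 14 (by omega) (by omega)).trans ((jr 14 (by omega)).trans k14)
    have i17 := (ir 17 (by omega) (by omega)).trans ((jr 17 (by omega)).trans ((kr 17 (by omega)
      (by omega) (by omega) (by omega) (by omega)).trans h17))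
    refine Prog.Within.block (by decide) ?_
    generalize hQ : (fun s' : State => (_ : Prop)) = P
    simp [Prog.wp, i12, i14, i17]
    and_intros
    any_goals omega
    rw [← hQ]
    clear hQ P
    refine ⟨by simp [i2, j2], fun a ha => ?_, ?_, ?_, by simp; omega, by simp; omega,
      fun r h0 h6 h10 h12 h14 => ?_⟩
    · simp [i1, show a ≠ V + i by omega, j1, k2 a ha]
    · rw [List.range_succ, List.map_append, holdsAt_append]
      refine ⟨k3.congr fun a h1 h2 => ?_, ?_⟩
      · simp at h2
        simp [i1, show a ≠ V + i by omega, j1]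
      · simp [holdsAt_cons, holdsAt_nil, i1]
    · simp [i10, Finset.sum_range_succ]
    · simp [h12, h14, ir r h0 h10, jr r h6, kr r h0 h6 h10 h12 h14]
  · rintro s' ⟨-, -, -, -, -, h, -⟩
    omega
  · refine ⟨by simp [hc], by simp, by simp [holdsAt_nil], by simp, by simp, by simp [h14],
      fun r h0 h6 h10 h12 h14 => by simp [h10, h12]⟩
  · rintro s' ⟨-, k2, k3, k10, k12, -, kr⟩
    exact ⟨k2, k3, k10, k12, kr⟩

/-- Load the value of the vertex to which register `8` points. -/
def loadValue : Prog := .load 6 8 ;; .add 6 6 7 ;; .load 6 6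

theorem loadValue_within {M V v b : ℕ} {s : State} (h7 : s.reg 7 = V)
    (h8 : s.mem (s.reg 8) = v) (hv : s.mem (V + v) = b) (h8M : s.reg 8 ≤ M) (hM : V + v ≤ M)
    (hb : b ≤ M) :
    loadValue.Within M s 3 fun s' => s'.mem = s.mem ∧ s'.reg 6 = b ∧
      ∀ r, r ≠ 6 → s'.reg r = s.reg r := by
  refine Prog.Within.block (by decide) ?_
  generalize hQ : (fun s' : State => (_ : Prop)) = P
  simp [loadValue, Prog.wp, h7, h8, add_comm v V, hv]
  and_intros
  any_goals omega
  rw [← hQ]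
  exact ⟨rfl, by simp, fun r hr => by simp [hr]⟩

/-- Compute the value of the gate to whose predecessors register `8` points. -/
def evalGate : Prog :=
  (.load 4 8 ;; .add 8 8 17 ;; .const 5 0) ;;
    .loop 4 (loadValue ;; modAdd 5 ;; (.add 8 8 17 ;; .sub 4 4 17))

/-- Reduction modulo `Q` after each addition keeps the numbers below `2 * Q`; the true values over
`ℕ` may be exponential in the depth of the circuit. -/
theorem evalGate_within {M V Q p : ℕ} {ps vs : List ℕ} {s : State} (h7 : s.reg 7 = V)
    (h8 : s.reg 8 = p) (h9 : s.reg 9 = Q) (h17 : s.reg 17 = 1)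
    (hps : HoldsAt s.mem p (withLength ps)) (hvs : HoldsAt s.mem V (vs.map (· % Q)))
    (hlt : ∀ v ∈ ps, v < vs.length) (hQ0 : 0 < Q)
    (hM : p + ps.length + V + vs.length + 2 * Q + 1 ≤ M) :
    evalGate.Within M s (10 * ps.length + 4) fun s' => s'.mem = s.mem ∧
      s'.reg 5 = ((ps.map fun v => vs.getD v 0).foldr (· + ·) 0) % Q ∧
      s'.reg 8 = p + 1 + ps.length ∧ ∀ r, 9 ≤ r ∨ r = 3 ∨ r = 7 → s'.reg r = s.reg r := by
  obtain ⟨hp, hps⟩ := holdsAt_cons.1 hps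
  refine Prog.Within.block_seq (10 * ps.length + 1) (by simp only [Prog.steps]; omega) ?_
  generalize hQ : Prog.Within M (Prog.loop _ _) = P
  simp [Prog.wp, h8, h17, hp]
  and_intros
  any_goals omega
  rw [← hQ]
  clear hQ P
  refine (Prog.Within.loop_const (fun i s' => s'.mem = s.mem ∧
      s'.reg 5 = (((ps.take i).map fun v => vs.getD v 0).sum) % Q ∧
      s'.reg 8 = p + 1 + i ∧ s'.reg 4 = ps.length - i ∧
      ∀ r, 9 ≤ r ∨ r = 3 ∨ r = 7 → s'.reg r = s.reg r) ps.length 9 ?_ ?_ ?_).mono (by omega) ?_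
  · rintro i hi s1 ⟨k1, k5, k8, k4, kr⟩
    have hv := hlt ps[i] (by simp)
    refine ⟨by omega, by omega, (loadValue_within (V := V) (v := ps[i])
      (b := vs.getD ps[i] 0 % Q) ((kr 7 (by omega)).trans h7) ?_ ?_ ?_ ?_ ?_).then (l := 6)
      (by omega) ?_⟩
    · rw [k1, k8, hps i hi]
    · rw [k1, hvs _ (by simpa using hv)]
      simp [List.getElem?_eq_getElem hv]
    · omega
    · omega
    · have := Nat.mod_lt (vs.getD ps[i] 0) hQ0
      omega
    rintro s2 ⟨j1, j6, jr⟩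
    refine (modAdd_within (M := M) (Q := Q) ((jr 5 (by omega)).trans k5) j6
      ((jr 9 (by omega)).trans ((kr 9 (by omega)).trans h9)) (Nat.mod_lt _ hQ0)
      (Nat.mod_lt _ hQ0) (by omega) (by omega) (by omega)).then (l := 2) (by omega) ?_
    rintro s3 ⟨i1, -, i5, ir⟩
    have i4 := (ir 4 (by omega) (by omega)).trans ((jr 4 (by omega)).trans k4)
    have i8 := (ir 8 (by omega) (by omega)).trans ((jr 8 (by omega)).trans k8)
    have i17 := (ir 17 (by omega) (by omega)).trans ((jr 17 (by omega)).trans ((kr 17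
      (by omega)).trans h17))
    refine Prog.Within.block (by decide) ?_
    generalize hQ : (fun s' : State => (_ : Prop)) = P
    simp only [Prog.wp, State.setReg_reg]
    simp [i4, i8, i17]
    and_intros
    any_goals omega
    rw [← hQ]
    clear hQ P
    refine ⟨by simp [i1, j1, k1], ?_, by simp; omega, by simp; omega, fun r hr => ?_⟩
    · have ht : ps.take (i + 1) = ps.take i ++ [ps[i]] := by simp
      rw [ht, List.map_append, List.sum_append]
      simp only [State.setReg_reg, i5]
      simp
    · simp [show r ≠ 4 by omega, show r ≠ 8 by omega, ir r (by omega) (by omega),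
        jr r (by omega), kr r hr]
  · rintro s' ⟨-, -, -, h, -⟩
    omega
  · refine ⟨rfl, by simp, by simp, by simp, fun r hr => ?_⟩
    simp [show r ≠ 4 by omega, show r ≠ 5 by omega, show r ≠ 8 by omega]
  · rintro s' ⟨k1, k5, k8, -, kr⟩
    exact ⟨k1, by simpa [List.sum] using k5, k8, kr⟩

/-- Compute the values of all gates. -/
def evalGates : Prog :=
  .loop 3 (evalGate ;; (.store 12 5 ;; .add 12 12 17 ;; .sub 3 3 17))

/-- The lengths of consecutive lists telescope to an address; the summand `2 * c` accounts for the
two header cells. -/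
theorem sum_listPos {ls : List (List ℕ)} {k : ℕ} (hk : k ≤ ls.length) (c : ℕ) :
    ∑ i ∈ Finset.range k, c * (1 + (nthList ls i).length) + 2 * c = c * listPos ls k := by
  induction k with
  | zero => simp; ring
  | succ k ih =>
    rw [Finset.sum_range_succ, listPos_succ (by omega)]
    linear_combination ih (by omega)

/-- The number of instructions must be linear in the length of the encoding: the rewritten circuit
may already have size about `2 ^ ((1 - ε / 2) n)`, so a bound by the number of gates times the
largest fan-in would be too weak. -/
theorem evalGates_within {M V Q : ℕ} {D : Circuit} {us : List ℕ} {s : State} (hD : D.WellFormed)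
    (hus : us.length = D.inputs) (h7 : s.reg 7 = V) (h8 : s.reg 8 = 2) (h9 : s.reg 9 = Q)
    (h3 : s.reg 3 = D.gates.length) (h12 : s.reg 12 = V + D.inputs) (h17 : s.reg 17 = 1)
    (hgates : HoldsAt s.mem 2 (D.gates.flatMap withLength))
    (hV : listPos D.gates D.gates.length ≤ V)
    (hin : HoldsAt s.mem V (us.map (· % Q))) (hQ0 : 0 < Q)
    (hM : 2 * V + D.inputs + D.gates.length + 2 * Q + 1 ≤ M) :
    evalGates.Within M s (10 * V + 1) fun s' =>
      (∀ a < V, s'.mem a = s.mem a) ∧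
      HoldsAt s'.mem V ((D.values (fun a b => a + b) 0 us).map (· % Q)) ∧
      s'.reg 8 = listPos D.gates D.gates.length ∧
      ∀ r, 9 ≤ r ∧ r ≠ 12 ∨ r = 7 → s'.reg r = s.reg r := by
  -- The cost of a round is rounded up so that, with the loop test, it is ten times the length of
  -- the entry of the gate; these costs are added up by `sum_listPos`.
  refine (Prog.Within.loop (fun i s' => (∀ a < V, s'.mem a = s.mem a) ∧
      HoldsAt s'.mem V ((D.valuesUpTo (fun a b => a + b) 0 us i).map (· % Q)) ∧
      s'.reg 8 = listPos D.gates i ∧ s'.reg 3 = D.gates.length - i ∧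
      s'.reg 12 = V + D.inputs + i ∧
      ∀ r, 9 ≤ r ∧ r ≠ 12 ∨ r = 7 → s'.reg r = s.reg r) D.gates.length
      (fun i => 9 + 10 * (nthList D.gates i).length) ?_ ?_ ?_).mono ?_ ?_
  · rintro i hi s1 ⟨k1, k2, k8, k3, k12, kr⟩
    have hle := listPos_le D.gates (i := i + 1) (by omega)
    have hsucc := listPos_succ hi
    have hgates' : HoldsAt s1.mem 2 (D.gates.flatMap withLength) := by
      refine hgates.congr fun a _ ha => k1 a ?_
      simp only [listPos, List.take_length] at hV
      omega
    have hlen := D.length_valuesUpTo (fun a b => a + b) 0 us hi.le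
    refine ⟨by omega, by omega, (evalGate_within (V := V) (Q := Q) (ps := nthList D.gates i)
      ((kr 7 (by omega)).trans h7) k8 ((kr 9 (by omega)).trans h9) ((kr 17 (by omega)).trans h17)
      (holdsAt_listPos hgates' hi) k2 ?_ hQ0 ?_).then (l := 3) (by omega) ?_⟩
    · intro v hv
      rw [nthList, List.getD_eq_getElem _ _ hi] at hv
      have := (hD.1 i hi).2.2 v hv
      omega
    · omega
    rintro s2 ⟨j1, j5, j8, jr⟩
    have j3 := (jr 3 (by omega)).trans k3
    have j12 := (jr 12 (by omega)).trans k12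
    have j17 := (jr 17 (by omega)).trans ((kr 17 (by omega)).trans h17)
    have hlt := Nat.mod_lt (((nthList D.gates i).map fun v =>
      (D.valuesUpTo (fun a b => a + b) 0 us i).getD v 0).foldr (· + ·) 0) hQ0
    rw [← j5] at hlt
    refine Prog.Within.block (by decide) ?_
    generalize hQ : (fun s' : State => (_ : Prop)) = P
    simp [Prog.wp, j3, j12, j17]
    and_intros
    any_goals omega
    rw [← hQ]
    clear hQ P
    refine ⟨fun a ha => ?_, ?_, by simp [j8]; omega, by simp; omega, by simp; omega,
      fun r hr => ?_⟩
    · simp [show a ≠ V + D.inputs + i by omega, j1, k1 a ha]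
    · rw [D.valuesUpTo_succ _ _ _ hi, List.map_append, holdsAt_append]
      refine ⟨k2.congr fun a h1 h2 => ?_, ?_⟩
      · simp [hlen] at h2
        simp [show a ≠ V + D.inputs + i by omega, j1]
      · simp only [List.map_cons, List.map_nil, holdsAt_cons, holdsAt_nil, and_true,
          List.length_map, hlen, hus]
        simp only [State.setReg_mem, State.setMem_mem, add_assoc, if_true]
        exact j5
    · simp [show r ≠ 3 by omega, show r ≠ 12 by omega, jr r (by omega), kr r hr]
  · rintro s' ⟨-, -, -, h, -⟩
    omega
  · exact ⟨fun a _ => rfl, hin, h8, h3, h12, fun r _ => rfl⟩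
  · have h := sum_listPos (ls := D.gates) le_rfl 10
    have : ∀ i, 9 + 10 * (nthList D.gates i).length + 1 = 10 * (1 + (nthList D.gates i).length) :=
      fun i => by ring
    simp only [this]
    omega
  · rintro s' ⟨k1, k2, k8, -, -, kr⟩
    rw [D.valuesUpTo_length] at k2
    exact ⟨k1, k2, k8, kr⟩

/-- Test whether the value of an output gate differs from register `10`. -/
def testOutputs : Prog :=
  (.load 4 8 ;; .add 8 8 17 ;; .const 11 0) ;;
  .loop 4 (loadValue ;; (.sub 0 6 10 ;; .sub 1 10 6 ;; .add 0 0 1 ;;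
    .branch 0 (.const 11 1) .skip ;; .add 8 8 17 ;; .sub 4 4 17)) ;;
  (.const 0 0 ;; .store 0 11)

/-- With truncated subtraction, `(a - b) + (b - a)` is nonzero iff `a ≠ b`. Register `11` is set at
the first difference and is never cleared afterwards. -/
theorem testOutputs_within {M V Q p t : ℕ} {os vs : List ℕ} {s : State} (h7 : s.reg 7 = V)
    (h8 : s.reg 8 = p) (h10 : s.reg 10 = t) (h17 : s.reg 17 = 1)
    (hos : HoldsAt s.mem p (withLength os)) (hvs : HoldsAt s.mem V (vs.map (· % Q)))
    (hlt : ∀ v ∈ os, v < vs.length) (hQ0 : 0 < Q) (ht : t < Q)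
    (hM : p + os.length + V + vs.length + 2 * Q + 1 ≤ M) :
    testOutputs.Within M s (11 * os.length + 7) fun s' =>
      s'.mem 0 = if os.any (fun v => vs.getD v 0 % Q ≠ t) then 1 else 0 := by
  obtain ⟨hp, hos⟩ := holdsAt_cons.1 hos
  refine Prog.Within.block_seq (11 * os.length + 4) (by simp only [Prog.steps]; omega) ?_
  generalize hQ : Prog.Within M (_ ;; _) = P
  simp [Prog.wp, h8, h17, hp]
  and_intros
  any_goals omega
  rw [← hQ]
  clear hQ P
  refine (Prog.Within.loop_const (fun i s' => s'.mem = s.mem ∧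
      (s'.reg 11 = if (os.take i).any (fun v => vs.getD v 0 % Q ≠ t) then 1 else 0) ∧
      s'.reg 8 = p + 1 + i ∧ s'.reg 4 = os.length - i ∧
      ∀ r, r = 7 ∨ r = 10 ∨ r = 17 → s'.reg r = s.reg r) os.length 10 ?_ ?_ ?_).then (l := 2)
      (by omega) ?_
  · rintro i hi s1 ⟨k1, k11, k8, k4, kr⟩
    have hv := hlt os[i] (by simp)
    have hb := Nat.mod_lt (vs.getD os[i] 0) hQ0
    refine ⟨by omega, by omega, (loadValue_within (V := V) (v := os[i])
      (b := vs.getD os[i] 0 % Q) ((kr 7 (by omega)).trans h7) ?_ ?_ ?_ ?_ ?_).then (l := 7)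
      (by omega) ?_⟩
    · rw [k1, k8, hos i hi]
    · rw [k1, hvs _ (by simpa using hv)]
      simp [List.getElem?_eq_getElem hv]
    · omega
    · omega
    · omega
    rintro s2 ⟨j1, j6, jr⟩
    have j4 := (jr 4 (by omega)).trans k4
    have j8 := (jr 8 (by omega)).trans k8
    have j10 := (jr 10 (by omega)).trans ((kr 10 (by omega)).trans h10)
    have j11 := (jr 11 (by omega)).trans k11
    have j17 := (jr 17 (by omega)).trans ((kr 17 (by omega)).trans h17)
    have ht' : os.take (i + 1) = os.take i ++ [os[i]] := by simp
    rw [ht', List.any_append]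
    set b := vs.getD os[i] 0 % Q with hb'
    refine Prog.Within.block (by decide) ?_
    generalize hQ : (fun s' : State => (_ : Prop)) = P
    simp [Prog.wp, j4, j6, j8, j10, j17]
    and_intros
    any_goals intro h
    any_goals intro h'
    any_goals and_intros
    any_goals omega
    all_goals rw [← hQ]
    · refine ⟨by simp [j1, k1], ?_, by simp; omega, by simp; omega, fun r hr => ?_⟩
      · have : b ≠ t := by omega
        simp only [List.any_cons, List.any_nil, ← hb']
        simp [this]
      · simp [show r ≠ 0 by omega, show r ≠ 1 by omega, show r ≠ 4 by omega,
          show r ≠ 8 by omega, show r ≠ 11 by omega, jr r (by omega), kr r hr]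
    · refine ⟨by simp [j1, k1], ?_, by simp; omega, by simp; omega, fun r hr => ?_⟩
      · have : b = t := by omega
        simp only [List.any_cons, List.any_nil, ← hb', State.setReg_reg]
        simp [this, j11]
      · simp [show r ≠ 0 by omega, show r ≠ 1 by omega, show r ≠ 4 by omega,
          show r ≠ 8 by omega, jr r (by omega), kr r hr]
  · rintro s' ⟨-, -, -, h, -⟩
    omega
  · refine ⟨rfl, by simp, by simp, by simp, fun r hr => ?_⟩
    simp [show r ≠ 4 by omega, show r ≠ 8 by omega, show r ≠ 11 by omega]
  · rintro s1 ⟨-, k11, -, -, -⟩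
    rw [List.take_length] at k11
    refine Prog.Within.block (by decide) ?_
    have : s1.reg 11 ≤ 1 := by rw [k11]; split_ifs <;> omega
    simp only [Prog.wp, State.setReg_reg, State.setReg_mem, State.setMem_mem]
    simp only [OfNat.ofNat_ne_zero, if_false, if_true]
    exact ⟨by omega, by omega, by omega, by simpa using k11⟩

/-- Test whether some output of a circuit differs from the sum of the inputs, modulo the number that
`setMod` writes to register `9`. The inputs are generated by `gen`. -/
def check (setMod gen : Prog) : Prog :=
  (.const 17 1 ;; .const 0 0 ;; .load 14 0 ;; .const 8 2 ;; .load 13 17) ;;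
  skipLists ;; (.load 0 8 ;; .add 7 8 0 ;; .add 7 7 17 ;; .load 3 17) ;; setMod ;;
  writeInputs gen ;; .const 8 2 ;; evalGates ;; testOutputs

theorem length_formulaWord_ge (n : ℕ) (ls : List (List ℕ)) :
    ls.length + 2 ≤ (formulaWord n ls).length := by
  simp only [formulaWord, List.length_cons, List.length_flatMap]
  have := List.length_le_sum_of_one_le (ls.map fun l => (withLength l).length) (by simp)
  rw [List.length_map] at this
  omega

/-- The values of the vertices are stored directly behind the encoding of `D`, from address `V =
D.encode.length` on. Nothing is assumed about the cells there, since each is written before it is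
read. -/
theorem check_within {M Q : ℕ} {setMod gen : Prog} {u : ℕ → ℕ} {coins : ℕ → ℕ → Bool}
    {D : Circuit} {s : State} (hD : D.WellFormed) (hs : s.Holds D.encode)
    (hc : s.coins = coins 0)
    (hset : ∀ s : State, s.reg 14 = D.inputs → s.reg 17 = 1 → setMod.Within M s 1 fun s' =>
      s'.mem = s.mem ∧ s'.coins = s.coins ∧ s'.reg 9 = Q ∧ ∀ r, r ≠ 9 → s'.reg r = s.reg r)
    (hgen : Generates M gen D.inputs u coins) (hu : ∀ i < D.inputs, u i < Q) (hQ0 : 0 < Q)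
    (hM : 4 * D.encode.length + 2 * D.inputs + 2 * Q + 10 ≤ M) :
    (check setMod gen).Within M s (26 * D.encode.length + 9 * D.inputs + 30) fun s' =>
      s'.mem 0 = if D.outputs.any (fun v => (D.values (fun a b => a + b) 0
        ((List.range D.inputs).map u)).getD v 0 % Q ≠ (∑ i ∈ Finset.range D.inputs, u i) % Q)
        then 1 else 0 := by
  have henc : D.encode = formulaWord D.inputs D.gates ++ withLength D.outputs := by
    simp [Circuit.encode, formulaWord, withLength]; rfl
  have hpos := listPos_length D.inputs D.gates
  have hlen : D.encode.length = listPos D.gates D.gates.length + (D.outputs.length + 1) := by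
    rw [henc, List.length_append, hpos, length_withLength]
  have hG := length_formulaWord_ge D.inputs D.gates
  have hs' : HoldsAt s.mem 0 D.encode := fun i hi => by simpa using hs i hi
  rw [henc, holdsAt_append] at hs'
  obtain ⟨hf, ho⟩ := hs'
  rw [zero_add, ← hpos] at ho
  obtain ⟨m0, hf⟩ := holdsAt_cons.1 hf
  obtain ⟨m1, hf⟩ := holdsAt_cons.1 hf
  simp only [zero_add, Nat.reduceAdd] at m1 hf
  have hflat : 2 + (D.gates.flatMap withLength).length = listPos D.gates D.gates.length := by
    simp [listPos]
  set V := D.encode.length with hV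
  refine Prog.Within.block_seq (26 * V + 9 * D.inputs + 25)
    (by simp only [Prog.steps]; omega) ?_
  generalize hQ : Prog.Within M (_ ;; _) = P
  simp [Prog.wp, m0, m1]
  and_intros
  any_goals omega
  rw [← hQ]
  clear hQ P
  refine (skipLists_within (ls := D.gates) ?_ ?_ ?_ ?_ ?_).then
    (l := 21 * V + 9 * D.inputs + 24) (by omega) ?_
  · simp
  · simpa using hf
  · simp
  · simp
  · omega
  rintro s1 ⟨a1, a2, a8, ar⟩
  have a14 := ar 14 (by omega) (by omega)
  have a17 := ar 17 (by omega) (by omega)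
  simp at a1 a2 a14 a17
  have mo := (holdsAt_cons.1 ho).1
  refine Prog.Within.block_seq (21 * V + 9 * D.inputs + 20) (by simp only [Prog.steps]; omega) ?_
  generalize hQ : Prog.Within M (_ ;; _) = P
  simp [Prog.wp, a1, a8, a17, mo, m1]
  and_intros
  any_goals omega
  rw [← hQ]
  clear hQ P
  rw [show listPos D.gates D.gates.length + D.outputs.length + 1 = V by omega]
  refine (hset _ (by simp [a14]) (by simp [a17])).then (l := 21 * V + 9 * D.inputs + 19)
    (by omega) ?_
  rintro s2 ⟨b1, b2, b9, br⟩
  have b3 := br 3 (by omega)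
  have b7 := br 7 (by omega)
  have b14 := br 14 (by omega)
  have b17 := br 17 (by omega)
  simp [a1, a2, a14, a17] at b1 b2 b3 b7 b14 b17
  refine (writeInputs_within hgen hu b7 b9 b14 b17 (b2.trans hc) hQ0 (by omega)).then
    (l := 21 * V + 15) (by omega) ?_
  rintro s3 ⟨c1, c2, c10, c12, cr⟩
  have c3 := (cr 3 (by omega) (by omega) (by omega) (by omega) (by omega)).trans b3
  have c7 := (cr 7 (by omega) (by omega) (by omega) (by omega) (by omega)).trans b7
  have c9 := (cr 9 (by omega) (by omega) (by omega) (by omega) (by omega)).trans b9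
  have c17 := (cr 17 (by omega) (by omega) (by omega) (by omega) (by omega)).trans b17
  rw [b1] at c1
  refine Prog.Within.block_seq (21 * V + 14) (by simp only [Prog.steps]; omega) ⟨by omega, ?_⟩
  -- The generated inputs are below `Q`, so they are their own residues.
  have hmod : ((List.range D.inputs).map u).map (· % Q) = (List.range D.inputs).map u := by
    rw [List.map_map]
    refine List.map_congr_left fun i hi => ?_
    exact Nat.mod_eq_of_lt (hu i (List.mem_range.1 hi))
  refine (evalGates_within (V := V) (Q := Q) (us := (List.range D.inputs).map u) hD ?_ ?_ ?_ ?_ ?_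
    ?_ ?_ ?_ ?_ ?_ hQ0 ?_).then (l := 11 * V + 13) (by omega) ?_
  · simp
  · simp [c7]
  · simp
  · simp [c9]
  · simp [c3]
  · simp [c12]
  · simp [c17]
  · exact hf.congr fun a _ ha => c1 a (by omega)
  · omega
  · rw [hmod]; exact c2
  · omega
  rintro s4 ⟨d1, d2, d8, dr⟩
  have d7 := dr 7 (by omega)
  have d10 := dr 10 (by omega)
  have d17 := dr 17 (by omega)
  simp [c7, c10, c17] at d7 d10 d17
  have hvl : (D.values (fun a b => a + b) 0 ((List.range D.inputs).map u)).length =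
      D.inputs + D.gates.length := by
    rw [← D.valuesUpTo_length, D.length_valuesUpTo _ _ _ le_rfl]; simp
  refine (testOutputs_within (V := V) d7 d8 d10 d17 (ho.congr fun a h1 h2 => ?_) d2 ?_ hQ0
    (Nat.mod_lt _ hQ0) ?_).mono (by omega) fun _ h => by simpa using h
  · rw [length_withLength] at h2
    rw [d1 a (by omega)]
    exact c1 a (by omega)
  · intro v hv
    rw [hvl]
    exact (hD.2.2.2 v hv).2
  · omega

end RAM

/-! ### The circuit of a formula -/

namespace RAM

/-- The hypothesis says that `N` lies outside the interval `[g, g + n)` of candidates. Clause gates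
satisfy the second alternative, output gates the first. -/
theorem nodup_gatePreds {N g n : ℕ} {f : ℕ → Bool} (h : N < g ∨ g + n ≤ N) :
    (gatePreds N g n f).Nodup := by
  rw [gatePreds, List.nodup_cons]
  constructor
  · simp only [List.mem_map, List.mem_filter, List.mem_range, not_exists, not_and]
    omega
  · exact (List.nodup_range.filter _).map fun a b h => by simpa using h

theorem gatePreds_ne_nil {N g n : ℕ} {f : ℕ → Bool} : gatePreds N g n f ≠ [] := by
  simp [gatePreds]

end RAM

open RAM

theorem satCircuit_wellFormed {N H : ℕ} {cls : List (List ℕ)} (hN : 0 < N) :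
    (satCircuit N H cls).WellFormed := by
  refine ⟨fun i hi => ?_, ?_, ?_, ?_⟩
  · simp only [satCircuit] at hi ⊢
    simp only [List.length_append, List.length_map, List.length_range, List.length_cons] at hi
    rcases lt_trichotomy i cls.length with h | rfl | h
    · rw [List.getElem_append_left (by simpa using h)]
      simp only [List.getElem_map, List.getElem_range]
      refine ⟨gatePreds_ne_nil, nodup_gatePreds (by omega), fun p hp => ?_⟩
      rcases mem_gatePreds.1 hp with rfl | ⟨i, hi, -, rfl⟩ <;> omega
    · rw [List.getElem_append_right (by simp)]
      simp
      omega
    · rw [List.getElem_append_right (by simpa using h.le)]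
      obtain ⟨k, rfl⟩ := Nat.exists_eq_add_of_lt h
      simp only [List.length_map, List.length_range,
        show cls.length + k + 1 - cls.length = k + 1 by omega, List.getElem_cons_succ,
        List.getElem_map, List.getElem_range]
      refine ⟨gatePreds_ne_nil, nodup_gatePreds (by omega), fun p hp => ?_⟩
      rcases mem_gatePreds.1 hp with rfl | ⟨i, hi, -, rfl⟩ <;> omega
  · simp [satCircuit]; omega
  · exact List.nodup_range.map fun a b h => by simpa using h
  · simp only [satCircuit, List.mem_map, List.mem_range, List.length_append, List.length_map,
      List.length_range, List.length_cons]
    omega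

theorem sum_map_range_le {f : ℕ → ℕ} {n k : ℕ} (h : ∀ i, f i ≤ k) :
    ((List.range n).map f).sum ≤ n * k := by
  simpa using List.sum_le_card_nsmul ((List.range n).map f) k (by simp; intro i _; exact h i)

theorem size_satCircuit_le (N H : ℕ) (cls : List (List ℕ)) :
    (satCircuit N H cls).size ≤ cls.length * (N + 1) + 1 + N * (cls.length + 1) := by
  have h1 := sum_map_range_le (n := cls.length) (f := fun j => (leftPreds N H cls j).length)
    (k := N + 1) fun j => length_gatePreds_le _ _ _ _
  have h2 := sum_map_range_le (n := N) (f := fun y => (rightPreds N H cls y).length)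
    (k := cls.length + 1) fun j => length_gatePreds_le _ _ _ _
  simp only [satCircuit, Circuit.size, List.map_append, List.map_map, List.map_cons,
    List.sum_append, List.sum_cons, List.length_cons, List.length_nil]
  simp only [Function.comp_def]
  omega

/-- The output gates supply at least `N` wires. The gate with the single predecessor `N` supplies
the missing one, which matters when there are no clauses. -/
theorem inputs_le_size_satCircuit (N H : ℕ) (cls : List (List ℕ)) :
    (satCircuit N H cls).inputs ≤ (satCircuit N H cls).size := by
  have h2 := List.length_le_sum_of_one_le
    ((List.range N).map fun y => (rightPreds N H cls y).length) (by
      simp only [List.mem_map, forall_exists_index, and_imp]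
      rintro _ y - rfl
      exact List.length_pos_of_ne_nil gatePreds_ne_nil)
  simp only [List.length_map, List.length_range] at h2
  simp only [satCircuit, Circuit.size, List.map_append, List.map_map, List.map_cons,
    List.sum_append, List.sum_cons, List.length_cons, List.length_nil]
  simp only [Function.comp_def]
  omega

namespace Circuit

variable {R S : Type} (op : R → R → R) (z : R)

/-- A layer of gates whose predecessors are on lower layers. -/
theorem foldl_layer (gs : List (List ℕ)) (vs ws : List R)
    (h : ∀ ps ∈ gs, ∀ p ∈ ps, p < vs.length) :
    gs.foldl (fun vs ps => vs ++ [(ps.map (fun p => vs.getD p z)).foldr op z]) (vs ++ ws) =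
      vs ++ ws ++ gs.map fun ps => (ps.map (fun p => vs.getD p z)).foldr op z := by
  induction gs generalizing ws with
  | nil => simp
  | cons ps gs ih =>
    have : ps.map (fun p => (vs ++ ws).getD p z) = ps.map (fun p => vs.getD p z) :=
      List.map_congr_left fun p hp => List.getD_append _ _ _ _ (h ps (by simp) p hp)
    rw [List.foldl_cons, this, List.append_assoc,
      ih _ fun ps hps => h ps (List.mem_cons_of_mem _ hps)]
    simp

/-- A homomorphism maps the values of the gates to the values of the gates. -/
theorem map_values {op : R → R → R} {z : R} {op' : S → S → S} {z' : S} (f : R → S)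
    (hop : ∀ a b, f (op a b) = op' (f a) (f b)) (hz : f z = z') (C : Circuit) (x : List R) :
    (C.values op z x).map f = C.values op' z' (x.map f) := by
  have hfold : ∀ l : List R, f (l.foldr op z) = (l.map f).foldr op' z' := by
    intro l
    induction l with
    | nil => simpa using hz
    | cons a l ih => simp [hop, ih]
  unfold values
  generalize C.gates = gs
  induction gs generalizing x with
  | nil => simp
  | cons ps gs ih =>
    rw [List.foldl_cons, List.foldl_cons, ih, List.map_append]
    congr 2
    simp only [List.map_cons, List.map_nil, hfold, List.map_map]
    congr 3
    funext p
    simp only [Function.comp_apply, List.getD_eq_getElem?_getD, List.getElem?_map]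
    cases x[p]? <;> simp [hz]

theorem map_eval {op : R → R → R} {z : R} {op' : S → S → S} {z' : S} (f : R → S)
    (hop : ∀ a b, f (op a b) = op' (f a) (f b)) (hz : f z = z') (C : Circuit) (x : List R) :
    (C.eval op z x).map f = C.eval op' z' (x.map f) := by
  rw [eval, eval, ← map_values f hop hz, List.map_map]
  refine List.map_congr_left fun p _ => ?_
  simp only [Function.comp_apply, List.getD_eq_getElem?_getD, List.getElem?_map]
  cases (C.values op z x)[p]? <;> simp [hz]

end Circuit

theorem foldr_or_eq_true (l : List Bool) : l.foldr (fun a b => a || b) false = true ↔ true ∈ l := by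
  induction l with
  | nil => simp
  | cons a l ih => rw [List.foldr_cons, Bool.or_eq_true, ih, List.mem_cons, @eq_comm _ a]

/-- The partial assignments `x` and `y` together falsify a clause. -/
def jointlyFalsifies (N H : ℕ) (cls : List (List ℕ)) (y x : ℕ) : Bool :=
  (List.range cls.length).any fun j =>
    falsifies N H 0 x (nthList cls j) && falsifies N H H y (nthList cls j)

theorem jointlyFalsifies_iff {N H : ℕ} {cls : List (List ℕ)} {y x : ℕ} :
    jointlyFalsifies N H cls y x = true ↔ ∃ j < cls.length,
      falsifies N H 0 x (nthList cls j) = true ∧ falsifies N H H y (nthList cls j) = true := by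
  simp [jointlyFalsifies]

/-- The matrix that is computed by `satCircuit`. -/
def satMatrix (N H : ℕ) (cls : List (List ℕ)) : Matrix (Fin N) (Fin (N + 1)) Bool :=
  fun y x => decide ((x : ℕ) = N) || jointlyFalsifies N H cls y x

/-- The arithmetic gates form two layers. Over the boolean semiring an output is the disjunction of
the `x i` that reach it along some path, and idempotence makes the number of paths irrelevant. -/
theorem satCircuit_orComputes (N H : ℕ) (cls : List (List ℕ)) :
    (satCircuit N H cls).OrComputes (satMatrix N H cls) := by
  refine ⟨rfl, fun x => ?_⟩
  set op : Bool → Bool → Bool := fun a b => a || b with hop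
  set xs := List.ofFn x with hxs
  have hlen : xs.length = N + 1 := by simp [hxs]
  set L1 := ((List.range cls.length).map (leftPreds N H cls) ++ [[N]]).map
    fun ps => (ps.map (fun p => xs.getD p false)).foldr op false with hL1
  have hlen1 : L1.length = cls.length + 1 := by simp [hL1]
  set L2 := ((List.range N).map (rightPreds N H cls)).map
    fun ps => (ps.map (fun p => (xs ++ L1).getD p false)).foldr op false with hL2
  -- The clause gates and the middle gate read inputs only, and the output gates read only inputs
  -- and clause gates, so each layer is evaluated at once.
  have hval : (satCircuit N H cls).values op false xs = xs ++ L1 ++ L2 := by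
    have h1 := Circuit.foldl_layer op false
      ((List.range cls.length).map (leftPreds N H cls) ++ [[N]]) xs [] (by
        simp only [List.mem_append, List.mem_map, List.mem_range, List.mem_singleton]
        rintro _ (⟨j, hj, rfl⟩ | rfl) p hp
        · rcases mem_gatePreds.1 hp with rfl | ⟨i, hi, -, rfl⟩ <;> omega
        · simp at hp; omega)
    have h2 := Circuit.foldl_layer op false
      ((List.range N).map (rightPreds N H cls)) (xs ++ L1) [] (by
        simp only [List.mem_map, List.mem_range, List.length_append]
        rintro _ ⟨j, hj, rfl⟩ p hp
        rcases mem_gatePreds.1 hp with rfl | ⟨i, hi, -, rfl⟩ <;> omega)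
    rw [List.append_nil] at h1 h2
    rw [Circuit.values, satCircuit, show (List.range cls.length).map (leftPreds N H cls) ++
      [N] :: (List.range N).map (rightPreds N H cls) =
      ((List.range cls.length).map (leftPreds N H cls) ++ [[N]]) ++
        (List.range N).map (rightPreds N H cls) by simp, List.foldl_append, h1, h2]
  have hx : ∀ i (hi : i < N + 1), (xs ++ L1).getD i false = x ⟨i, hi⟩ := by
    intro i hi
    rw [List.getD_append _ _ _ _ (by omega), List.getD_eq_getElem _ _ (by omega)]
    simp only [hxs, List.getElem_ofFn]
  have hx' : ∀ i (hi : i < N + 1), xs.getD i false = x ⟨i, hi⟩ := by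
    intro i hi
    rw [List.getD_eq_getElem _ _ (by omega)]
    simp only [hxs, List.getElem_ofFn]
  have hg : ∀ j < cls.length, ((xs ++ L1).getD (N + 1 + j) false = true ↔
      x ⟨N, by omega⟩ = true ∨ ∃ i, ∃ hi : i < N, falsifies N H 0 i (nthList cls j) = true ∧
        x ⟨i, by omega⟩ = true) := by
    intro j hj
    rw [List.getD_append_right _ _ _ _ (by omega), hlen, Nat.add_sub_cancel_left, hL1,
      List.map_append, List.getD_append _ _ _ _ (by simpa using hj),
      List.getD_eq_getElem _ _ (by simpa using hj)]
    simp only [List.getElem_map, List.getElem_range]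
    rw [foldr_or_eq_true, List.mem_map]
    constructor
    · rintro ⟨p, hp, h⟩
      rcases mem_gatePreds.1 hp with rfl | ⟨i, hi, hf, rfl⟩
      · left; rwa [hx' _ (by omega)] at h
      · right
        rw [zero_add, hx' _ (by omega)] at h
        exact ⟨i, hi, hf, h⟩
    · rintro (h | ⟨i, hi, hf, h⟩)
      · exact ⟨N, mem_gatePreds.2 (.inl rfl), by rwa [hx' _ (by omega)]⟩
      · exact ⟨0 + i, mem_gatePreds.2 (.inr ⟨i, hi, hf, rfl⟩), by rwa [zero_add, hx' _ (by omega)]⟩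
  refine List.ext_getElem (by simp [Circuit.eval, satCircuit]) fun y h1 h2 => ?_
  have hy : y < N := by simpa using h2
  rw [List.getElem_ofFn]
  simp only [Circuit.eval, hval, List.getElem_map]
  simp only [satCircuit, List.getElem_map, List.getElem_range]
  rw [List.getD_append_right _ _ _ _ (by simp [hlen, hlen1]; omega), List.length_append, hlen,
    hlen1, show N + cls.length + 2 + y - (N + 1 + (cls.length + 1)) = y by omega,
    List.getD_eq_getElem _ _ (by simpa [hL2] using hy)]
  simp only [hL2, List.getElem_map, List.getElem_range]
  rw [Bool.eq_iff_iff, foldr_or_eq_true, foldr_or_eq_true, List.mem_map]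
  simp only [List.mem_ofFn, satMatrix]
  constructor
  · rintro ⟨p, hp, h⟩
    rcases mem_gatePreds.1 hp with rfl | ⟨j, hj, hf, rfl⟩
    · rw [hx _ (by omega)] at h
      exact ⟨⟨p, by omega⟩, by simp [h]⟩
    · rw [hg j hj] at h
      rcases h with h | ⟨i, hi, hf', h⟩
      · exact ⟨⟨N, by omega⟩, by simp [h]⟩
      · refine ⟨⟨i, by omega⟩, ?_⟩
        have : jointlyFalsifies N H cls y i = true := jointlyFalsifies_iff.2 ⟨j, hj, hf', hf⟩
        simp [this, h]
  · rintro ⟨⟨i, hi⟩, h⟩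
    simp only [Bool.or_eq_true, decide_eq_true_eq, Bool.if_false_right,
      Bool.and_eq_true] at h
    obtain ⟨h, hxi⟩ := h
    rcases h with rfl | h
    · exact ⟨i, mem_gatePreds.2 (.inl rfl), by rwa [hx _ (by omega)]⟩
    · obtain ⟨j, hj, hf', hf⟩ := jointlyFalsifies_iff.1 h
      refine ⟨N + 1 + j, mem_gatePreds.2 (.inr ⟨j, hj, hf, rfl⟩), (hg j hj).2 ?_⟩
      by_cases hiN : i = N
      · subst hiN; exact .inl hxi
      · exact .inr ⟨i, by omega, hf', hxi⟩

/-! ### Satisfiability -/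

/-- The binary digits of a number below `2 ^ h`, from the most significant one on, can be prescribed. -/
theorem exists_digits (h : ℕ) (f : ℕ → Bool) :
    ∃ x < 2 ^ h, ∀ v < h, (2 ^ h ≤ 2 * ((2 ^ v * x) % 2 ^ h) ↔ f v = true) := by
  induction h generalizing f with
  | zero => exact ⟨0, by simp, by simp⟩
  | succ h ih =>
    obtain ⟨x, hx, hf⟩ := ih fun v => f (v + 1)
    have hb := Bool.toNat_le (f 0)
    -- The first prescribed digit goes on top of the number that realizes the remaining ones; any
    -- further shift removes it modulo the power of two.
    refine ⟨(f 0).toNat * 2 ^ h + x, ?_, fun v hv => ?_⟩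
    · rw [pow_succ]; nlinarith
    · cases v with
      | zero =>
        rw [pow_zero, one_mul, Nat.mod_eq_of_lt (by rw [pow_succ]; nlinarith), pow_succ]
        cases h0 : f 0
        · simp; omega
        · simp; omega
      | succ v =>
        rw [pow_succ' 2 v, pow_succ' 2 h, mul_assoc 2, Nat.mul_mod_mul_left, mul_add, ← mul_assoc (2 ^ v),
          Nat.mul_add_mod_self_right, ← hf v (by omega)]
        omega

namespace CNF

/-- The clauses of a formula, as words. -/
def words (φ : CNF) : List (List ℕ) :=
  φ.clauses.map fun cl => cl.map fun l => 2 * (l.1 : ℕ) + l.2.toNat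

theorem encode_eq (φ : CNF) : φ.encode = formulaWord φ.vars φ.words := by
  simp [encode, formulaWord, words, List.flatMap_map, withLength]

/-- A pair `(y, x)` is an assignment of `2 * h` variables, of which `φ` uses the first `φ.vars`. The
code `2 v + b` of a literal lies in the window `[0, 2 h)` iff `v < h`, and otherwise in `[2 h, 4
h)`, so each literal is seen by exactly one half. -/
theorem satisfiable_iff {φ : CNF} {h : ℕ} (hh : φ.vars ≤ 2 * h) : φ.Satisfiable ↔
    ∃ y x : Fin (2 ^ h), jointlyFalsifies (2 ^ h) (2 * h) φ.words y x = false := by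
  have key : ∀ (a : Fin φ.vars → Bool) (x y : ℕ),
      (∀ v, a v = if (v : ℕ) < h then decide (2 ^ h ≤ 2 * ((2 ^ (v : ℕ) * x) % 2 ^ h)) else
        decide (2 ^ h ≤ 2 * ((2 ^ ((v : ℕ) - h) * y) % 2 ^ h))) →
      ((∀ cl ∈ φ.clauses, ∃ l ∈ cl, a l.1 = l.2) ↔
        jointlyFalsifies (2 ^ h) (2 * h) φ.words y x = false) := by
    intro a x y ha
    have hlit : ∀ l : Fin φ.vars × Bool, a l.1 = l.2 ↔
        litTrue (2 ^ h) (2 * h) 0 x (2 * (l.1 : ℕ) + l.2.toNat) = true ∨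
        litTrue (2 ^ h) (2 * h) (2 * h) y (2 * (l.1 : ℕ) + l.2.toNat) = true := by
      rintro ⟨v, b⟩
      have hv := v.2
      have hb := Bool.toNat_le b
      have hb' : b = true ↔ b.toNat = 1 := by cases b <;> simp
      simp only [litTrue, decide_eq_true_eq, ha v]
      have e1 : (2 * (v : ℕ) + b.toNat - 0) / 2 = v := by omega
      have e2 : (2 * (v : ℕ) + b.toNat - 0) % 2 = b.toNat := by omega
      by_cases hvh : (v : ℕ) < h
      · simp only [hvh, if_true, e1, e2]
        rw [Bool.eq_iff_iff, decide_eq_true_eq, hb']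
        constructor
        · intro h; left; exact ⟨by omega, by omega, h⟩
        · rintro (h | h)
          · exact h.2.2
          · omega
      · have e3 : (2 * (v : ℕ) + b.toNat - 2 * h) / 2 = v - h := by omega
        have e4 : (2 * (v : ℕ) + b.toNat - 2 * h) % 2 = b.toNat := by omega
        simp only [hvh, if_false, e3, e4]
        rw [Bool.eq_iff_iff, decide_eq_true_eq, hb']
        constructor
        · intro h; right; exact ⟨by omega, by omega, h⟩
        · rintro (h | h)
          · omega
          · exact h.2.2
    rw [← Bool.not_eq_true, jointlyFalsifies_iff, words, List.length_map]
    constructor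
    · rintro hs ⟨j, hj, h1, h2⟩
      obtain ⟨l, hl, e⟩ := hs φ.clauses[j] (by simp)
      rw [nthList, List.getD_eq_getElem _ _ (by simpa using hj), List.getElem_map] at h1 h2
      simp only [falsifies, List.all_eq_true, List.mem_map, Bool.not_eq_true',
        forall_exists_index, and_imp] at h1 h2
      rcases (hlit l).1 e with e | e
      · rw [h1 _ l hl rfl] at e; cases e
      · rw [h2 _ l hl rfl] at e; cases e
    · intro hs cl hcl
      obtain ⟨j, hj, rfl⟩ := List.getElem_of_mem hcl
      by_contra hno
      refine hs ⟨j, hj, ?_⟩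
      rw [nthList, List.getD_eq_getElem _ _ (by simpa using hj), List.getElem_map]
      simp only [falsifies, List.all_eq_true, List.mem_map, Bool.not_eq_true',
        forall_exists_index, and_imp]
      constructor
      all_goals
        rintro _ l hl rfl
        rw [← Bool.not_eq_true]
        intro e
        exact hno ⟨l, hl, (hlit l).2 (by simp [e])⟩
  constructor
  · rintro ⟨a, ha⟩
    -- Digits that do not correspond to a variable are padded with `false`.
    obtain ⟨x, hx, hxf⟩ := exists_digits h fun v => if hv : v < φ.vars then a ⟨v, hv⟩ else false
    obtain ⟨y, hy, hyf⟩ := exists_digits h fun v =>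
      if hv : v + h < φ.vars then a ⟨v + h, hv⟩ else false
    refine ⟨⟨y, hy⟩, ⟨x, hx⟩, (key a x y fun v => ?_).1 ha⟩
    have hv := v.2
    split_ifs with hvh
    · rw [Bool.eq_iff_iff, decide_eq_true_eq, hxf v hvh]
      simp
    · rw [Bool.eq_iff_iff, decide_eq_true_eq, hyf (v - h) (by omega)]
      simp [show (v : ℕ) - h + h = v by omega]
  · rintro ⟨y, x, hxy⟩
    exact ⟨fun v => if (v : ℕ) < h then decide (2 ^ h ≤ 2 * ((2 ^ (v : ℕ) * (x : ℕ)) % 2 ^ h)) else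
      decide (2 ^ h ≤ 2 * ((2 ^ ((v : ℕ) - h) * (y : ℕ)) % 2 ^ h)), (key _ x y fun v => rfl).2 hxy⟩

end CNF

open RAM

/-! ### Random bits -/

namespace RAM

/-- Flip the `j`-th bit. -/
def flipBit (j : ℕ) (ω : ℕ → Bool) : ℕ → Bool := fun i => if i = j then !ω i else ω i

theorem flipBit_involutive (j : ℕ) : Function.Involutive (flipBit j) := by
  intro ω
  funext i
  by_cases h : i = j <;> simp [flipBit, h]

theorem measurable_flipBit (j : ℕ) : Measurable (flipBit j) := by
  refine measurable_pi_iff.2 fun i => ?_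
  exact (measurable_of_finite (fun b : Bool => if i = j then !b else b)).comp (measurable_pi_apply i)

/-- The flip acts coordinatewise, and negation preserves a fair coin. -/
theorem map_flipBit_coinMeasure (j : ℕ) : coinMeasure.map (flipBit j) = coinMeasure := by
  have h := Measure.infinitePi_map_pi (ι := ℕ) (X := fun _ => Bool) (Y := fun _ => Bool)
    (fun _ => (PMF.uniformOfFintype Bool).toMeasure)
    (f := fun i b => if i = j then !b else b) fun i => measurable_of_finite _
  refine h.trans ?_
  rw [coinMeasure]
  congr 1
  funext i
  by_cases hij : i = j
  · simp only [hij, if_true]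
    rw [PMF.toMeasure_map _ _ (measurable_of_finite _)]
    congr 1
    ext b
    cases b <;> simp [PMF.map_apply, PMF.uniformOfFintype_apply]
  · simp [hij]

instance : IsProbabilityMeasure coinMeasure := by
  unfold coinMeasure; infer_instance

/-- `S` and its preimage under the flip cover the space and have the same measure. The flip is a
measurable equivalence, so this equality holds without measurability of `S`. -/
theorem half_le_coinMeasure (j : ℕ) {S : Set (ℕ → Bool)} (h : ∀ ω, ω ∈ S ∨ flipBit j ω ∈ S) :
    1 / 2 ≤ coinMeasure S := by
  have h1 : coinMeasure (flipBit j ⁻¹' S) = coinMeasure S := by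
    have := (MeasurableEquiv.ofInvolutive (flipBit j) (flipBit_involutive j)
      (measurable_flipBit j)).map_apply (μ := coinMeasure) S
    change coinMeasure.map (flipBit j) S = _ at this
    rw [map_flipBit_coinMeasure] at this
    exact this.symm
  have h2 : (1 : ENNReal) ≤ coinMeasure S + coinMeasure S := by
    calc (1 : ENNReal) = coinMeasure Set.univ := measure_univ.symm
      _ ≤ coinMeasure (S ∪ flipBit j ⁻¹' S) := measure_mono fun ω _ => h ω
      _ ≤ _ := (measure_union_le _ _).trans_eq (by rw [h1])
  rw [← two_mul] at h2
  exact ENNReal.div_le_of_le_mul' h2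

end RAM

/-! ### The length of the output of a program -/

namespace RAM

theorem countP_le_card {mem : ℕ → ℕ} {F : Finset ℕ} (hF : ∀ a, mem a ≠ 0 → a ∈ F) {b : ℕ}
    {l : List ℕ} (h : HoldsAt mem b l) : l.countP (· ≠ 0) ≤ (F.filter (b ≤ ·)).card := by
  induction l generalizing b with
  | nil => simp
  | cons a l ih =>
    obtain ⟨h0, h1⟩ := holdsAt_cons.1 h
    have hsub : F.filter (b + 1 ≤ ·) ⊆ F.filter (b ≤ ·) := by
      intro x
      simp only [Finset.mem_filter]
      rintro ⟨h1, h2⟩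
      exact ⟨h1, by omega⟩
    by_cases ha : a = 0
    · rw [List.countP_cons_of_neg (by simpa using ha)]
      exact (ih h1).trans (Finset.card_le_card hsub)
    · rw [List.countP_cons_of_pos (by simpa using ha)]
      refine (Nat.add_le_add_right (ih h1) 1).trans ?_
      rw [← Finset.card_insert_of_notMem (a := b) (by simp)]
      refine Finset.card_le_card (Finset.insert_subset ?_ hsub)
      simp [hF b (by rw [h0]; exact ha)]

end RAM

namespace Circuit

/-- Among distinct predecessors only the vertex `0` is a zero entry, and it is balanced by the
nonzero fan-in. -/
theorem length_le_countP_withLength {ps : List ℕ} (h : ps ≠ []) (hn : ps.Nodup) :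
    (withLength ps).length ≤ 2 * (withLength ps).countP (· ≠ 0) := by
  have hpos := List.length_pos_of_ne_nil h
  have h0 : ps.countP (fun x => ¬ (decide (x ≠ 0)) = true) ≤ 1 := by
    have := List.nodup_iff_count_le_one.1 hn 0
    rw [List.count_eq_countP] at this
    refine le_trans (le_of_eq ?_) this
    refine List.countP_congr fun x _ => ?_
    simp
  have h1 := List.length_eq_countP_add_countP (fun x : ℕ => decide (x ≠ 0)) (l := ps)
  rw [withLength, List.countP_cons_of_pos (by simp; exact h), List.length_cons]
  omega

theorem length_encode_le {D : Circuit} (hD : D.WellFormed) (hin : D.inputs ≠ 0) :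
    D.encode.length ≤ 2 * D.encode.countP (· ≠ 0) := by
  have hg : (D.gates.flatMap withLength).length ≤
      2 * (D.gates.flatMap withLength).countP (· ≠ 0) := by
    have hall : ∀ ps ∈ D.gates, ps ≠ [] ∧ ps.Nodup := by
      intro ps hps
      obtain ⟨i, hi, rfl⟩ := List.getElem_of_mem hps
      exact ⟨(hD.1 i hi).1, (hD.1 i hi).2.1⟩
    generalize D.gates = gs at hall
    induction gs with
    | nil => simp
    | cons ps gs ih =>
      have h1 := length_le_countP_withLength (hall ps (by simp)).1 (hall ps (by simp)).2
      have h2 := ih fun ps hps => hall ps (List.mem_cons_of_mem _ hps)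
      rw [List.flatMap_cons, List.length_append, List.countP_append]
      omega
  have ho : D.outputs.countP (· ≠ 0) = D.outputs.length := by
    refine List.countP_eq_length.2 fun o ho => ?_
    have := (hD.2.2.2 o ho).1
    simp; omega
  have henc : D.encode = D.inputs :: D.gates.length :: (D.gates.flatMap withLength ++
    D.outputs.length :: D.outputs) := rfl
  have hol := List.length_pos_of_ne_nil hD.2.1
  have hgl : D.gates.length ≠ 0 := by
    have := hD.2.2.2 D.outputs[0] (by simp)
    omega
  rw [henc, List.countP_cons_of_pos (by simpa using hin),
    List.countP_cons_of_pos (by simpa using hgl), List.countP_append,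
    List.countP_cons_of_pos (by simpa using hD.2.1), ho]
  simp only [List.length_cons, List.length_append]
  omega

end Circuit

/-- Unwritten cells hold zero, so the final memory may hold zero entries of the output that were
never written, and the running time bounds only the number of nonzero cells. It still bounds the
length, because at least half of the entries of an encoding are nonzero. -/
theorem length_encode_le_of_runs {P : Prog} {w : List ℕ} {ω : ℕ → Bool} {t : ℕ} {s : State}
    {D : Circuit} (hrun : P.Runs (init w ω) t s) (hD : D.WellFormed) (hin : D.inputs ≠ 0)
    (hs : s.Holds D.encode) : D.encode.length ≤ 2 * (w.length + t) := by
  obtain ⟨F, hF, hsub⟩ := hrun.support (Finset.range w.length) fun a ha => by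
    rw [Finset.mem_range]
    by_contra h
    exact ha (List.getD_eq_default _ _ (by omega))
  rw [Finset.card_range] at hF
  have h := countP_le_card hsub (b := 0) (l := D.encode) fun i hi => by simpa using hs i hi
  have := Finset.card_filter_le F (0 ≤ ·)
  have := Circuit.length_encode_le hD hin
  omega

/-! ### The outputs of a circuit, modulo a number -/

namespace Circuit

/-- Some output of the circuit on the inputs `u 0, u 1, …` differs from their sum, modulo `Q`. -/
def differs (D : Circuit) (Q : ℕ) (u : ℕ → ℕ) : Bool :=
  D.outputs.any fun v => (D.values (fun a b => a + b) 0 ((List.range D.inputs).map u)).getD v 0 % Q ≠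
    (∑ i ∈ Finset.range D.inputs, u i) % Q

theorem differs_iff {D : Circuit} {Q : ℕ} {u : ℕ → ℕ} : D.differs Q u = true ↔
    ∃ v ∈ D.eval (fun a b => a + b) 0 ((List.range D.inputs).map u),
      v % Q ≠ (∑ i ∈ Finset.range D.inputs, u i) % Q := by
  simp [differs, eval]

theorem map_range_eq_ofFn {R : Type} (u : ℕ → R) (n : ℕ) :
    (List.range n).map u = List.ofFn fun j : Fin n => u j := by
  refine List.ext_getElem (by simp) fun i h1 h2 => by simp

theorem foldr_ofFn {R : Type} [AddCommMonoid R] {n : ℕ} (f : Fin n → R) :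
    (List.ofFn f).foldr (fun a b => a + b) 0 = ∑ j, f j := by
  rw [← List.sum_ofFn]; rfl

/-- On the all-ones vector an output is the number of ones in its row. This is at most `D.inputs`,
so the modulus `D.inputs + 1` loses nothing, and equality means that the row has no zero. -/
theorem SumComputes.differs_iff {D : Circuit} {m n : ℕ} {A : Matrix (Fin m) (Fin n) Bool}
    (h : D.SumComputes A) : D.differs (D.inputs + 1) (fun _ => 1) = true ↔
      ∃ i j, A i j = false := by
  obtain ⟨rfl, h⟩ := h
  rw [Circuit.differs_iff, map_range_eq_ofFn, h]
  simp only [List.mem_ofFn, exists_exists_eq_and, foldr_ofFn, Finset.sum_const, Finset.card_range,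
    smul_eq_mul, mul_one]
  refine exists_congr fun i => ?_
  have hle : (∑ j, if A i j = true then 1 else 0) ≤ D.inputs := by
    simpa using Finset.card_le_univ (Finset.univ.filter fun j => A i j = true)
  rw [Nat.mod_eq_of_lt (by omega), Nat.mod_eq_of_lt (by omega), ← not_iff_not]
  simp only [not_exists, Bool.not_eq_false, ne_eq, not_not]
  rw [Finset.sum_boole, Nat.cast_id]
  have := Finset.card_filter_eq_iff (s := (Finset.univ : Finset (Fin D.inputs)))
    (p := fun j => A i j = true)
  rw [Finset.card_univ, Fintype.card_fin] at this
  simpa using this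

theorem XorComputes.differs_iff {D : Circuit} {m n : ℕ} {A : Matrix (Fin m) (Fin n) Bool}
    (h : D.XorComputes A) (u : ℕ → ℕ) : D.differs 2 u = true ↔
      ∃ i, (∑ j, if A i j then (u j : ZMod 2) else 0) ≠ ∑ j : Fin n, (u j : ZMod 2) := by
  obtain ⟨rfl, h⟩ := h
  -- The machine adds natural numbers modulo `2`; the cast to `ZMod 2` is a homomorphism, so this
  -- evaluates the XOR-circuit.
  have hmap := map_eval (op' := fun a b => a + b) (z' := 0) (Nat.cast : ℕ → ZMod 2)
    (fun a b => Nat.cast_add a b) Nat.cast_zero D ((List.range D.inputs).map u)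
  rw [List.map_map, map_range_eq_ofFn (R := ZMod 2), h] at hmap
  rw [Circuit.differs_iff]
  have key : ∀ v : ℕ, v % 2 ≠ (∑ i ∈ Finset.range D.inputs, u i) % 2 ↔
      (v : ZMod 2) ≠ ∑ j : Fin D.inputs, (u j : ZMod 2) := by
    intro v
    rw [← Fin.sum_univ_eq_sum_range, ← Nat.cast_sum, Ne, Ne, ZMod.natCast_eq_natCast_iff']
  simp only [key]
  have hex : (∃ v ∈ D.eval (fun a b => a + b) 0 ((List.range D.inputs).map u),
      (v : ZMod 2) ≠ ∑ j : Fin D.inputs, (u j : ZMod 2)) ↔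
      ∃ v ∈ (D.eval (fun a b => a + b) 0 ((List.range D.inputs).map u)).map
        (Nat.cast : ℕ → ZMod 2), v ≠ ∑ j : Fin D.inputs, (u j : ZMod 2) := by
    simp
  rw [hex, hmap]
  simp only [List.mem_ofFn, exists_exists_eq_and, foldr_ofFn, Function.comp_apply]

/-- Flipping the bit `j` leaves row `i` unchanged, since `A i j` is zero, and changes the sum of all
inputs by one. The test therefore succeeds for at least one of the two bit sequences. -/
theorem XorComputes.half_le_differs {D : Circuit} {m n : ℕ} {A : Matrix (Fin m) (Fin n) Bool}
    (h : D.XorComputes A) {i : Fin m} {j : Fin n} (hA : A i j = false) :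
    1 / 2 ≤ coinMeasure {ω | D.differs 2 (fun k => (ω k).toNat) = true} := by
  refine half_le_coinMeasure j fun ω => ?_
  simp only [Set.mem_ofPred_eq]
  by_contra hno
  rw [not_or, h.differs_iff, h.differs_iff] at hno
  obtain ⟨h1, h2⟩ := hno
  simp only [not_exists, not_not, ne_eq] at h1 h2
  have e1 := h1 i
  have e2 := h2 i
  have hsame : (∑ k, if A i k then (((flipBit j ω k).toNat : ℕ) : ZMod 2) else 0) =
      ∑ k, if A i k then (((ω k).toNat : ℕ) : ZMod 2) else 0 := by
    refine Finset.sum_congr rfl fun k _ => ?_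
    by_cases hk : k = j
    · subst hk; simp [hA]
    · simp [flipBit, Fin.val_inj, hk]
  have hdiff : (∑ k : Fin n, (((flipBit j ω k).toNat : ℕ) : ZMod 2)) =
      (∑ k : Fin n, (((ω k).toNat : ℕ) : ZMod 2)) + 1 := by
    rw [Finset.sum_eq_add_sum_sdiff_singleton_of_mem (Finset.mem_univ j),
      Finset.sum_eq_add_sum_sdiff_singleton_of_mem (Finset.mem_univ j)
        (fun k : Fin n => (((ω k).toNat : ℕ) : ZMod 2))]
    have : ∑ k ∈ Finset.univ \ {j}, (((flipBit j ω k).toNat : ℕ) : ZMod 2) =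
        ∑ k ∈ Finset.univ \ {j}, (((ω k).toNat : ℕ) : ZMod 2) := by
      refine Finset.sum_congr rfl fun k hk => ?_
      have hk : k ≠ j := by simpa using hk
      simp [flipBit, Fin.val_inj, hk]
    rw [this]
    have : (((flipBit j ω j).toNat : ℕ) : ZMod 2) = (((ω j).toNat : ℕ) : ZMod 2) + 1 := by
      cases hj : ω j <;> simp [flipBit, hj]
      decide
    rw [this]
    ring
  rw [hsame, e1, hdiff] at e2
  simp at e2

end Circuit

open RAM

/-! ### Estimates -/

theorem build_steps_le {m n L S N : ℕ} (hm : m + 2 ≤ L) (hS : S = n + L) (hN : 1 ≤ N) :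
    m * (N * (2 * S * (8 * (2 * S) + 23) + 12) + 18) +
        N * (m * (2 * S * (8 * (2 * S) + 23) + 12) + 22) +
        6 * (m * (N + 2) + N * (m + 2) + N + 5) + 4 * n + 5 * m + 4 * L + 91 ≤
      600 * S ^ 3 * N := by
  have hmS : m ≤ S := by omega
  have hS1 : 1 ≤ S := by omega
  have h1 : S ^ 2 * N ≤ S ^ 3 * N := Nat.mul_le_mul_right _ (Nat.pow_le_pow_right hS1 (by omega))
  have h2 : S * N ≤ S ^ 2 * N :=
    Nat.mul_le_mul_right _ (by simpa using Nat.pow_le_pow_right hS1 (show 1 ≤ 2 by omega))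
  have h3 : S ≤ S * N := Nat.le_mul_of_pos_right _ hN
  have h4 : N ≤ S * N := Nat.le_mul_of_pos_left _ hS1
  calc _ ≤ S * (N * (2 * S * (8 * (2 * S) + 23) + 12) + 18) +
        N * (S * (2 * S * (8 * (2 * S) + 23) + 12) + 22) +
        6 * (S * (N + 2) + N * (S + 2) + N + 5) + 4 * S + 5 * S + 4 * S + 91 := by
        gcongr <;> omega
    _ ≤ 600 * S ^ 3 * N := by
        ring_nf at h1 h2 h3 h4 ⊢
        omega

theorem build_bound_le {m n L S N : ℕ} (hm : m + 2 ≤ L) (hS : S = n + L) (hN : 1 ≤ N) :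
    2 * L + m * (N + 2) + N * (m + 2) + 3 * N + 2 * n + m + 2 * S + 20 ≤ 100 * (S * N) := by
  have h0 : m * N ≤ S * N := Nat.mul_le_mul_right _ (by omega)
  have h3 : S ≤ S * N := Nat.le_mul_of_pos_right _ hN
  have h4 : N ≤ S * N := Nat.le_mul_of_pos_left _ (by omega)
  ring_nf at h0 h3 h4 ⊢
  omega

theorem size_bound_le {m n L S N : ℕ} (hm : m + 2 ≤ L) (hS : S = n + L) (hN : 1 ≤ N) :
    m * (N + 1) + 1 + N * (m + 1) ≤ 4 * (S * N) := by
  have h0 : m * N ≤ S * N := Nat.mul_le_mul_right _ (by omega)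
  have h3 : S ≤ S * N := Nat.le_mul_of_pos_right _ hN
  have h4 : N ≤ S * N := Nat.le_mul_of_pos_left _ (by omega)
  ring_nf at h0 h3 h4 ⊢
  omega

theorem length_bound_le {m n L S N : ℕ} (hm : m + 2 ≤ L) (hS : S = n + L) (hN : 1 ≤ N) :
    m * (N + 2) + N * (m + 2) + N + 5 ≤ 12 * (S * N) := by
  have h0 : m * N ≤ S * N := Nat.mul_le_mul_right _ (by omega)
  have h3 : S ≤ S * N := Nat.le_mul_of_pos_right _ hN
  have h4 : N ≤ S * N := Nat.le_mul_of_pos_left _ (by omega)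
  ring_nf at h0 h3 h4 ⊢
  omega

theorem two_pow_half_le (n : ℕ) :
    ((2 ^ ((n + 1) / 2) : ℕ) : ℝ) ≤ 2 * (2 : ℝ) ^ ((n : ℝ) / 2) := by
  have h : ((2 ^ ((n + 1) / 2) : ℕ) : ℝ) = (2 : ℝ) ^ (((n + 1) / 2 : ℕ) : ℝ) := by
    rw [Real.rpow_natCast]; push_cast; rfl
  rw [h]
  calc (2 : ℝ) ^ (((n + 1) / 2 : ℕ) : ℝ) ≤ (2 : ℝ) ^ ((n : ℝ) / 2 + 1) := by
        refine Real.rpow_le_rpow_of_exponent_le (by norm_num) ?_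
        have : (((n + 1) / 2 : ℕ) : ℝ) ≤ ((n + 1 : ℕ) : ℝ) / ((2 : ℕ) : ℝ) := Nat.cast_div_le
        push_cast at this
        linarith
    _ = 2 * (2 : ℝ) ^ ((n : ℝ) / 2) := by
        rw [Real.rpow_add (by norm_num), Real.rpow_one, mul_comm]

/-- The exponent `(n / 2) (2 - ε)` equals `(1 - ε / 2) n`: a circuit of size about `2 ^ (n / 2)`
turns a subquadratic rewriting time into an exponential saving. -/
theorem rpow_size_le {ε x S n : ℝ} (hε : 0 < ε) (hε1 : ε ≤ 1) (hx : 0 ≤ x) (hS : 1 ≤ S)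
    (h : x ≤ 8 * S * (2 : ℝ) ^ (n / 2)) :
    x ^ (2 - ε) ≤ 64 * S ^ 2 * (2 : ℝ) ^ ((1 - ε / 2) * n) := by
  have h2 : (0 : ℝ) < (2 : ℝ) ^ (n / 2) := Real.rpow_pos_of_pos (by norm_num) _
  calc x ^ (2 - ε) ≤ (8 * S * (2 : ℝ) ^ (n / 2)) ^ (2 - ε) :=
        Real.rpow_le_rpow hx h (by linarith)
    _ = (8 * S) ^ (2 - ε) * ((2 : ℝ) ^ (n / 2)) ^ (2 - ε) :=
        Real.mul_rpow (by positivity) h2.le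
    _ ≤ (8 * S) ^ (2 : ℝ) * ((2 : ℝ) ^ (n / 2)) ^ (2 - ε) := by
        gcongr
        · linarith
        · linarith
    _ = 64 * S ^ 2 * (2 : ℝ) ^ ((1 - ε / 2) * n) := by
        rw [← Real.rpow_mul (by norm_num), Real.rpow_two]
        ring_nf

theorem RewriteSolvable.mono {X Y : CircuitModel} {e e' : ℝ} (h : RewriteSolvable X Y e)
    (he : e ≤ e') : RewriteSolvable X Y e' := by
  obtain ⟨P, c, hP, h⟩ := h
  -- The constant is not assumed to be nonnegative, and monotonicity in the exponent needs both `0 ≤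
  -- |c|` and `1 ≤ C.size`.
  refine ⟨P, |c|, hP, fun C hC hin m n A hA => ?_⟩
  obtain ⟨t, s, D, h1, h2, h3⟩ := h C hC hin m n A hA
  refine ⟨t, s, D, h1, h2.trans ?_, h3⟩
  have hsize : 1 ≤ C.size := by
    have ho := hC.2.2.2 _ (List.head_mem hC.2.1)
    have hg : 0 < C.gates.length := by omega
    calc 1 ≤ C.gates[0].length := List.length_pos_of_ne_nil (hC.1 0 hg).1
      _ ≤ C.size := List.single_le_sum (by simp) _ (List.mem_map_of_mem (by simp))
  have : (1 : ℝ) ≤ C.size := by exact_mod_cast hsize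
  gcongr
  exact le_abs_self c

/-! ### The reduction -/

namespace CNF

theorem length_words_add_two_le (φ : CNF) : φ.words.length + 2 ≤ φ.encode.length := by
  rw [encode_eq]; exact length_formulaWord_ge _ _

theorem words_le (φ : CNF) : ∀ cl ∈ φ.words, cl.length ≤ 2 * φ.size ∧ ∀ l ∈ cl, l ≤ 2 * φ.size := by
  intro cl hcl
  constructor
  · have h1 : cl.length + 1 ≤ (φ.words.flatMap withLength).length := by
      rw [List.length_flatMap]
      exact List.single_le_sum (by simp) _ (List.mem_map.2 ⟨cl, hcl, rfl⟩)
    have h2 : φ.encode.length = (φ.words.flatMap withLength).length + 2 := by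
      rw [encode_eq]; simp [formulaWord]
    rw [size]; omega
  · intro l hl
    obtain ⟨cl', -, rfl⟩ := List.mem_map.1 hcl
    obtain ⟨⟨v, b⟩, -, rfl⟩ := List.mem_map.1 hl
    have := Bool.toNat_le b
    have := v.2
    have := φ.length_words_add_two_le
    simp only [size]
    omega

end CNF

/-- The circuit of a formula. -/
def CNF.circuit (φ : CNF) : Circuit :=
  satCircuit (2 ^ ((φ.vars + 1) / 2)) (2 * ((φ.vars + 1) / 2)) φ.words

/-- The matrix that is computed by the circuit of a formula. -/
def CNF.matrix (φ : CNF) :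
    Matrix (Fin (2 ^ ((φ.vars + 1) / 2))) (Fin (2 ^ ((φ.vars + 1) / 2) + 1)) Bool :=
  satMatrix (2 ^ ((φ.vars + 1) / 2)) (2 * ((φ.vars + 1) / 2)) φ.words

theorem CNF.satisfiable_iff_matrix (φ : CNF) :
    φ.Satisfiable ↔ ∃ i j, φ.matrix i j = false := by
  rw [CNF.satisfiable_iff (h := (φ.vars + 1) / 2) (by omega)]
  refine exists_congr fun y => ⟨?_, ?_⟩
  · rintro ⟨x, hx⟩
    -- Partial assignments are the columns below `N`. In the converse direction, column `N` consists
    -- of ones and cannot contain the zero.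
    refine ⟨x.castSucc, ?_⟩
    simp [CNF.matrix, satMatrix, hx, x.2.ne]
  · rintro ⟨x, hx⟩
    simp only [CNF.matrix, satMatrix, Bool.or_eq_false_iff, decide_eq_false_iff_not] at hx
    exact ⟨⟨x, by omega⟩, hx.2⟩

set_option maxHeartbeats 1000000 in
/-- An algorithm that rewrites circuits yields an algorithm that decides whether the rewritten circuit
of a formula differs from a circuit that adds up all inputs. -/
theorem exists_decider {Y : CircuitModel}
    (hY : ∀ {D : Circuit} {m n : ℕ} {A : Matrix (Fin m) (Fin n) Bool}, Y D A → D.inputs = n)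
    {ε : ℝ} (hε : 0 < ε) (hε1 : ε ≤ 1) (h : RewriteSolvable Circuit.OrComputes Y (2 - ε))
    {setMod gen : Prog} {Q : ℕ → ℕ} {u : (ℕ → Bool) → ℕ → ℕ}
    {coins : (ℕ → Bool) → ℕ → ℕ → Bool} (hcoins : ∀ ω, coins ω 0 = ω)
    (hQ : ∀ n, 0 < n → 0 < Q n ∧ Q n ≤ n + 2)
    (hset : ∀ (M n : ℕ) (s : State), n + 2 ≤ M → s.reg 14 = n → s.reg 17 = 1 →
      setMod.Within M s 1 fun s' => s'.mem = s.mem ∧ s'.coins = s.coins ∧ s'.reg 9 = Q n ∧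
        ∀ r, r ≠ 9 → s'.reg r = s.reg r)
    (hgen : ∀ (M n : ℕ) (ω : ℕ → Bool), 2 ≤ M → Generates M gen n (u ω) (coins ω))
    (hu : ∀ (ω : ℕ → Bool) (n i : ℕ), i < n → u ω i < Q n) :
    ∃ (P : Prog) (c : ℕ), P.Deterministic ∧ ∀ φ : CNF, ∃ D : Circuit, Y D φ.matrix ∧
      ∀ ω : ℕ → Bool, ∃ (t : ℕ) (s : State),
        (build ;; P ;; check setMod gen).Runs (init φ.encode ω) t s ∧
        (t : ℝ) ≤ c * (φ.size : ℝ) ^ c * (2 : ℝ) ^ ((1 - ε / 2) * φ.vars) ∧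
        s.mem 0 = if D.differs (Q D.inputs) (u ω) then 1 else 0 := by
  obtain ⟨P, c, hPdet, hP⟩ := h
  obtain ⟨c₀, hc₀⟩ := exists_nat_ge c
  -- With `E = 2 ^ ((1 - ε / 2) n)`, the constants come from the estimates below: `C0` bounds the
  -- length of the rewritten circuit in units of `S ^ 2 * E`, `C1` the numbers in `check`, `C2` the
  -- number of its instructions, and `C3` the total time.
  obtain ⟨C0, hC0⟩ : ∃ C0, C0 = 48 + 128 * c₀ := ⟨_, rfl⟩
  obtain ⟨C1, hC1⟩ : ∃ C1, C1 = 4 * C0 + 28 := ⟨_, rfl⟩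
  obtain ⟨C2, hC2⟩ : ∃ C2, C2 = 26 * C0 + 57 := ⟨_, rfl⟩
  obtain ⟨C3, hC3⟩ : ∃ C3, C3 = (1200 + C2) * (2 * (C1 + 3) + 3) + 64 * c₀ := ⟨_, rfl⟩
  refine ⟨P, C3, hPdet, fun φ => ?_⟩
  set n := φ.vars with hn
  set S := φ.size with hS
  set N := 2 ^ ((n + 1) / 2) with hN
  set L := φ.encode.length with hL
  set m := φ.words.length with hm
  have hmL : m + 2 ≤ L := φ.length_words_add_two_le
  have hSnL : S = n + L := rfl
  have hN1 : 1 ≤ N := Nat.one_le_two_pow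
  obtain ⟨E, hE⟩ : ∃ E : ℝ, E = (2 : ℝ) ^ ((1 - ε / 2) * (n : ℝ)) := ⟨_, rfl⟩
  obtain ⟨tP, sP, D, hrun, htime, hDwf, hDholds, hYD⟩ := hP φ.circuit
    (satCircuit_wellFormed hN1) (inputs_le_size_satCircuit _ _ _) _ _ φ.matrix
    (satCircuit_orComputes _ _ _)
  have hDin : D.inputs = N + 1 := hY hYD
  refine ⟨D, hYD, fun ω => ?_⟩
  -- estimates
  have hS1 : (1 : ℝ) ≤ S := by exact_mod_cast (show 1 ≤ S by omega)
  have hE1 : 1 ≤ E := hE ▸ Real.one_le_rpow (by norm_num) (mul_nonneg (by linarith) (Nat.cast_nonneg _))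
  have hNhalf : (N : ℝ) ≤ 2 * (2 : ℝ) ^ ((n : ℝ) / 2) := two_pow_half_le n
  have hNE : (N : ℝ) ≤ 2 * E := by
    refine hNhalf.trans ?_
    rw [hE]
    gcongr 2 * ?_
    refine Real.rpow_le_rpow_of_exponent_le (by norm_num) ?_
    have : (0 : ℝ) ≤ n := Nat.cast_nonneg _
    nlinarith
  have hES : E ≤ (2 : ℝ) ^ S := by
    rw [hE, ← Real.rpow_natCast]
    refine Real.rpow_le_rpow_of_exponent_le (by norm_num) ?_
    have h1 : (n : ℝ) ≤ S := by exact_mod_cast (show n ≤ S by omega)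
    exact (mul_le_of_le_one_left (Nat.cast_nonneg _) (by linarith)).trans h1
  have hSS : S ≤ 2 ^ S := Nat.lt_two_pow_self.le
  have hSSr : (S : ℝ) ≤ (2 : ℝ) ^ S := by exact_mod_cast hSS
  have hNS : N ≤ 2 ^ S := Nat.pow_le_pow_right (by omega) (by omega)
  have hsize : (φ.circuit.size : ℝ) ≤ 8 * S * (2 : ℝ) ^ ((n : ℝ) / 2) := by
    have h1 : φ.circuit.size ≤ 4 * (S * N) :=
      (size_satCircuit_le _ _ _).trans (size_bound_le hmL hSnL hN1)
    have h2 : (φ.circuit.size : ℝ) ≤ 4 * (S * N) := by exact_mod_cast h1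
    have h3 := mul_le_mul_of_nonneg_left hNhalf (show (0 : ℝ) ≤ 4 * S by positivity)
    linarith
  have htP : (tP : ℝ) ≤ 64 * c₀ * S ^ 2 * E := by
    have h1 := rpow_size_le hε hε1 (Nat.cast_nonneg _) hS1 hsize
    rw [← hE] at h1
    have h2 : (0 : ℝ) ≤ (φ.circuit.size : ℝ) ^ (2 - ε) := Real.rpow_nonneg (Nat.cast_nonneg _) _
    calc (tP : ℝ) ≤ c * (φ.circuit.size : ℝ) ^ (2 - ε) := htime
      _ ≤ c₀ * (φ.circuit.size : ℝ) ^ (2 - ε) := by gcongr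
      _ ≤ c₀ * (64 * S ^ 2 * E) := by gcongr
      _ = 64 * c₀ * S ^ 2 * E := by ring
  have hE0 : 0 ≤ E := zero_le_one.trans hE1
  have hS2 : (S : ℝ) ≤ S ^ 2 := le_self_pow₀ hS1 two_ne_zero
  have hS2E : 1 ≤ (S : ℝ) ^ 2 * E := one_le_mul_of_one_le_of_one_le (one_le_pow₀ hS1) hE1
  -- No bound on the size of the rewritten circuit is given; it follows from the time that was
  -- needed to write it.
  have hV : (D.encode.length : ℝ) ≤ C0 * (S ^ 2 * E) := by
    have h1 := length_encode_le_of_runs hrun hDwf (by omega) hDholds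
    have h2 : φ.circuit.encode.length ≤ 12 * (S * N) :=
      (length_encode_satCircuit _ _ _).trans (length_bound_le hmL hSnL hN1)
    have h3 : (D.encode.length : ℝ) ≤ 2 * (12 * (S * N) + tP) := by
      exact_mod_cast h1.trans (by omega)
    have h4 : (S : ℝ) * N ≤ S ^ 2 * (2 * E) := by gcongr
    rw [hC0]
    push_cast
    linarith
  -- `C1` is at most `2 ^ (C1 * S)`, and each of `S`, `N` and `E` is at most `2 ^ S`, so `M` exceeds
  -- every number in `build` and `check`, while `M.size` is only `O(S)`.
  obtain ⟨M, hM⟩ : ∃ M, M = 2 ^ ((C1 + 3) * S) := ⟨_, rfl⟩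
  have hC1S : C1 ≤ 2 ^ (C1 * S) :=
    Nat.lt_two_pow_self.le.trans (Nat.pow_le_pow_right (by omega)
      (Nat.le_mul_of_pos_right _ (by omega)))
  have hMeq : M = 2 ^ (C1 * S) * (2 ^ S * 2 ^ S * 2 ^ S) := by
    rw [hM, ← pow_add, ← pow_add, ← pow_add]; congr 1; ring
  have hMbuild : 2 * L + m * (N + 2) + N * (m + 2) + 3 * N + 2 * n + m + 2 * S + 20 ≤ M := by
    refine (build_bound_le hmL hSnL hN1).trans ?_
    rw [hMeq]
    calc 100 * (S * N) ≤ C1 * (S * N * 1) := by rw [mul_one]; gcongr; omega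
      _ ≤ 2 ^ (C1 * S) * (2 ^ S * 2 ^ S * 2 ^ S) := by
        gcongr
        exact Nat.one_le_two_pow
  have hMcheck : 4 * D.encode.length + 4 * N + 20 ≤ M := by
    have : ((4 * D.encode.length + 4 * N + 20 : ℕ) : ℝ) ≤ (M : ℝ) := by
      calc ((4 * D.encode.length + 4 * N + 20 : ℕ) : ℝ)
          = 4 * D.encode.length + 4 * N + 20 := by push_cast; ring
        _ ≤ C1 * (S ^ 2 * E) := by
          have : E ≤ (S : ℝ) ^ 2 * E := le_mul_of_one_le_left hE0 (one_le_pow₀ hS1)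
          rw [hC1]; push_cast
          linarith
        _ ≤ 2 ^ (C1 * S) * (((2 : ℝ) ^ S) ^ 2 * 2 ^ S) := by
          gcongr
          exact_mod_cast hC1S
        _ = M := by rw [hMeq]; push_cast; ring
    exact_mod_cast this
  -- the three programs
  obtain ⟨t1, s1, hrun1, ht1, rfl⟩ := build_within (M := M) (n := n) (K := 2 * S) ω rfl
    φ.words_le (by rw [← CNF.encode_eq]; exact hMbuild)
  rw [← CNF.encode_eq] at hrun1 ht1
  -- The run is given for the all-false bit sequence. Being deterministic, it exists for every `ω`
  -- and leaves all random bits to `check`.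
  have hrun2 := hrun.with_coins hPdet ω
  obtain ⟨hQ0, hQn⟩ := hQ D.inputs (by omega)
  obtain ⟨t3, s3, hrun3, ht3, h3⟩ := check_within (M := M) (Q := Q D.inputs)
    (s := { sP with coins := ω }) (u := u ω) (coins := coins ω) hDwf hDholds (hcoins ω).symm
    (fun s => hset M D.inputs s (by omega)) (hgen M _ ω (by omega)) (hu ω D.inputs) hQ0
    (by omega)
  refine ⟨_, s3, hrun1.seq (hrun2.seq hrun3), ?_, h3⟩
  rw [← hE]
  -- the time
  have hMsize : 1 + 2 * M.size ≤ (2 * (C1 + 3) + 3) * S := by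
    rw [hM, Nat.size_pow]
    have h1 : (2 * (C1 + 3) + 3) * S = 2 * ((C1 + 3) * S) + 3 * S := by ring
    omega
  have ht1' : (t1 : ℝ) ≤ 1200 * (S ^ 3 * E) * ((2 * (C1 + 3) + 3) * S) := by
    have h1 : t1 ≤ 600 * S ^ 3 * N * ((2 * (C1 + 3) + 3) * S) :=
      ht1.trans (Nat.mul_le_mul (build_steps_le hmL hSnL hN1) hMsize)
    have h2 : (t1 : ℝ) ≤ 600 * S ^ 3 * N * ((2 * (C1 + 3) + 3) * S) := by exact_mod_cast h1
    refine h2.trans ?_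
    have : 600 * (S : ℝ) ^ 3 * N ≤ 600 * (S : ℝ) ^ 3 * (2 * E) := by gcongr
    calc _ ≤ 600 * (S : ℝ) ^ 3 * (2 * E) * ((2 * (C1 + 3) + 3) * S) := by gcongr
      _ = _ := by ring
  have ht3' : (t3 : ℝ) ≤ C2 * (S ^ 2 * E) * ((2 * (C1 + 3) + 3) * S) := by
    have h1 : t3 ≤ (26 * D.encode.length + 9 * (N + 1) + 30) * ((2 * (C1 + 3) + 3) * S) := by
      rw [hDin] at ht3
      exact ht3.trans (Nat.mul_le_mul_left _ hMsize)
    have h2 : (t3 : ℝ) ≤ (26 * D.encode.length + 9 * (N + 1) + 30) *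
        ((2 * (C1 + 3) + 3) * S) := by exact_mod_cast h1
    refine h2.trans ?_
    gcongr
    have : E ≤ (S : ℝ) ^ 2 * E := le_mul_of_one_le_left hE0 (one_le_pow₀ hS1)
    rw [hC2]; push_cast
    linarith
  have hS3 : (S : ℝ) ^ 2 * E * S ≤ S ^ 4 * E := by
    have : (S : ℝ) ^ 3 ≤ S ^ 4 := pow_le_pow_right₀ hS1 (by omega)
    calc (S : ℝ) ^ 2 * E * S = S ^ 3 * E := by ring
      _ ≤ _ := by gcongr
  have hS4 : (S : ℝ) ^ 2 * E ≤ S ^ 4 * E := by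
    have : (S : ℝ) ^ 2 ≤ S ^ 4 := pow_le_pow_right₀ hS1 (by omega)
    gcongr
  calc ((t1 + (tP + t3) : ℕ) : ℝ) = t1 + (tP + t3) := by push_cast; ring
    _ ≤ 1200 * (2 * (C1 + 3) + 3) * (S ^ 4 * E) + (64 * c₀ * (S ^ 2 * E) +
        C2 * (2 * (C1 + 3) + 3) * (S ^ 2 * E * S)) := by linarith
    _ ≤ 1200 * (2 * (C1 + 3) + 3) * (S ^ 4 * E) + (64 * c₀ * (S ^ 4 * E) +
        C2 * (2 * (C1 + 3) + 3) * (S ^ 4 * E)) := by gcongr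
    _ = C3 * S ^ 4 * E := by rw [hC3]; push_cast; ring
    _ ≤ C3 * S ^ C3 * E := by
      gcongr
      -- The definition of the problem uses one constant as factor and as exponent, so `C3 ≥ 4` is
      -- needed.
      have h1 : 1200 * 3 ≤ (1200 + C2) * (2 * (C1 + 3) + 3) :=
        Nat.mul_le_mul (by omega) (by omega)
      omega

theorem Generates.const {M n : ℕ} {coins : ℕ → Bool} (hM : 2 ≤ M) :
    Generates M (.const 6 1) n (fun _ => 1) fun _ => coins := by
  intro i _ s hs
  exact Prog.Within.block (by decide) ⟨by omega, rfl, hs, by simp, fun r hr => by simp [hr]⟩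

theorem Generates.coin {M n : ℕ} {ω : ℕ → Bool} :
    Generates M (.coin 6) n (fun i => (ω i).toNat) fun i j => ω (i + j) := by
  intro i _ s hs
  refine Prog.Within.block (by decide) ⟨rfl, ?_, by simp [hs], fun r hr => by simp [hr]⟩
  funext j
  simp [hs, add_assoc, add_comm 1]

theorem deterministic_decider {P : Prog} (hP : P.Deterministic) :
    (build ;; P ;; check (.add 9 14 17) (.const 6 1)).Deterministic := by
  simp [build, prologue, emitCircuit, moveOutput, skipLists, nextList, emit, leftGates, rightGates,
    gate, openGate, closeGate, selectBody, testClause, testLit, shift, shiftBody, emitOutputs,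
    clearRegs, check, writeInputs, modAdd, evalGates, evalGate, loadValue, testOutputs,
    Prog.Deterministic, hP]

theorem kSatSolvable_of_rewriteSolvable {ε : ℝ} (hε : 0 < ε) (hε1 : ε ≤ 1)
    (h : RewriteSolvable Circuit.OrComputes Circuit.SumComputes (2 - ε)) (k : ℕ) :
    KSatSolvable k (1 - ε / 2) := by
  obtain ⟨P, c, hP, hc⟩ := exists_decider (Y := Circuit.SumComputes) (fun hD => hD.1) hε hε1 h
    (setMod := .add 9 14 17) (gen := .const 6 1) (Q := fun n => n + 1) (u := fun _ _ => 1)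
    (coins := fun ω _ => ω) (fun _ => rfl) (fun n _ => ⟨by omega, by omega⟩)
    (fun M n s hM h14 h17 => Prog.Within.block (by decide)
      ⟨by omega, by omega, rfl, rfl, by simp [h14, h17], fun r hr => by simp [hr]⟩)
    (fun M n ω hM => Generates.const hM) (fun ω n i hi => by omega)
  refine ⟨_, c, deterministic_decider hP, fun φ _ => ?_⟩
  obtain ⟨D, hD, hrun⟩ := hc φ
  obtain ⟨t, s, h1, h2, h3⟩ := hrun fun _ => false
  have hiff := hD.differs_iff
  rw [← φ.satisfiable_iff_matrix] at hiff
  refine ⟨t, s, h1, h2, fun hs => ?_, fun hs => ?_⟩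
  · rw [h3, if_pos (hiff.2 hs)]
  · rw [h3, if_neg fun hd => hs (hiff.1 hd)]

/-- The error is one-sided: for an unsatisfiable formula the matrix is all ones, so every output
equals the sum of the inputs for every outcome of the random bits. -/
theorem kSatSolvableRandomized_of_rewriteSolvable {ε : ℝ} (hε : 0 < ε) (hε1 : ε ≤ 1)
    (h : RewriteSolvable Circuit.OrComputes Circuit.XorComputes (2 - ε)) (k : ℕ) :
    KSatSolvableRandomized k (1 - ε / 2) := by
  obtain ⟨P, c, hP, hc⟩ := exists_decider (Y := Circuit.XorComputes) (fun hD => hD.1) hε hε1 h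
    (setMod := .const 9 2) (gen := .coin 6) (Q := fun _ => 2) (u := fun ω i => (ω i).toNat)
    (coins := fun ω i j => ω (i + j)) (fun ω => by simp) (fun n hn => ⟨by omega, by omega⟩)
    (fun M n s hM h14 h17 => Prog.Within.block (by decide)
      ⟨by omega, rfl, rfl, by simp, fun r hr => by simp [hr]⟩)
    (fun M n ω hM => Generates.coin) (fun ω n i hi => Nat.lt_succ_of_le (Bool.toNat_le _))
  refine ⟨build ;; P ;; check (.const 9 2) (.coin 6), c, fun φ _ => ?_⟩
  obtain ⟨D, hD, hrun⟩ := hc φ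
  refine ⟨fun ω => ?_, fun hs => ?_⟩
  · obtain ⟨t, s, h1, h2, h3⟩ := hrun ω
    refine ⟨t, s, h1, h2, ?_, fun hs => ?_⟩
    · rw [h3]
      split_ifs <;> simp
    · rw [h3, if_neg]
      rw [hD.differs_iff]
      rintro ⟨i, hi⟩
      refine hi (Finset.sum_congr rfl fun j _ => ?_)
      by_cases hA : φ.matrix i j = true
      · simp [hA]
      · exact absurd (φ.satisfiable_iff_matrix.2 ⟨i, j, by simpa using hA⟩) hs
  · obtain ⟨i, j, hA⟩ := φ.satisfiable_iff_matrix.1 hs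
    refine (hD.half_le_differs hA).trans (measure_mono fun ω hω => ?_)
    obtain ⟨t, s, h1, -, h3⟩ := hrun ω
    exact ⟨t, s, h1, by rw [h3]; exact if_pos (by simpa using hω)⟩

theorem theorem4 :
    (SETH → ¬ ∃ ε : ℝ, 0 < ε ∧
      RewriteSolvable Circuit.OrComputes Circuit.SumComputes (2 - ε)) ∧
    (RandomizedSETH → ¬ ∃ ε : ℝ, 0 < ε ∧
      RewriteSolvable Circuit.OrComputes Circuit.XorComputes (2 - ε)) := by
  constructor
  · rintro hseth ⟨ε, hε, h⟩
    -- Only `ε ≤ 1` is treated by the estimates; a larger `ε` gives a stronger time bound, which may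
    -- be weakened.
    have hε' : 0 < min ε 1 := lt_min hε one_pos
    obtain ⟨k, hk⟩ := hseth (min ε 1 / 2) (half_pos hε')
    exact hk (kSatSolvable_of_rewriteSolvable hε' (min_le_right _ _)
      (h.mono (by linarith [min_le_left ε 1])) k)
  · rintro hseth ⟨ε, hε, h⟩
    have hε' : 0 < min ε 1 := lt_min hε one_pos
    obtain ⟨k, hk⟩ := hseth (min ε 1 / 2) (half_pos hε')
    exact hk (kSatSolvableRandomized_of_rewriteSolvable hε' (min_le_right _ _)
      (h.mono (by linarith [min_le_left ε 1])) k)
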